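/- Let $X$ be an irreducible smooth complex projective variety of dimension $n\ge 3$, let $L$ be an ample line bundle on $X$ and let $V\subseteq H^0(X,L)$ be a vector subspace spanning $L$. For a line bundle $M$ on a smooth projective variety $Y$ and a vector subspace $W\subseteq H^0(Y,M)$, let $\mathcal D(Y,W)\subseteq |W|=\mathbb P(W)$ be the discriminant locus, i.e. the set of all $[s]$ such that $s_y\in\mathfrak m_y^2M_y$ (equivalently $j_1(s)(y)=0$) for some closed point $y\in Y$, and put $\mathrm{def}(Y,W)=\dim|W|-1-\dim\mathcal D(Y,W)$, where $\dim|W|=\dim W-1$ and $\dim\emptyset=-1$; write $\mathrm{def}(Y,M)=\mathrm{def}(Y,H^0(Y,M))$. An effective divisor $E\subset X$ is a $(-1)$-hyperplane of $(X,L)$ if $E\simeq\mathbb P^{n-1}$, $L|_E\simeq\mathcal O_E(1)$ and $\mathcal O_X(E)|_E\simeq\mathcal O_E(-1)$. Let $(X',L')$ be a reduction of $(X,L)$: $X'$ is a smooth projective variety of dimension $n$, $L'$ is an ample line bundle on $X'$, and there is a morphism $\sigma:X\to X'$ which is the blowing up of $X'$ at finitely many (possibly zero) distinct points $p_1,\dots,p_s$,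 such that $L\simeq\sigma^*L'\otimes\mathcal O_X(-E)$ with $E=E_1+\dots+E_s$, $E_i=\sigma^{-1}(p_i)$, and such that every $(-1)$-hyperplane of $(X,L)$ is one of the $E_i$. Then $\mathrm{def}(X,V)\le\mathrm{def}(X',L')$; in particular $\mathrm{def}(X,L)\le\mathrm{def}(X',L')$. Moreover, the image under $\sigma$ of every smooth member of $|L|$ is a smooth member of $|L'|$: for every non-zero $s\in H^0(X,L)$ whose first jet vanishes at no closed point there is a non-zero $s'\in H^0(X',L')$ whose first jet vanishes at no closed point and whose zero locus is the image under $\sigma$ of the zero locus of $s$. -/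

import Mathlib

open CategoryTheory AlgebraicGeometry

noncomputable section

namespace DiscriminantDefect

/-! ### Line bundles and their sections -/

/-- The stalk of a sheaf of modules is a module over the stalk of the structure sheaf. -/
instance stalkModule {X : Scheme.{0}} (M : X.Modules) (x : X) :
    Module (X.presheaf.stalk x) (M.presheaf.stalk x) :=
  let P : PresheafOfModules.{0} (X.presheaf ⋙ forget₂ CommRingCat RingCat) := M.val
  inferInstanceAs (Module (X.presheaf.stalk x) (TopCat.Presheaf.stalk (C := Ab) P.presheaf x))

/-- The structure sheaf, as a module over itself. -/
def structureModule (X : Scheme.{0}) : X.Modules := SheafOfModules.unit X.ringCatSheaf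

/-- A line bundle (invertible sheaf): locally isomorphic to the structure sheaf. -/
def IsLineBundle {X : Scheme.{0}} (L : X.Modules) : Prop :=
  ∀ x : X, ∃ U : X.Opens, x ∈ U ∧
    Nonempty (L.restrict U.ι ≅ structureModule (U : Scheme.{0}))

/-- The tensor product of sheaves of modules: the sheafification of the tensor product of
presheaves of modules. -/
def tensor {X : Scheme.{0}} (M N : X.Modules) : X.Modules :=
  (PresheafOfModules.sheafification (𝟙 X.ringCatSheaf.obj)).obj
    (MonoidalCategory.tensorObj
      (C := PresheafOfModules.{0} (X.presheaf ⋙ forget₂ CommRingCat RingCat)) M.val N.val)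

/-- The tensor powers `M ^ ⊗ m`. -/
def tensorPow {X : Scheme.{0}} (M : X.Modules) : ℕ → X.Modules
  | 0 => structureModule X
  | m + 1 => tensor M (tensorPow M m)

/-- A global section `s` vanishes at `x` if its germ lies in `𝔪_x M_x`. -/
def VanishesAt {X : Scheme.{0}} {M : X.Modules} (s : Γ(M, ⊤)) (x : X) : Prop :=
  M.presheaf.germ ⊤ x trivial s ∈
    (IsLocalRing.maximalIdeal (X.presheaf.stalk x)) •
      (⊤ : Submodule (X.presheaf.stalk x) (M.presheaf.stalk x))

/-- The first jet of `s` at `x` is zero: the germ of `s` lies in `𝔪_x ^ 2 M_x`. -/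
def JetVanishesAt {X : Scheme.{0}} {M : X.Modules} (s : Γ(M, ⊤)) (x : X) : Prop :=
  M.presheaf.germ ⊤ x trivial s ∈
    ((IsLocalRing.maximalIdeal (X.presheaf.stalk x)) ^ 2) •
      (⊤ : Submodule (X.presheaf.stalk x) (M.presheaf.stalk x))

/-- Ampleness of a line bundle (on a quasi-compact scheme): the affine open sets of the form
`X_s`, with `s` a global section of a positive tensor power, cover `X`. -/
def IsAmple {X : Scheme.{0}} (L : X.Modules) : Prop :=
  ∀ x : X, ∃ m : ℕ, 0 < m ∧ ∃ s : Γ(tensorPow L m, ⊤), ∃ U : X.Opens,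
    IsAffineOpen U ∧ x ∈ U ∧ ∀ y : X, y ∈ U ↔ ¬ VanishesAt s y

/-! ### Varieties over the complex numbers -/

/-- The spectrum of the complex numbers. -/
abbrev SpecC : Scheme.{0} := Spec (CommRingCat.of ℂ)

attribute [local instance] MvPolynomial.gradedAlgebra

/-- Projective space of dimension `N` over `ℂ`, as the `Proj` of the polynomial ring. -/
def projectiveSpace (N : ℕ) : Scheme.{0} :=
  Proj (MvPolynomial.homogeneousSubmodule (Fin (N + 1)) ℂ)

/-- The structure morphism of projective space. -/
def projectiveSpaceToSpecC (N : ℕ) : projectiveSpace N ⟶ SpecC :=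
  Proj.toSpecZero (MvPolynomial.homogeneousSubmodule (Fin (N + 1)) ℂ) ≫
    Spec.map (CommRingCat.ofHom
      (algebraMap ℂ (MvPolynomial.homogeneousSubmodule (Fin (N + 1)) ℂ 0)))

/-- `X` is an irreducible smooth complex projective variety of dimension `n`. -/
structure IsSmoothProjectiveVariety {X : Scheme.{0}} (f : X ⟶ SpecC) (n : ℕ) : Prop where
  isIntegral : IsIntegral X
  smooth : SmoothOfRelativeDimension n f
  projective : ∃ (N : ℕ) (i : X ⟶ projectiveSpace N),
    IsClosedImmersion i ∧ i ≫ projectiveSpaceToSpecC N = f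

/-- The ring homomorphism from `ℂ` to the functions on an open subset of a complex scheme. -/
def scalars {X : Scheme.{0}} (f : X ⟶ SpecC) (U : X.Opens) : ℂ →+* Γ(X, U) :=
  ((Scheme.ΓSpecIso (CommRingCat.of ℂ)).inv ≫ f.appTop ≫ X.presheaf.map (homOfLE le_top).op).hom

/-- The complex vector space `H⁰(X, M)`. -/
def H0 {X : Scheme.{0}} (_f : X ⟶ SpecC) (M : X.Modules) : Type := Γ(M, ⊤)

instance {X : Scheme.{0}} (f : X ⟶ SpecC) (M : X.Modules) : AddCommGroup (H0 f M) :=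
  inferInstanceAs (AddCommGroup Γ(M, ⊤))

instance {X : Scheme.{0}} (f : X ⟶ SpecC) (M : X.Modules) : Module ℂ (H0 f M) :=
  letI : Module Γ(X, ⊤) (H0 f M) := inferInstanceAs (Module Γ(X, ⊤) Γ(M, ⊤))
  Module.compHom (H0 f M) (scalars f ⊤)

/-- The section of `M` underlying an element of `H⁰(X, M)`. -/
def H0.toSection {X : Scheme.{0}} {f : X ⟶ SpecC} {M : X.Modules} (s : H0 f M) : Γ(M, ⊤) := s

/-- The vector subspace `V ⊆ H⁰(X, L)` spans `L`: its germs generate every stalk. -/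
def Spans {X : Scheme.{0}} {f : X ⟶ SpecC} {L : X.Modules} (V : Submodule ℂ (H0 f L)) : Prop :=
  ∀ x : X, Submodule.span (X.presheaf.stalk x)
    {g : L.presheaf.stalk x | ∃ s ∈ V, g = L.presheaf.germ ⊤ x trivial s.toSection} = ⊤

/-- The zero locus of a section, as a set of points: the support of the divisor it defines. -/
def zeroLocus {X : Scheme.{0}} {f : X ⟶ SpecC} {L : X.Modules} (s : H0 f L) : Set X :=
  {x | VanishesAt s.toSection x}

/-- The section `s` is singular: its first jet vanishes at some closed point. (For `s ≠ 0` this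
says that the member of `|L|` defined by `s` is singular.) -/
def IsSingular {X : Scheme.{0}} {f : X ⟶ SpecC} {L : X.Modules} (s : H0 f L) : Prop :=
  ∃ x : X, IsClosed {x} ∧ JetVanishesAt s.toSection x

/-! ### The discriminant locus and the defect -/

/-- The Zariski topology on the projective space `ℙ(V)` of lines in `V`: the non-vanishing loci
of homogeneous polynomials in linear forms on `V` are a basis of open sets. -/
@[reducible]
def zariskiTopology (V : Type) [AddCommGroup V] [Module ℂ V] :
    TopologicalSpace (Projectivization ℂ V) :=
  TopologicalSpace.generateFrom
    {S | ∃ (d : ℕ) (p : MvPolynomial (Module.Dual ℂ V) ℂ), p.IsHomogeneous d ∧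
      S = {q | MvPolynomial.eval (fun l : Module.Dual ℂ V => l q.rep) p ≠ 0}}

/-- The dimension of a subset of `ℙ(V)` in the Zariski topology, with `dim ∅ = -1`. -/
def projDim {V : Type} [AddCommGroup V] [Module ℂ V] (D : Set (Projectivization ℂ V)) : ℤ :=
  letI := zariskiTopology V
  if D = ∅ then -1 else (((topologicalKrullDim D).unbotD 0).toNat : ℤ)

/-- The discriminant locus `𝒟(X, V) ⊆ |V| = ℙ(V)`: the image of the incidence correspondence
`{(x, [s]) : j₁(s)(x) = 0}`. -/
def discriminantLocus {X : Scheme.{0}} {f : X ⟶ SpecC} {L : X.Modules}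
    (V : Submodule ℂ (H0 f L)) : Set (Projectivization ℂ V) :=
  {q | ∃ s : V, s ∈ q.submodule ∧ s ≠ 0 ∧ IsSingular (s : H0 f L)}

/-- The discriminant defect `dim |V| - 1 - dim 𝒟(X, V)`, where `dim |V| = dim V - 1`. -/
def defect {X : Scheme.{0}} {f : X ⟶ SpecC} {L : X.Modules} (V : Submodule ℂ (H0 f L)) : ℤ :=
  ((Module.finrank ℂ V : ℤ) - 1) - 1 - projDim (discriminantLocus V)

/-! ### Blowing up and reductions -/

/-- An ideal sheaf defines an effective Cartier divisor: locally it is generated by one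
non-zero-divisor. -/
def IsEffectiveCartier {X : Scheme.{0}} (I : X.IdealSheafData) : Prop :=
  ∀ x : X, ∃ U : X.affineOpens, x ∈ U.1 ∧
    ∃ t ∈ nonZeroDivisors Γ(X, U.1), I.ideal U = Ideal.span {t}

/-- `σ : X ⟶ Y` is the blowing up of `Y` along the closed subscheme defined by `I`: the inverse
image ideal sheaf is that of an effective Cartier divisor, and `σ` is universal for this. -/
structure IsBlowup {X Y : Scheme.{0}} (σ : X ⟶ Y) (I : Y.IdealSheafData) : Prop where
  isEffectiveCartier : IsEffectiveCartier (I.comap σ)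
  existsUnique_lift : ∀ {T : Scheme.{0}} (g : T ⟶ Y), IsEffectiveCartier (I.comap g) →
    ∃! h : T ⟶ X, h ≫ σ = g

/-- `(E, M)` is isomorphic to `(ℙ^m, 𝒪(1))`: there are sections `x₀, …, x_m` of `M`, whose
non-vanishing loci `U_i` cover `E`, such that `U_i` is the affine space with coordinates the
quotients `x_j / x_i`, `j ≠ i`. -/
def IsProjectiveSpaceO1 {E : Scheme.{0}} (g : E ⟶ SpecC) (M : E.Modules) (m : ℕ) : Prop :=
  IsLineBundle M ∧ ∃ (x : Fin (m + 1) → Γ(M, ⊤)) (U : Fin (m + 1) → E.Opens),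
    (∀ e : E, ∃ i, e ∈ U i) ∧
    ∀ i, IsAffineOpen (U i) ∧ (∀ e : E, e ∈ U i ↔ ¬ VanishesAt (x i) e) ∧
      ∃ φ : MvPolynomial {j : Fin (m + 1) // j ≠ i} ℂ ≃+* Γ(E, U i),
        (∀ c : ℂ, φ (MvPolynomial.C c) = scalars g (U i) c) ∧
        ∀ j : {j : Fin (m + 1) // j ≠ i},
          M.presheaf.map (homOfLE (le_top : U i ≤ ⊤)).op (x j) =
            φ (MvPolynomial.X j) • M.presheaf.map (homOfLE (le_top : U i ≤ ⊤)).op (x i)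

/-- `j : J ⟶ 𝒪_X` identifies `J` with the ideal sheaf `𝒪_X(-E)` of `i : E ⟶ X`. -/
def IsIdealModule {X E : Scheme.{0}} (i : E ⟶ X) (J : X.Modules)
    (j : J ⟶ structureModule X) : Prop :=
  ∀ U : X.Opens, Function.Injective (j.app U) ∧
    ∀ a : Γ(X, U), (∃ b : Γ(J, U), j.app U b = a) ↔ i.app U a = 0

/-- The closed subscheme `i : E ⟶ X` is a `(-1)`-hyperplane of `(X, L)`, where `dim X = n`: it is
an effective divisor with `E ≅ ℙ^(n-1)`, `L|_E ≅ 𝒪_E(1)` and `𝒪_X(E)|_E ≅ 𝒪_E(-1)`; the last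
condition is expressed as `𝒪_X(-E)|_E ≅ 𝒪_E(1)`. -/
def IsMinusOneHyperplane {X E : Scheme.{0}} (f : X ⟶ SpecC) (L : X.Modules) (n : ℕ)
    (i : E ⟶ X) : Prop :=
  IsClosedImmersion i ∧
  IsProjectiveSpaceO1 (i ≫ f) ((Scheme.Modules.pullback i).obj L) (n - 1) ∧
  ∃ (J : X.Modules) (j : J ⟶ structureModule X), IsLineBundle J ∧ IsIdealModule i J j ∧
    IsProjectiveSpaceO1 (i ≫ f) ((Scheme.Modules.pullback i).obj J) (n - 1)

/-- `L ≅ N ⊗ 𝒪_X(-E)`, with `I` the ideal sheaf `𝒪_X(-E)`: there is an isomorphism of `L` with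
the submodule `I N` of the line bundle `N`. -/
def IsTwistByIdeal {X : Scheme.{0}} (L N : X.Modules) (I : X.IdealSheafData) : Prop :=
  ∃ ι : L ⟶ N, ∀ U : X.affineOpens, Function.Injective (ι.app U.1) ∧
    ∀ b : Γ(N, U.1), (∃ a : Γ(L, U.1), ι.app U.1 a = b) ↔
      b ∈ I.ideal U • (⊤ : Submodule Γ(X, U.1) Γ(N, U.1))

/-- `(X', L')`, with the contraction `σ : X ⟶ X'`, is a reduction of `(X, L)`, `dim X = n`:
`(X', L')` is a smooth polarized variety, `σ` is the blowing up of `X'` at a finite set `Z` of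
points, `L = σ^* L' - E` for the total exceptional divisor `E`, and every `(-1)`-hyperplane of
`(X, L)` is contracted, i.e. it is the exceptional divisor over one of the points. -/
structure IsReduction {X X' : Scheme.{0}} (f : X ⟶ SpecC) (L : X.Modules)
    (f' : X' ⟶ SpecC) (L' : X'.Modules) (n : ℕ) (σ : X ⟶ X') : Prop where
  comp_eq : σ ≫ f' = f
  isSmoothProjectiveVariety : IsSmoothProjectiveVariety f' n
  isLineBundle : IsLineBundle L'
  isAmple : IsAmple L'
  exists_center : ∃ Z : TopologicalSpace.Closeds X',
    (Z : Set X').Finite ∧ (∀ p ∈ Z, IsClosed {p}) ∧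
    IsBlowup σ (Scheme.IdealSheafData.vanishingIdeal Z) ∧
    IsTwistByIdeal L ((Scheme.Modules.pullback σ).obj L')
      ((Scheme.IdealSheafData.vanishingIdeal Z).comap σ) ∧
    ∀ {E : Scheme.{0}} (i : E ⟶ X), IsMinusOneHyperplane f L n i →
      ∃ p ∈ Z, Set.range i = σ ⁻¹' {p}

end DiscriminantDefect

end

namespace DiscriminantDefect

/-! ### Frames of line bundles -/

/-! Since L = σ^*L' ⊗ 𝒪(-E), multiplication by the equation of E embeds H⁰(X, L) in H⁰(X, σ^*L').
The latter is H⁰(X', L'), because σ_*𝒪_X = 𝒪_X': functions extend over points of a smooth variety of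
dimension at least two. The result is an injective linear map φ : H⁰(X, L) → H⁰(X', L')
(`IsReduction.exists_linearMap`).

Geometry: if φ(s) is singular, so is s. Off the centre σ is an isomorphism and jets correspond
(`IsTwistHom.off_center`). At a centre p (`IsTwistHom.on_center`), let a be the local equation of
φ(s) and t_i coordinates at p. On X one has a = cκ, with κ an equation of E and c an equation of s.
If a ∈ 𝔪_p², its quadratic part has a non-trivial zero v over ℂ. At the point of E in the direction
v, c = κd with κ and d both vanishing, so s is singular there. A zero of the linear part of a
likewise gives a point over p where s vanishes, so σ maps the zero locus of s onto that of φ(s). The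
point in the direction v is found by lifting a curve with tangent v through the universal property
(`IsBlowup.exists_point_over`), so no explicit charts of the blowing up are needed.

Linear algebra: let D and D' be the discriminants in ℙ(V) and ℙ(W), with W = H⁰(X', L'). If dim D =
d - 1, some d linear forms have no common zero on D (`exists_forms`). Their common kernel Λ has
codimension at most d in V, and ℙ(φ(Λ)) misses D'. A closed set missing a linear subspace of
codimension e has dimension less than e (`length_lt_of_forms`), so dim D' < dim W - dim V + d, which
is the inequality of defects. This needs W finite-dimensional (`IsLineBundle.finiteDimensional_H0`,
through valuation rings) and D' closed (`isClosed_discriminantLocus`, through elimination theory on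
a proper variety). -/

theorem germ_smul' {X : Scheme.{0}} (M : X.Modules) (x : X) (U : X.Opens) (hx : x ∈ U)
    (r : Γ(X, U)) (m : Γ(M, U)) :
    M.presheaf.germ U x hx (r • m) = X.presheaf.germ U x hx r • M.presheaf.germ U x hx m :=
  PresheafOfModules.germ_smul (R := X.presheaf) M.val x U hx r m

/-- Restriction of sections. -/
noncomputable abbrev res {X : Scheme.{0}} {M : X.Modules} {U W : X.Opens} (h : W ≤ U)
    (s : Γ(M, U)) : Γ(M, W) := M.presheaf.map (homOfLE h).op s

/-- Restriction of functions. -/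
noncomputable abbrev fres {X : Scheme.{0}} {U W : X.Opens} (h : W ≤ U) : Γ(X, U) →+* Γ(X, W) :=
  (X.presheaf.map (homOfLE h).op).hom

theorem res_res {X : Scheme.{0}} {M : X.Modules} {U V W : X.Opens} (h : V ≤ U) (h' : W ≤ V)
    (s : Γ(M, U)) : res h' (res h s) = res (h'.trans h) s := by
  simp only [res, ← ConcreteCategory.comp_apply, ← Functor.map_comp]
  rfl

theorem fres_fres {X : Scheme.{0}} {U V W : X.Opens} (h : V ≤ U) (h' : W ≤ V)
    (s : Γ(X, U)) : fres h' (fres h s) = fres (h'.trans h) s := by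
  simp only [fres, ← CommRingCat.comp_apply, ← Functor.map_comp]
  rfl

theorem res_smul {X : Scheme.{0}} {M : X.Modules} {U W : X.Opens} (h : W ≤ U) (a : Γ(X, U))
    (s : Γ(M, U)) : res h (a • s) = fres h a • res h s :=
  Scheme.Modules.map_smul M (homOfLE h) a s

theorem app_res {X : Scheme.{0}} {M N : X.Modules} (φ : M ⟶ N) {U W : X.Opens} (h : W ≤ U)
    (s : Γ(M, U)) : φ.app W (res h s) = res h (φ.app U s) :=
  congr($(φ.mapPresheaf.naturality (homOfLE h).op) s)

theorem germ_res' {X : Scheme.{0}} {M : X.Modules} {U W : X.Opens} (h : W ≤ U) (x : X)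
    (hx : x ∈ W) (s : Γ(M, U)) :
    M.presheaf.germ W x hx (res h s) = M.presheaf.germ U x (h hx) s :=
  TopCat.Presheaf.germ_res_apply M.presheaf (homOfLE h) x hx s

theorem germ_fres {X : Scheme.{0}} {U W : X.Opens} (h : W ≤ U) (x : X)
    (hx : x ∈ W) (s : Γ(X, U)) :
    X.presheaf.germ W x hx (fres h s) = X.presheaf.germ U x (h hx) s :=
  TopCat.Presheaf.germ_res_apply X.presheaf (homOfLE h) x hx s

/-- A frame of a sheaf of modules on an open set: a section that is freely generating on every
smaller open set. -/
def IsFrame {X : Scheme.{0}} {M : X.Modules} {U : X.Opens} (e : Γ(M, U)) : Prop :=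
  ∀ (W : X.Opens) (h : W ≤ U), Function.Bijective (fun a : Γ(X, W) ↦ a • res h e)

theorem IsFrame.restrict {X : Scheme.{0}} {M : X.Modules} {U V : X.Opens} {e : Γ(M, U)}
    (he : IsFrame e) (h : V ≤ U) : IsFrame (res h e) := by
  intro W hW
  simpa only [res_res] using he W (hW.trans h)

theorem IsFrame.exists_eq_smul {X : Scheme.{0}} {M : X.Modules} {U : X.Opens} {e : Γ(M, U)}
    (he : IsFrame e) {W : X.Opens} (h : W ≤ U) (s : Γ(M, W)) :
    ∃ a : Γ(X, W), s = a • res h e :=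
  let ⟨a, ha⟩ := (he W h).2 s; ⟨a, ha.symm⟩

/-- The germ of a frame is a basis of the stalk, so I M_x consists of the multiples of that germ by
I. Vanishing and jet vanishing thereby become conditions on the coefficient function alone. -/
theorem IsFrame.smul_germ_mem_iff {X : Scheme.{0}} {M : X.Modules} {U : X.Opens} {e : Γ(M, U)}
    (he : IsFrame e) (x : X) (hx : x ∈ U) (a : X.presheaf.stalk x)
    (I : Ideal (X.presheaf.stalk x)) :
    a • M.presheaf.germ U x hx e ∈ I • (⊤ : Submodule (X.presheaf.stalk x) (M.presheaf.stalk x))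
      ↔ a ∈ I := by
  have hinj : ∀ a : X.presheaf.stalk x, a • M.presheaf.germ U x hx e = 0 → a = 0 := by
    intro a ha
    obtain ⟨W, hW, hxW, b, rfl⟩ := X.presheaf.exists_le_germ_eq a hx
    rw [← germ_res' hW x hxW, ← germ_smul',
      ← map_zero (ConcreteCategory.hom (M.presheaf.germ W x hxW))] at ha
    obtain ⟨W', hxW', i, j, h⟩ := M.presheaf.germ_eq x hxW hxW _ _ ha
    have hi : W' ≤ W := leOfHom i
    have h1 : fres hi b • res (hi.trans hW) e = 0 := by
      rw [← res_res hW hi, ← res_smul]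
      exact h.trans (map_zero _)
    have h2 : fres hi b = 0 := by
      apply (he W' (hi.trans hW)).1
      simpa using h1
    rw [← germ_fres hi x hxW']
    exact (congrArg _ h2).trans (map_zero _)
  have hsurj : ∀ m : M.presheaf.stalk x, ∃ a : X.presheaf.stalk x,
      a • M.presheaf.germ U x hx e = m := by
    intro m
    obtain ⟨W, hW, hxW, b, rfl⟩ := M.presheaf.exists_le_germ_eq m hx
    obtain ⟨a, rfl⟩ := he.exists_eq_smul hW b
    exact ⟨X.presheaf.germ W x hxW a, by rw [germ_smul', germ_res']⟩
  constructor
  · intro h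
    have : ∀ m ∈ I • (⊤ : Submodule (X.presheaf.stalk x) (M.presheaf.stalk x)),
        ∃ b ∈ I, m = b • M.presheaf.germ U x hx e := by
      intro m hm
      refine Submodule.smul_induction_on hm ?_ ?_
      · intro r hr m _
        obtain ⟨c, rfl⟩ := hsurj m
        exact ⟨r * c, I.mul_mem_right _ hr, by rw [mul_smul]⟩
      · rintro _ _ ⟨b, hb, rfl⟩ ⟨c, hc, rfl⟩
        exact ⟨b + c, I.add_mem hb hc, by rw [add_smul]⟩
    obtain ⟨b, hb, hab⟩ := this _ h
    have : a = b := sub_eq_zero.mp (hinj _ (by rw [sub_smul, hab, sub_self]))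
    rwa [this]
  · intro h
    exact Submodule.smul_mem_smul h trivial

theorem IsFrame.vanishesAt_iff {X : Scheme.{0}} {M : X.Modules} {U : X.Opens} {e : Γ(M, U)}
    (he : IsFrame e) {x : X} (hx : x ∈ U) {s : Γ(M, ⊤)} {a : Γ(X, U)}
    (h : res le_top s = a • e) :
    VanishesAt s x ↔ X.presheaf.germ U x hx a ∈
      IsLocalRing.maximalIdeal (X.presheaf.stalk x) := by
  rw [VanishesAt, ← germ_res' le_top x hx, h, germ_smul', he.smul_germ_mem_iff]

theorem IsFrame.jetVanishesAt_iff {X : Scheme.{0}} {M : X.Modules} {U : X.Opens} {e : Γ(M, U)}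
    (he : IsFrame e) {x : X} (hx : x ∈ U) {s : Γ(M, ⊤)} {a : Γ(X, U)}
    (h : res le_top s = a • e) :
    JetVanishesAt s x ↔ X.presheaf.germ U x hx a ∈
      IsLocalRing.maximalIdeal (X.presheaf.stalk x) ^ 2 := by
  rw [JetVanishesAt, ← germ_res' le_top x hx, h, germ_smul', he.smul_germ_mem_iff]

/-- A function, as a section of the structure sheaf viewed as a module over itself. -/
def toStructure {X : Scheme.{0}} {U : X.Opens} (a : Γ(X, U)) : Γ(structureModule X, U) := a

theorem toStructure_bijective {X : Scheme.{0}} (U : X.Opens) :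
    Function.Bijective (toStructure (X := X) (U := U)) := Function.bijective_id

theorem toStructure_mul {X : Scheme.{0}} {U : X.Opens} (a b : Γ(X, U)) :
    toStructure (a * b) = a • toStructure b := rfl

theorem res_toStructure {X : Scheme.{0}} {U W : X.Opens} (h : W ≤ U) (a : Γ(X, U)) :
    res h (toStructure a) = toStructure (fres h a) := rfl

/-! ### Frames, restriction to open subschemes and pullback. -/

theorem restrict_smul {X : Scheme.{0}} {M : X.Modules} {U : X.Opens}
    {W : (U : Scheme.{0}).Opens} (a : Γ((U : Scheme.{0}), W)) (m : Γ(M.restrict U.ι, W)) :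
    (M.restrictAppIso U.ι W).hom (a • m) =
      (U.ι.appIso W).inv a • (M.restrictAppIso U.ι W).hom m := rfl

theorem restrict_res {X : Scheme.{0}} {M : X.Modules} {U : X.Opens}
    {W W' : (U : Scheme.{0}).Opens} (h : W ≤ W') (m : Γ(M.restrict U.ι, W')) :
    (M.restrictAppIso U.ι W).hom (res h m) =
      res (U.ι.image_mono h) ((M.restrictAppIso U.ι W').hom m) := rfl

/-- The section of `M` on `U` corresponding to the section `1` under an isomorphism of the structure
sheaf of `U` with `M|_U` is a frame. -/
theorem isFrame_of_isIso {X : Scheme.{0}} {M : X.Modules} {U : X.Opens}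
    (φ : structureModule (U : Scheme.{0}) ⟶ M.restrict U.ι) [IsIso φ] (e : Γ(M, U))
    (he : (M.restrictAppIso U.ι ⊤).hom (φ.app ⊤ (toStructure 1)) = res (U.ι_image_le ⊤) e) :
    IsFrame e := by
  intro W' hW'
  obtain ⟨W, rfl⟩ : ∃ W : (U : Scheme.{0}).Opens, W' = U.ι ''ᵁ W :=
    ⟨U.ι ⁻¹ᵁ W', by simpa [Scheme.Hom.image_preimage_eq_opensRange_inf] using hW'⟩
  have h1 : (M.restrictAppIso U.ι W).hom (φ.app W (toStructure 1)) = res hW' e := by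
    have h := app_res φ (le_top : W ≤ ⊤) (toStructure 1)
    rw [res_toStructure, map_one] at h
    rw [h, restrict_res, he, res_res]
  have key : ∀ a : Γ((U : Scheme.{0}), W),
      (M.restrictAppIso U.ι W).hom (φ.app W (toStructure a)) =
        (U.ι.appIso W).inv a • res hW' e := by
    intro a
    rw [← h1, ← restrict_smul, ← Scheme.Modules.Hom.app_smul, ← toStructure_mul, mul_one]
  have hb : Function.Bijective fun a ↦ (M.restrictAppIso U.ι W).hom (φ.app W (toStructure a)) :=
    (ConcreteCategory.bijective_of_isIso (M.restrictAppIso U.ι W).hom).comp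
      ((ConcreteCategory.bijective_of_isIso (φ.app W)).comp (toStructure_bijective W))
  refine (Function.Bijective.of_comp_iff _
    (ConcreteCategory.bijective_of_isIso (U.ι.appIso W).inv)).mp ?_
  convert hb using 1
  exact (funext key).symm

theorem IsLineBundle.exists_frame {X : Scheme.{0}} {L : X.Modules} (hL : IsLineBundle L) (x : X) :
    ∃ U : X.Opens, x ∈ U ∧ ∃ e : Γ(L, U), IsFrame e := by
  obtain ⟨U, hx, ⟨φ⟩⟩ := hL x
  let e : Γ(L, U) := res (M := L) (U.ι_image_top.ge)
    ((L.restrictAppIso U.ι ⊤).hom (φ.inv.app ⊤ (toStructure 1)))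
  refine ⟨U, hx, e, isFrame_of_isIso φ.inv e ?_⟩
  rw [res_res]
  exact congr($((L.presheaf.map_id _).symm) _)

/-- The map on sections `Γ(V, M) → Γ(f⁻¹ V, f^* M)`. -/
noncomputable def pull {X Y : Scheme.{0}} (f : X ⟶ Y) (M : Y.Modules) (V : Y.Opens) :
    Γ(M, V) ⟶ Γ((Scheme.Modules.pullback f).obj M, f ⁻¹ᵁ V) :=
  ((Scheme.Modules.pullbackPushforwardAdjunction f).unit.app M).app V

theorem pull_res {X Y : Scheme.{0}} (f : X ⟶ Y) (M : Y.Modules) {V W : Y.Opens} (h : W ≤ V)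
    (s : Γ(M, V)) : pull f M W (res h s) = res (f.preimage_mono h) (pull f M V s) :=
  app_res ((Scheme.Modules.pullbackPushforwardAdjunction f).unit.app M) h s

theorem pull_smul {X Y : Scheme.{0}} (f : X ⟶ Y) (M : Y.Modules) {V : Y.Opens} (a : Γ(Y, V))
    (s : Γ(M, V)) : pull f M V (a • s) = f.app V a • pull f M V s :=
  ((Scheme.Modules.pullbackPushforwardAdjunction f).unit.app M).app_smul a s

/-- The morphism from the structure sheaf determined by a global section. -/
noncomputable def homOfSection {X : Scheme.{0}} {M : X.Modules} (s : Γ(M, ⊤)) : structureModule X ⟶ M :=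
  (SheafOfModules.unitHomEquiv (M : SheafOfModules X.ringCatSheaf)).symm
    ⟨fun U => res (M := M) (le_top : U.unop ≤ ⊤) s, by
      intro U V f
      exact res_res (M := M) (U := ⊤) (V := U.unop) (W := V.unop) le_top (leOfHom f.unop) s⟩

theorem res_self {X : Scheme.{0}} {M : X.Modules} {U : X.Opens} (h : U ≤ U) (s : Γ(M, U)) :
    res h s = s :=
  congr($(M.presheaf.map_id _) s)

/-- The two open sets are equal, but not definitionally; restricting back avoids a transport. -/
theorem res_injective_of_ge {X : Scheme.{0}} {M : X.Modules} {U W : X.Opens} (h : W ≤ U)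
    (h' : U ≤ W) : Function.Injective (res (M := M) h) := fun s t hst => by
  have := congrArg (res h') hst
  rwa [res_res, res_res, res_self, res_self] at this

theorem homOfSection_app {X : Scheme.{0}} {M : X.Modules} (s : Γ(M, ⊤)) (W : X.Opens)
    (a : Γ(X, W)) : (homOfSection s).app W (toStructure a) = a • res le_top s := by
  have h : (homOfSection s).app W (toStructure 1) = res le_top s :=
    congr(($((SheafOfModules.unitHomEquiv (M : SheafOfModules X.ringCatSheaf)).apply_symm_apply
      ⟨fun U => res (M := M) (le_top : U.unop ≤ ⊤) s, by
        intro U V f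
        exact res_res (M := M) (U := ⊤) (V := U.unop) (W := V.unop) le_top
          (leOfHom f.unop) s⟩)).val (.op W))
  rw [← h, ← Scheme.Modules.Hom.app_smul, ← toStructure_mul, mul_one]

theorem hom_structureModule_app {X : Scheme.{0}} {M : X.Modules} (φ : structureModule X ⟶ M)
    (W : X.Opens) (a : Γ(X, W)) :
    φ.app W (toStructure a) = a • res le_top (φ.app ⊤ (toStructure 1)) := by
  rw [← app_res, res_toStructure, map_one, ← Scheme.Modules.Hom.app_smul, ← toStructure_mul,
    mul_one]

theorem hom_structureModule_ext {X : Scheme.{0}} {M : X.Modules} {φ ψ : structureModule X ⟶ M}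
    (h : φ.app ⊤ (toStructure 1) = ψ.app ⊤ (toStructure 1)) : φ = ψ := by
  ext W a
  obtain ⟨a, rfl⟩ := (toStructure_bijective W).2 a
  rw [hom_structureModule_app, h, ← hom_structureModule_app]

/-- The global section of `M|_U` defined by a section of `M` on `U`. -/
noncomputable def restrictSection {X : Scheme.{0}} {M : X.Modules} {U : X.Opens} (e : Γ(M, U)) :
    Γ(M.restrict U.ι, ⊤) :=
  (M.restrictAppIso U.ι ⊤).inv (res (U.ι_image_le ⊤) e)

theorem restrictAppIso_restrictSection {X : Scheme.{0}} {M : X.Modules} {U : X.Opens}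
    (e : Γ(M, U)) :
    (M.restrictAppIso U.ι ⊤).hom (restrictSection e) = res (U.ι_image_le ⊤) e := rfl

theorem res_restrictSection {X : Scheme.{0}} {M : X.Modules} {U : X.Opens} (e : Γ(M, U))
    (W : (U : Scheme.{0}).Opens) : res le_top (restrictSection e) =
      (M.restrictAppIso U.ι W).inv (res (U.ι_image_le W) e) := by
  apply (ConcreteCategory.bijective_of_isIso (M.restrictAppIso U.ι W).hom).1
  rw [restrict_res, restrictAppIso_restrictSection, res_res, Iso.inv_hom_id_apply]

theorem IsFrame.isIso {X : Scheme.{0}} {M : X.Modules} {U : X.Opens} {e : Γ(M, U)}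
    (he : IsFrame e) : IsIso (homOfSection (restrictSection e)) := by
  rw [Scheme.Modules.Hom.isIso_iff_isIso_app]
  intro W
  rw [ConcreteCategory.isIso_iff_bijective]
  refine (Function.Bijective.of_comp_iff _ (toStructure_bijective W)).mp ?_
  refine (Function.Bijective.of_comp_iff' (ConcreteCategory.bijective_of_isIso
    (M.restrictAppIso U.ι W).hom) _).mp ?_
  have := (he _ (U.ι_image_le W)).comp (ConcreteCategory.bijective_of_isIso (U.ι.appIso W).inv)
  convert this using 1
  funext a
  simp only [Function.comp_apply, homOfSection_app]
  rw [restrict_smul, restrict_res, restrictAppIso_restrictSection, res_res]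

/-- A morphism of `M` to a module supported on `V`, determined by the image of a frame on `V`. -/
theorem IsFrame.exists_hom_pushforward {Y V' : Scheme.{0}} {M : Y.Modules} {V : Y.Opens}
    {e : Γ(M, V)} (he : IsFrame e) (g : V' ⟶ (V : Scheme.{0})) (N : V'.Modules) (t : Γ(N, ⊤)) :
    ∃ α : M ⟶ (Scheme.Modules.pushforward (g ≫ V.ι)).obj N,
      res (M := N) (U := (g ≫ V.ι) ⁻¹ᵁ V) (W := ⊤) (by simp) (α.app V e) = t := by
  have := he.isIso
  obtain ⟨t', ht'⟩ : ∃ t' : Γ((Scheme.Modules.pushforward g).obj N, ⊤), t' = t := ⟨t, rfl⟩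
  let β : M.restrict V.ι ⟶ (Scheme.Modules.pushforward g).obj N :=
    inv (homOfSection (restrictSection e)) ≫ homOfSection t'
  refine ⟨(Scheme.Modules.restrictAdjunction V.ι).homEquiv _ _ β ≫
    (Scheme.Modules.pushforwardComp g V.ι).hom.app N, ?_⟩
  have h1 : (((Scheme.Modules.restrictAdjunction V.ι).homEquiv _ _ β ≫
      (Scheme.Modules.pushforwardComp g V.ι).hom.app N).app V e) =
      β.app (V.ι ⁻¹ᵁ V) ((M.restrictAppIso V.ι _).inv (res (V.ι_image_le _) e)) := by
    rw [Adjunction.homEquiv_unit]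
    rfl
  have h2 : (M.restrictAppIso V.ι (V.ι ⁻¹ᵁ V)).inv (res (V.ι_image_le _) e) =
      res le_top (restrictSection e) := by
    rw [res_restrictSection]
  have h3 : β.app ⊤ (restrictSection e) = t' := by
    have h4 : homOfSection (restrictSection e) ≫ β = homOfSection t' := by simp [β]
    have h5 := congr(($h4).app ⊤ (toStructure 1))
    rw [Scheme.Modules.Hom.comp_app, ConcreteCategory.comp_apply, homOfSection_app,
      homOfSection_app, one_smul, one_smul, res_self, res_self] at h5
    exact h5
  rw [h1, h2, app_res, h3, ht']
  exact (res_res (M := N) (U := ⊤) _ _ t).trans (res_self _ t)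

/-- As g lands in V, sections of the target over W are the same as sections over W ⊓ V, where the
frame generates M. -/
theorem IsFrame.hom_ext_pushforward {Y X' : Scheme.{0}} {M : Y.Modules} {V : Y.Opens}
    {e : Γ(M, V)} (he : IsFrame e) (g : X' ⟶ Y) (hg : g ⁻¹ᵁ V = ⊤) (N : X'.Modules)
    {α β : M ⟶ (Scheme.Modules.pushforward g).obj N} (h : α.app V e = β.app V e) : α = β := by
  ext W m
  have hW : g ⁻¹ᵁ W ≤ g ⁻¹ᵁ (W ⊓ V) := by
    intro x hx
    exact ⟨hx, (hg ▸ trivial : x ∈ g ⁻¹ᵁ V)⟩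
  apply res_injective_of_ge (M := N) (g.preimage_mono inf_le_left) hW
  have key : ∀ γ : M ⟶ (Scheme.Modules.pushforward g).obj N,
      res (M := N) (g.preimage_mono inf_le_left) (γ.app W m) = γ.app (W ⊓ V) (res inf_le_left m) :=
    fun γ => (app_res γ inf_le_left m).symm
  rw [key, key]
  obtain ⟨a, ha⟩ := he.exists_eq_smul inf_le_right (res (inf_le_left : W ⊓ V ≤ W) m)
  rw [ha, Scheme.Modules.Hom.app_smul, Scheme.Modules.Hom.app_smul, app_res, app_res, h]

/-- By Yoneda, using only the adjunctions and no formula for f^*M. Maps from (f^*M)|_V' to N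
correspond to maps from M to the pushforward of N along V' → Y. Since this morphism lands in V, such
a map is determined by an arbitrary choice of the image of e, a global section of N. -/
theorem IsFrame.isFrame_pull {X Y : Scheme.{0}} (f : X ⟶ Y) {M : Y.Modules} {V : Y.Opens}
    {e : Γ(M, V)} (he : IsFrame e) : IsFrame (pull f M V e) := by
  set V' := f ⁻¹ᵁ V
  set φ := homOfSection (restrictSection (pull f M V e)) with hφ
  suffices IsIso φ from isFrame_of_isIso φ _ (by
    rw [hφ, homOfSection_app, one_smul, res_self, restrictAppIso_restrictSection])
  rw [isIso_iff_coyoneda_map_bijective]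
  intro N
  let A : (((Scheme.Modules.pullback f).obj M).restrict V'.ι ⟶ N) ≃
      (M ⟶ (Scheme.Modules.pushforward (V'.ι ≫ f)).obj N) :=
    ((Scheme.Modules.restrictAdjunction V'.ι).homEquiv _ _).trans
      (((Scheme.Modules.pullbackPushforwardAdjunction f).homEquiv _ _).trans
      (Iso.homToEquiv ((Scheme.Modules.pushforwardComp V'.ι f).app N)))
  have hV' : (V'.ι ≫ f) ⁻¹ᵁ V = ⊤ := by
    rw [Scheme.Hom.comp_preimage]; simp [V']
  -- Under the adjunctions, precomposition with φ becomes evaluation at the frame e.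
  have hA : ∀ ψ, (A ψ).app V e = res (M := N) (W := (V'.ι ≫ f) ⁻¹ᵁ V) le_top
      ((φ ≫ ψ).app ⊤ (toStructure 1)) := by
    intro ψ
    have h1 : (A ψ).app V e = ψ.app (V'.ι ⁻¹ᵁ V')
        ((Scheme.Modules.restrictAppIso V'.ι _ _).inv (res (V'.ι_image_le _) (pull f M V e))) := by
      simp only [A, Equiv.trans_apply, Adjunction.homEquiv_unit]
      rfl
    rw [h1, Scheme.Modules.Hom.comp_app, ConcreteCategory.comp_apply, hφ, homOfSection_app,
      one_smul, res_self]
    refine Eq.trans ?_ (app_res ψ _ _)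
    rw [res_restrictSection]
    rfl
  constructor
  · intro ψ₁ ψ₂ h
    apply A.injective
    apply he.hom_ext_pushforward _ hV'
    have h : φ ≫ ψ₁ = φ ≫ ψ₂ := h
    rw [hA, hA, h]
  · intro θ
    have hg : f ∣_ V ≫ V.ι = V'.ι ≫ f := morphismRestrict_ι f V
    obtain ⟨α, hα⟩ := he.exists_hom_pushforward (f ∣_ V) N (θ.app ⊤ (toStructure 1))
    obtain ⟨α', hα'⟩ : ∃ α' : M ⟶ (Scheme.Modules.pushforward (V'.ι ≫ f)).obj N,
        res (M := N) (U := (V'.ι ≫ f) ⁻¹ᵁ V) (W := ⊤) hV'.ge (α'.app V e) =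
          θ.app ⊤ (toStructure 1) := by
      revert hV'
      rw [← hg]
      intro _
      exact ⟨α, hα⟩
    refine ⟨A.symm α', hom_structureModule_ext ?_⟩
    have := hA (A.symm α')
    rw [A.apply_symm_apply] at this
    rw [this, res_res, res_self] at hα'
    exact hα'

/-! ### Inverse images of ideal sheaves -/

/-- The inverse image is left adjoint to the direct image of ideal sheaves, and on affine schemes
the latter is contraction of ideals; hence the former is extension of ideals. -/
theorem ideal_top_comap {X Y : Scheme.{0}} [IsAffine X] [IsAffine Y] (K : Y.IdealSheafData)
    (g : X ⟶ Y) : (K.comap g).ideal ⟨⊤, isAffineOpen_top X⟩ =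
      (K.ideal ⟨⊤, isAffineOpen_top Y⟩).map g.appTop.hom := by
  apply le_antisymm
  · let J := Scheme.IdealSheafData.ofIdealTop ((K.ideal ⟨⊤, isAffineOpen_top Y⟩).map g.appTop.hom)
    have hJ : J.ideal ⟨⊤, isAffineOpen_top X⟩ =
        (K.ideal ⟨⊤, isAffineOpen_top Y⟩).map g.appTop.hom := by
      simp [J, Scheme.IdealSheafData.ofIdealTop]
    have : K.comap g ≤ J := by
      rw [← Scheme.IdealSheafData.le_map_iff_comap_le]
      apply Scheme.IdealSheafData.le_of_isAffine
      rw [Scheme.IdealSheafData.ideal_map_of_isAffineHom, ← Ideal.map_le_iff_le_comap]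
      exact hJ.ge
    exact (this _).trans hJ.le
  · rw [Ideal.map_le_iff_le_comap]
    refine ((Scheme.IdealSheafData.le_map_comap K g) _).trans ?_
    rw [Scheme.IdealSheafData.ideal_map_of_isAffineHom]
    rfl

theorem ideal_comap_ι {X : Scheme.{0}} (K : X.IdealSheafData) (U : X.affineOpens) :
    haveI : IsAffine U.1 := U.2
    (K.comap U.1.ι).ideal ⟨⊤, isAffineOpen_top _⟩ = (K.ideal U).map U.1.topIso.inv.hom := by
  have : IsAffine U.1 := U.2
  rw [Scheme.IdealSheafData.ideal_comap_of_isOpenImmersion]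
  rw [Scheme.Opens.ι_appIso, Scheme.Opens.topIso_inv]
  exact (Ideal.comap_id _).trans (Scheme.IdealSheafData.map_ideal'
    (U := ⟨U.1.ι ''ᵁ ⊤, (isAffineOpen_top U.1.toScheme).image_of_isOpenImmersion U.1.ι⟩) K _).symm

theorem ideal_comap {X Y : Scheme.{0}} (I : Y.IdealSheafData) (f : X ⟶ Y) (V : Y.affineOpens)
    (U : X.affineOpens) (e : U.1 ≤ f ⁻¹ᵁ V.1) :
    (I.comap f).ideal U = (I.ideal V).map (f.appLE V.1 U.1 e).hom := by
  have : IsAffine U.1 := U.2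
  have : IsAffine V.1 := V.2
  have h1 := ideal_comap_ι (I.comap f) U
  rw [← Scheme.IdealSheafData.comap_comp, ← Scheme.Hom.resLE_comp_ι f e,
    Scheme.IdealSheafData.comap_comp, ideal_top_comap, ideal_comap_ι, Ideal.map_map] at h1
  have h2 := congrArg (Ideal.map U.1.topIso.hom.hom) h1
  rw [Ideal.map_map, Ideal.map_map, ← CommRingCat.hom_comp, ← CommRingCat.hom_comp,
    ← CommRingCat.hom_comp, Iso.inv_hom_id, CommRingCat.hom_id, Ideal.map_id] at h2
  rw [← h2]
  congr 2
  have h3 : (f.resLE V.1 U.1 e).appTop =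
    V.1.topIso.hom ≫ f.appLE V.1 U.1 e ≫ U.1.topIso.inv := Scheme.Hom.resLE_app_top ..
  rw [h3]
  simp only [Category.assoc, Iso.inv_hom_id_assoc, Iso.inv_hom_id, Category.comp_id]

/-! ### Points of smooth algebras -/

/-- Nullstellensatz: the residue field is finite over ℂ, hence equal to ℂ, and v is evaluation at
the point. -/
theorem exists_value {A : Type} [CommRing A] (σ : ℂ →+* A) (hσ : σ.FiniteType) (m : Ideal A)
    [m.IsMaximal] : ∃ v : A →+* ℂ, (∀ c, v (σ c) = c) ∧ ∀ a, v a = 0 ↔ a ∈ m := by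
  algebraize [σ]
  let := Ideal.Quotient.field m
  have hft : Algebra.FiniteType ℂ (A ⧸ m) :=
    Algebra.FiniteType.of_surjective (Ideal.Quotient.mkₐ ℂ m) Ideal.Quotient.mk_surjective
  have : Module.Finite ℂ (A ⧸ m) := finite_of_finite_type_of_isJacobsonRing ℂ (A ⧸ m)
  have hb := IsAlgClosed.algebraMap_bijective_of_isIntegral (k := ℂ) (K := A ⧸ m)
  let e := RingEquiv.ofBijective _ hb
  refine ⟨e.symm.toRingHom.comp (Ideal.Quotient.mk m), fun c => ?_, fun a => ?_⟩
  · change e.symm (e c) = c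
    simp
  · change e.symm (Ideal.Quotient.mk m a) = 0 ↔ _
    rw [map_eq_zero_iff _ e.symm.injective, Ideal.Quotient.eq_zero_iff_mem]

/-- At a point of an étale algebra over a polynomial ring, the differences of the coordinates and
their values generate the maximal ideal locally. -/
theorem exists_mul_mem_span_of_etale {A : Type} [CommRing A] {n : ℕ}
    (g : MvPolynomial (Fin n) ℂ →+* A) (hg : g.Etale) (m : Ideal A) [m.IsMaximal]
    (v : A →+* ℂ) (hv : ∀ c, v (g (MvPolynomial.C c)) = c) (hm : ∀ a, v a = 0 ↔ a ∈ m) :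
    ∃ h ∉ m, ∀ a ∈ m, h * a ∈ Ideal.span
      (Set.range fun i => g (MvPolynomial.X i - MvPolynomial.C (v (g (MvPolynomial.X i))))) := by
  set J := Ideal.span
      (Set.range fun i => g (MvPolynomial.X i - MvPolynomial.C (v (g (MvPolynomial.X i))))) with hJ
  have hJX : ∀ i, g (MvPolynomial.X i) - g (MvPolynomial.C (v (g (MvPolynomial.X i)))) ∈ J :=
    fun i => by rw [← map_sub]; exact Ideal.subset_span ⟨i, rfl⟩
  have hJm : J ≤ m := by
    rw [hJ, Ideal.span_le]
    rintro _ ⟨i, rfl⟩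
    simp [← hm, hv]
  -- The quotient map to A / (J + m²) and the map sending a to its value v a are both algebra maps
  -- over the polynomial ring, because each coordinate is congruent to its value modulo J. They
  -- agree modulo m, whose image has square zero, so unramifiedness makes them equal; elements of m
  -- have value zero.
  have key : m ≤ J ⊔ m ^ 2 := by
    algebraize [g]
    have := hg
    let K := J ⊔ m ^ 2
    have hK : K ≤ m := sup_le hJm (Ideal.pow_le_self two_ne_zero)
    let g₁ : A →ₐ[MvPolynomial (Fin n) ℂ] A ⧸ K := Ideal.Quotient.mkₐ _ K
    have hcomp : (((Ideal.Quotient.mk K).comp (g.comp MvPolynomial.C)).comp v).comp g =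
        (Ideal.Quotient.mk K).comp g := by
      apply MvPolynomial.ringHom_ext
      · intro c; simp [hv]
      · intro i
        refine (Ideal.Quotient.eq.mpr ?_).symm
        exact le_sup_left (a := J) (hJX i)
    let g₂ : A →ₐ[MvPolynomial (Fin n) ℂ] A ⧸ K :=
      { ((Ideal.Quotient.mk K).comp (g.comp MvPolynomial.C)).comp v with
        commutes' := fun p => congr($hcomp p) }
    have h12 : g₁ = g₂ := by
      refine Algebra.FormallyUnramified.ext' (Ideal.Quotient.factor hK) ⟨2, ?_⟩ _ _ fun a => ?_
      · rw [Ideal.Quotient.factor_ker, ← Ideal.map_pow, Ideal.zero_eq_bot,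
          Ideal.map_eq_bot_iff_le_ker, Ideal.mk_ker]
        exact le_sup_right
      · change Ideal.Quotient.mk m a = Ideal.Quotient.mk m _
        rw [Ideal.Quotient.eq, ← hm, map_sub]
        simp [hv]
    intro a ha
    have := congr($h12 a)
    change Ideal.Quotient.mk K a = Ideal.Quotient.mk K (g (MvPolynomial.C (v a))) at this
    rw [(hm a).mpr ha, map_zero, map_zero, map_zero, Ideal.Quotient.eq_zero_iff_mem] at this
    exact this
  have : IsNoetherianRing A := by
    algebraize [g]
    have := hg
    exact Algebra.FiniteType.isNoetherianRing (MvPolynomial (Fin n) ℂ) A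
  -- Nakayama, in the form that produces the denominator r ≡ 1 modulo m.
  obtain ⟨r, hr, hr'⟩ := Submodule.exists_sub_one_mem_and_smul_le_of_fg_of_le_sup
    (I := m) (N := J) (N' := m) (P := m) (IsNoetherian.noetherian m) le_rfl
    (by rwa [smul_eq_mul, ← pow_two])
  refine ⟨r, fun h => ?_, fun a ha => hr' (Submodule.smul_mem_pointwise_smul a r m ha)⟩
  exact Ideal.IsPrime.ne_top' (I := m) ((Ideal.eq_top_iff_one _).mpr (by simpa using m.sub_mem h hr))

/-- On a smooth algebra, membership in the square of a maximal ideal is detected by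
derivations. -/
theorem exists_derivations {A : Type} [CommRing A] (σ : ℂ →+* A) (hσ : σ.IsStandardSmooth) :
    letI := σ.toAlgebra
    ∃ (ι : Type) (D : ι → Derivation ℂ A A), ∀ m : Ideal A, m.IsMaximal →
      ∀ a ∈ m, a ∈ m ^ 2 ↔ ∀ i, D i a ∈ m := by
  algebraize [σ]
  have : Algebra.FiniteType ℂ A := inferInstance
  let b := Module.Free.chooseBasis A (Ω[A⁄ℂ])
  refine ⟨_, fun i => (b.coord i).compDer (KaehlerDifferential.D ℂ A), fun m hm a ha => ?_⟩
  constructor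
  · intro h i
    rw [pow_two] at h
    refine Submodule.mul_induction_on h (fun x hx y hy => ?_) (fun x y hx hy => ?_)
    · rw [Derivation.leibniz, smul_eq_mul, smul_eq_mul]
      exact m.add_mem (m.mul_mem_right _ hx) (m.mul_mem_right _ hy)
    · rw [map_add]
      exact m.add_mem hx hy
  · intro h
    obtain ⟨v, hv, hvm⟩ := exists_value σ this m
    have hvσ : ∀ a, a - σ (v a) ∈ m := fun a => by rw [← hvm, map_sub, hv, sub_self]
    have hsm : ∀ c : ℂ, ∀ a : A, c • a = σ c * a := fun c a => Algebra.smul_def c a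
    -- The map a ↦ a - v(a) is a derivation modulo m². It factors through the differentials and
    -- kills m Ω, so it vanishes on every a whose differential has coordinates in m.
    let δ₀ : A →ₗ[ℂ] A ⧸ m ^ 2 :=
      { toFun := fun a => Ideal.Quotient.mk _ (a - σ (v a))
        map_add' := fun a b => by rw [← map_add]; congr 1; simp only [map_add]; ring
        map_smul' := fun c a => by
          rw [RingHom.id_apply, hsm, map_mul, map_mul, hv, ← mul_sub, map_mul, Algebra.smul_def]
          rfl }
    let δ : Derivation ℂ A (A ⧸ m ^ 2) := Derivation.mk' δ₀ fun a b => by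
      change Ideal.Quotient.mk (m ^ 2) (a * b - σ (v (a * b))) =
        Ideal.Quotient.mk (m ^ 2) (a * (b - σ (v b))) + Ideal.Quotient.mk (m ^ 2) (b * (a - σ (v a)))
      rw [← map_add, Ideal.Quotient.eq]
      have : (a - σ (v a)) * (b - σ (v b)) ∈ m ^ 2 := by
        rw [pow_two]; exact Ideal.mul_mem_mul (hvσ a) (hvσ b)
      convert (m ^ 2).neg_mem this using 1
      simp only [map_mul]
      ring
    have hδ : ∀ a, δ a = Ideal.Quotient.mk (m ^ 2) (a - σ (v a)) := fun a => rfl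
    let φ := δ.liftKaehlerDifferential
    have h0 : ∀ x ∈ m, ∀ ω : Ω[A⁄ℂ], x • φ ω = 0 := by
      intro x hx ω
      have hω : ω ∈ Submodule.span A (Set.range (KaehlerDifferential.D ℂ A)) := by
        rw [KaehlerDifferential.span_range_derivation]; trivial
      induction hω using Submodule.span_induction with
      | mem _ h =>
        obtain ⟨b, rfl⟩ := h
        rw [Derivation.liftKaehlerDifferential_comp_D, hδ]
        change Ideal.Quotient.mk (m ^ 2) (x * _) = 0
        rw [Ideal.Quotient.eq_zero_iff_mem, pow_two]
        exact Ideal.mul_mem_mul hx (hvσ b)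
      | zero => simp
      | add y z _ _ hy hz => rw [map_add, smul_add, hy, hz, add_zero]
      | smul r y _ hy => rw [map_smul, smul_comm, hy, smul_zero]
    have h1 : φ (KaehlerDifferential.D ℂ A a) = 0 := by
      rw [← b.linearCombination_repr (KaehlerDifferential.D ℂ A a),
        Finsupp.linearCombination_apply, Finsupp.sum, map_sum]
      exact Finset.sum_eq_zero fun i _ => by rw [map_smul]; exact h0 _ (h i) _
    rw [Derivation.liftKaehlerDifferential_comp_D, hδ, (hvm a).mpr ha, map_zero, sub_zero,
      Ideal.Quotient.eq_zero_iff_mem] at h1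
    exact h1

/-! ### Charts on smooth varieties -/

theorem fres_scalars {X : Scheme.{0}} (f : X ⟶ SpecC) {U V : X.Opens} (h : V ≤ U) (c : ℂ) :
    fres h (scalars f U c) = scalars f V c := by
  change ((Scheme.ΓSpecIso (CommRingCat.of ℂ)).inv ≫ f.appTop ≫ (X.presheaf.map _ ≫
    X.presheaf.map _)).hom c = _
  rw [← Functor.map_comp]
  rfl

theorem opens_SpecC_eq_top (U : SpecC.Opens) (x : SpecC) (hx : x ∈ U) : U = ⊤ := by
  have : Subsingleton SpecC := inferInstanceAs (Subsingleton (PrimeSpectrum ℂ))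
  ext y
  simp [Subsingleton.elim y x, hx]

theorem isStandardSmoothOfRelativeDimension_fres_basicOpen {X : Scheme.{0}} {V : X.Opens}
    (hV : IsAffineOpen V) (a : Γ(X, V)) :
    (fres (X.basicOpen_le a)).IsStandardSmoothOfRelativeDimension 0 := by
  have := hV.isLocalization_basicOpen a
  exact RingHom.IsStandardSmoothOfRelativeDimension.algebraMap_isLocalizationAway a

theorem exists_smooth_chart {X : Scheme.{0}} {n : ℕ} {f : X ⟶ SpecC}
    (hf : SmoothOfRelativeDimension n f) (x : X) (O : X.Opens) (hx : x ∈ O) :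
    ∃ V : X.Opens, IsAffineOpen V ∧ x ∈ V ∧ V ≤ O ∧
      (scalars f V).IsStandardSmoothOfRelativeDimension n := by
  obtain ⟨U, hU, V, hV, hxV, e, h⟩ := hf.exists_isStandardSmoothOfRelativeDimension x
  obtain rfl := opens_SpecC_eq_top U (f x) (e hxV)
  obtain ⟨a, haO, hxa⟩ := hV.exists_basicOpen_le ⟨x, hx⟩ hxV
  refine ⟨X.basicOpen a, hV.basicOpen a, hxa, haO, ?_⟩
  have h2 := (isStandardSmoothOfRelativeDimension_fres_basicOpen hV a).comp (h.comp
    (RingHom.IsStandardSmoothOfRelativeDimension.equiv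
      (Scheme.ΓSpecIso (CommRingCat.of ℂ)).symm.commRingCatIsoToRingEquiv))
  rw [add_zero, zero_add] at h2
  have h3 : scalars f (X.basicOpen a) = (fres (X.basicOpen_le a)).comp ((f.appLE ⊤ V e).hom.comp
      ((Scheme.ΓSpecIso (CommRingCat.of ℂ)).symm.commRingCatIsoToRingEquiv : ℂ →+* _)) :=
    RingHom.ext fun c => by
      rw [← fres_scalars f (X.basicOpen_le a)]
      rfl
  rw [h3]
  exact h2

/-- The ideal of the functions on `V` vanishing at `x`. -/
noncomputable def pointIdeal {X : Scheme.{0}} {V : X.Opens} (x : X) (hx : x ∈ V) :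
    Ideal Γ(X, V) :=
  (IsLocalRing.maximalIdeal (X.presheaf.stalk x)).comap (X.presheaf.germ V x hx).hom

theorem mem_pointIdeal {X : Scheme.{0}} {V : X.Opens} {x : X} {hx : x ∈ V} {a : Γ(X, V)} :
    a ∈ pointIdeal x hx ↔ X.presheaf.germ V x hx a ∈
      IsLocalRing.maximalIdeal (X.presheaf.stalk x) := Iff.rfl

theorem mem_pointIdeal_iff {X : Scheme.{0}} {V : X.Opens} {x : X} {hx : x ∈ V} {a : Γ(X, V)} :
    a ∈ pointIdeal x hx ↔ x ∉ X.basicOpen a := by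
  rw [mem_pointIdeal, IsLocalRing.mem_maximalIdeal, mem_nonunits_iff, X.mem_basicOpen a x hx]

instance {X : Scheme.{0}} {V : X.Opens} (x : X) (hx : x ∈ V) : (pointIdeal x hx).IsPrime :=
  inferInstanceAs (Ideal.comap _ _).IsPrime

theorem fres_mem_pointIdeal {X : Scheme.{0}} {V W : X.Opens} (h : W ≤ V) {x : X} {hx : x ∈ W}
    {a : Γ(X, V)} : fres h a ∈ pointIdeal x hx ↔ a ∈ pointIdeal x (h hx) := by
  rw [mem_pointIdeal, mem_pointIdeal, ← germ_fres h x hx]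

theorem primeIdealOf_asIdeal {X : Scheme.{0}} {V : X.Opens} (hV : IsAffineOpen V) (x : X)
    (hx : x ∈ V) : (hV.primeIdealOf ⟨x, hx⟩).asIdeal = pointIdeal x hx := by
  rw [hV.primeIdealOf_eq_map_closedPoint]
  rfl

theorem isMaximal_pointIdeal {X : Scheme.{0}} {V : X.Opens} (hV : IsAffineOpen V) (x : X)
    (hx : x ∈ V) (hcl : IsClosed {x}) : (pointIdeal x hx).IsMaximal := by
  rw [← primeIdealOf_asIdeal hV]
  exact hV.primeIdealOf_isMaximal_of_isClosed ⟨x, hx⟩ hcl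

/-- Étale coordinates, translated to vanish at x, generate the maximal ideal after inverting one
function h. Of étaleness only flatness over the polynomial ring is kept: it makes the coordinates a
regular sequence and lets curves be pulled back. -/
theorem exists_centered_chart {X : Scheme.{0}} {n : ℕ} {f : X ⟶ SpecC}
    (hf : SmoothOfRelativeDimension n f) (x : X) (hcl : IsClosed {x}) (O : X.Opens) (hx : x ∈ O) :
    ∃ V : X.Opens, IsAffineOpen V ∧ V ≤ O ∧ ∃ hxV : x ∈ V,
      ∃ g : MvPolynomial (Fin n) ℂ →+* Γ(X, V), (∀ c, g (MvPolynomial.C c) = scalars f V c) ∧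
        g.Flat ∧ pointIdeal x hxV = Ideal.span (Set.range fun i => g (MvPolynomial.X i)) := by
  obtain ⟨V, hV, hxV, hVO, hs⟩ := exists_smooth_chart hf x O hx
  have hft : (scalars f V).FiniteType := by
    have := hs.isStandardSmooth
    algebraize [scalars f V]
    have : Algebra.IsStandardSmooth ℂ Γ(X, V) := hs.isStandardSmooth
    exact (inferInstance : Algebra.FiniteType ℂ Γ(X, V))
  obtain ⟨g, hg, hge⟩ := hs.exists_etale_mvPolynomial
  have hg' : ∀ c, g (MvPolynomial.C c) = scalars f V c := fun c => congr($hg c)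
  have := isMaximal_pointIdeal hV x hxV hcl
  obtain ⟨v, hv, hvm⟩ := exists_value (scalars f V) hft (pointIdeal x hxV)
  obtain ⟨h, hh, hmul⟩ := exists_mul_mem_span_of_etale g hge (pointIdeal x hxV) v
    (fun c => by rw [hg', hv]) hvm
  set c : Fin n → ℂ := fun i => v (g (MvPolynomial.X i)) with hc
  have hxW : x ∈ X.basicOpen h := by rwa [mem_pointIdeal_iff, not_not] at hh
  have hWV := X.basicOpen_le h
  -- Translation of affine space moving the image of x to the origin.
  let τ : MvPolynomial (Fin n) ℂ →ₐ[ℂ] MvPolynomial (Fin n) ℂ :=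
    MvPolynomial.aeval fun i => MvPolynomial.X i - MvPolynomial.C (c i)
  let τ' : MvPolynomial (Fin n) ℂ →ₐ[ℂ] MvPolynomial (Fin n) ℂ :=
    MvPolynomial.aeval fun i => MvPolynomial.X i + MvPolynomial.C (c i)
  have h1 : τ.comp τ' = AlgHom.id _ _ := by ext i; simp [τ, τ']
  have h2 : τ'.comp τ = AlgHom.id _ _ := by ext i; simp [τ, τ']
  have hτ : Function.Bijective τ.toRingHom := Function.bijective_iff_has_inverse.mpr
    ⟨τ', fun x => congr($h2 x), fun x => congr($h1 x)⟩
  refine ⟨X.basicOpen h, hV.basicOpen h, hWV.trans hVO, hxW,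
    ((fres hWV).comp g).comp τ.toRingHom, fun c => ?_, ?_, ?_⟩
  · simp [τ, hg', fres_scalars]
  · refine RingHom.Flat.comp (RingHom.Flat.of_bijective hτ) (RingHom.Flat.comp ?_ ?_)
    · exact (RingHom.Etale.iff_flat_and_formallyUnramified.mp hge).1
    · have := hV.isLocalization_basicOpen h
      exact RingHom.flat_algebraMap_iff.mpr
        (IsLocalization.flat _ (Submonoid.powers h))
  · have hX : ∀ i, (((fres hWV).comp g).comp τ.toRingHom) (MvPolynomial.X i) =
      fres hWV (g (MvPolynomial.X i - MvPolynomial.C (c i))) := fun i => by simp [τ]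
    simp only [hX]
    apply le_antisymm
    · intro a ha
      have := hV.isLocalization_basicOpen h
      obtain ⟨⟨b, ⟨_, k, rfl⟩⟩, hb⟩ := IsLocalization.surj (Submonoid.powers h) a
      have hb : a * fres hWV (h ^ k) = fres hWV b := hb
      have hbm : b ∈ pointIdeal x hxV := by
        rw [← fres_mem_pointIdeal hWV (hx := hxW), ← hb]
        exact Ideal.mul_mem_right _ _ ha
      have h3 := Ideal.mem_map_of_mem (fres hWV) (hmul b hbm)
      rw [Ideal.map_span, ← Set.range_comp, map_mul, ← hb, map_pow] at h3
      have hu : IsUnit (fres hWV h) := X.toRingedSpace.isUnit_res_basicOpen h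
      rw [Ideal.unit_mul_mem_iff_mem _ hu, Ideal.mul_unit_mem_iff_mem _ (hu.pow k)] at h3
      exact h3
    · rw [Ideal.span_le]
      rintro _ ⟨i, rfl⟩
      rw [SetLike.mem_coe, fres_mem_pointIdeal, ← hvm]
      simp [hc, hg', hv]

/-! ### Blowing up closed points -/

theorem mem_vanishingIdeal_ideal {X : Scheme.{0}} (Z : TopologicalSpace.Closeds X)
    (V : X.affineOpens) (a : Γ(X, V.1)) :
    a ∈ (Scheme.IdealSheafData.vanishingIdeal Z).ideal V ↔
      ∀ x ∈ Z, ∀ hx : x ∈ V.1, a ∈ pointIdeal x hx := by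
  rw [Scheme.IdealSheafData.vanishingIdeal_ideal, PrimeSpectrum.mem_vanishingIdeal]
  have hV : IsAffineOpen V.1 := V.2
  constructor
  · intro h x hxZ hx
    rw [← primeIdealOf_asIdeal hV]
    refine h _ ?_
    change hV.fromSpec (hV.primeIdealOf ⟨x, hx⟩) ∈ Z
    rwa [hV.fromSpec_primeIdealOf]
  · intro h y hy
    have hyV : hV.fromSpec y ∈ V.1 := (hV.isoSpec.inv y).2
    have := h _ hy hyV
    rw [← primeIdealOf_asIdeal hV] at this
    have h2 : hV.primeIdealOf ⟨hV.fromSpec y, hyV⟩ = y :=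
      hV.fromSpec.isOpenEmbedding.injective (hV.fromSpec_primeIdealOf _)
    rwa [h2] at this

theorem vanishingIdeal_ideal_eq_pointIdeal {X : Scheme.{0}} (Z : TopologicalSpace.Closeds X)
    (V : X.affineOpens) (p : X) (hpZ : p ∈ Z) (hp : p ∈ V.1) (h : ∀ x ∈ Z, x ∈ V.1 → x = p) :
    (Scheme.IdealSheafData.vanishingIdeal Z).ideal V = pointIdeal p hp := by
  ext a
  rw [mem_vanishingIdeal_ideal]
  refine ⟨fun ha => ha p hpZ hp, fun ha x hxZ hx => ?_⟩
  obtain rfl := h x hxZ hx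
  exact ha

theorem isEffectiveCartier_top (X : Scheme.{0}) :
    IsEffectiveCartier (⊤ : X.IdealSheafData) := by
  intro x
  obtain ⟨U, hU, hxU, -⟩ := exists_isAffineOpen_mem_and_subset (x := x) (U := ⊤) trivial
  exact ⟨⟨U, hU⟩, hxU, 1, one_mem _, by simp [Scheme.IdealSheafData.ideal_top]⟩

theorem comap_vanishingIdeal_eq_top {X T : Scheme.{0}} (Z : TopologicalSpace.Closeds X)
    (g : T ⟶ X) (h : ∀ t, g t ∉ Z) :
    (Scheme.IdealSheafData.vanishingIdeal Z).comap g = ⊤ := by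
  rw [← Scheme.IdealSheafData.support_eq_bot_iff, Scheme.IdealSheafData.support_comap]
  ext t
  simpa using h t

/-- Over an open set missing the centre the ideal pulls back to the unit ideal, which is Cartier.
The universal property then lifts the inclusion of V, and its uniqueness clause makes the lift
inverse to σ. -/
theorem IsBlowup.isIso_morphismRestrict {X Y : Scheme.{0}} {σ : X ⟶ Y}
    {Z : TopologicalSpace.Closeds Y}
    (hB : IsBlowup σ (Scheme.IdealSheafData.vanishingIdeal Z)) (V : Y.Opens)
    (hV : ∀ x ∈ Z, x ∉ V) : IsIso (σ ∣_ V) := by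
  have hcart : ∀ {T : Scheme.{0}} (r : T ⟶ (V : Scheme.{0})), IsEffectiveCartier
      ((Scheme.IdealSheafData.vanishingIdeal Z).comap (r ≫ V.ι)) := by
    intro T r
    rw [comap_vanishingIdeal_eq_top Z (r ≫ V.ι)]
    · exact isEffectiveCartier_top T
    · intro t ht
      exact hV _ ht (r t).2
  obtain ⟨h, hh, -⟩ := hB.existsUnique_lift V.ι (by simpa using hcart (𝟙 _))
  have h1 : σ ∣_ V ≫ h = (σ ⁻¹ᵁ V).ι := by
    obtain ⟨k, -, hk⟩ := hB.existsUnique_lift (σ ∣_ V ≫ V.ι) (hcart _)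
    rw [hk (σ ∣_ V ≫ h) (by simp [hh]), hk (σ ⁻¹ᵁ V).ι (by simp)]
  have hr : Set.range h ⊆ Set.range (σ ⁻¹ᵁ V).ι := by
    rintro _ ⟨y, rfl⟩
    have : σ (h y) = V.ι y := by rw [← Scheme.Hom.comp_apply, hh]
    rw [Scheme.Opens.range_ι]
    change σ (h y) ∈ V
    rw [this]
    exact y.2
  let k := IsOpenImmersion.lift (σ ⁻¹ᵁ V).ι h hr
  have hk : k ≫ (σ ⁻¹ᵁ V).ι = h := IsOpenImmersion.lift_fac ..
  refine ⟨k, ?_, ?_⟩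
  · rw [← cancel_mono (σ ⁻¹ᵁ V).ι, Category.assoc, hk, h1, Category.id_comp]
  · rw [← cancel_mono V.ι, Category.assoc, morphismRestrict_ι, reassoc_of% hk, hh,
      Category.id_comp]

theorem IsBlowup.app_bijective {X Y : Scheme.{0}} {σ : X ⟶ Y}
    {Z : TopologicalSpace.Closeds Y}
    (hB : IsBlowup σ (Scheme.IdealSheafData.vanishingIdeal Z)) (V : Y.Opens)
    (hV : ∀ x ∈ Z, x ∉ V) : Function.Bijective (σ.app V) := by
  have := hB.isIso_morphismRestrict V hV
  have h1 : IsIso ((σ ∣_ V).app ⊤) := inferInstance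
  rw [morphismRestrict_app] at h1
  have h3 : IsIso (X.presheaf.map (eqToHom (image_morphismRestrict_preimage σ V ⊤)).op) := by
    change IsIso (X.presheaf.map (eqToIso (image_morphismRestrict_preimage σ V ⊤)).hom.op)
    infer_instance
  have h2 : IsIso (σ.app (V.ι ''ᵁ ⊤)) :=
    (@isIso_comp_right_iff _ _ _ _ _ (σ.app (V.ι ''ᵁ ⊤)) (X.presheaf.map _) h3).mp h1
  rw [V.ι_image_top] at h2
  exact ConcreteCategory.bijective_of_isIso _

/-- Equational criterion for flatness: a relation in A comes from relations in P. -/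
theorem exists_of_smul_eq_smul_of_flat {P A : Type} [CommRing P] [CommRing A] [Algebra P A]
    [Module.Flat P A] {x y : P} {a b : A} (h : x • a = y • b) :
    ∃ (k : ℕ) (c d : Fin k → P) (z : Fin k → A), b = ∑ s, d s • z s ∧ ∀ s, x * c s = y * d s := by
  have hrel : ∑ s : Fin 2, (![x, -y] : Fin 2 → P) s • (![a, b] : Fin 2 → A) s = 0 := by
    simp [Fin.sum_univ_two, h]
  obtain ⟨k, c, z, hz, hc⟩ := Module.Flat.isTrivialRelation_of_sum_smul_eq_zero (R := P) (M := A)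
    (f := ![x, -y]) (x := ![a, b]) (by simpa [Fin.sum_univ_two] using hrel)
  refine ⟨k, c 0, c 1, z, hz 1, fun s => ?_⟩
  have := hc s
  simp only [Fin.sum_univ_two, Matrix.cons_val_zero, Matrix.cons_val_one] at this
  linear_combination this

theorem X_pow_dvd_of_dvd {n : ℕ} {i j : Fin n} (hij : i ≠ j) {k l : ℕ}
    {c : MvPolynomial (Fin n) ℂ} (h : MvPolynomial.X i ^ k ∣ MvPolynomial.X j ^ l * c) :
    MvPolynomial.X i ^ k ∣ c := by
  have hp := MvPolynomial.X_prime (R := ℂ) (i := i)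
  refine hp.pow_dvd_of_dvd_mul_left k (fun h => hij ?_) h
  have := hp.dvd_of_dvd_pow h
  rwa [MvPolynomial.X_dvd_X] at this

/-- Powers of two distinct coordinates form a regular sequence in a flat algebra over a polynomial
ring. -/
theorem pow_dvd_of_mul_pow_eq_mul_pow {A : Type} [CommRing A] {n : ℕ}
    (g : MvPolynomial (Fin n) ℂ →+* A) (hg : g.Flat) {i j : Fin n} (hij : i ≠ j) (k l : ℕ) (a b : A)
    (h : g (MvPolynomial.X i) ^ k * a = g (MvPolynomial.X j) ^ l * b) :
    g (MvPolynomial.X i) ^ k ∣ b := by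
  algebraize [g]
  have hrel : (MvPolynomial.X i ^ k : MvPolynomial (Fin n) ℂ) • a =
      (MvPolynomial.X j ^ l : MvPolynomial (Fin n) ℂ) • b := by
    rw [Algebra.smul_def, Algebra.smul_def, map_pow, map_pow]
    exact h
  obtain ⟨r, c, d, z, rfl, hc⟩ := exists_of_smul_eq_smul_of_flat hrel
  refine Finset.dvd_sum fun s _ => ?_
  rw [Algebra.smul_def]
  refine Dvd.dvd.mul_right ?_ _
  rw [← map_pow]
  exact map_dvd g (X_pow_dvd_of_dvd hij ⟨c s, (hc s).symm⟩)

theorem ne_zero_of_flat {A : Type} [CommRing A] [Nontrivial A] {n : ℕ}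
    (g : MvPolynomial (Fin n) ℂ →+* A) (hg : g.Flat) (i : Fin n) : g (MvPolynomial.X i) ≠ 0 := by
  algebraize [g]
  intro h
  have h1 : IsSMulRegular (MvPolynomial (Fin n) ℂ) (MvPolynomial.X i : MvPolynomial (Fin n) ℂ) :=
    isSMulRegular_iff_right_eq_zero_of_smul.mpr fun x hx => by
      simpa [MvPolynomial.X_ne_zero] using hx
  have h2 : IsSMulRegular A (MvPolynomial.X i : MvPolynomial (Fin n) ℂ) := h1.of_flat
  have h3 : (MvPolynomial.X i : MvPolynomial (Fin n) ℂ) • (1 : A) = 0 := by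
    rw [Algebra.smul_def]
    exact (congrArg (· * 1) h).trans (zero_mul _)
  exact one_ne_zero (isSMulRegular_iff_right_eq_zero_of_smul.mp h2 _ h3)

theorem fres_app {X Y : Scheme.{0}} (σ : X ⟶ Y) {U V : Y.Opens} (h : V ≤ U) (a : Γ(Y, U)) :
    σ.app V (fres h a) = fres (X := X) (U := σ ⁻¹ᵁ U) (W := σ ⁻¹ᵁ V) (fun _ hx => h hx)
      (σ.app U a) :=
  ConcreteCategory.congr_hom (σ.naturality (homOfLE h).op) a

theorem fres_injective {X : Scheme.{0}} [IsIntegral X] {U V : X.Opens} (h : V ≤ U)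
    (hV : (V : Set X).Nonempty) : Function.Injective (fres h) := by
  have : Nonempty V := hV.to_subtype
  exact map_injective_of_isIntegral X (homOfLE h)

theorem IsBlowup.app_injective_of_le {X Y : Scheme.{0}} [IsIntegral Y] {σ : X ⟶ Y}
    {V D : Y.Opens} (hDV : D ≤ V) (hD : (D : Set Y).Nonempty)
    (hb : Function.Injective (σ.app D)) : Function.Injective (σ.app V) := by
  intro a b hab
  refine fres_injective hDV hD (hb ?_)
  rw [fres_app, fres_app, hab]

/-- A Hartogs argument. A function b over σ⁻¹(V) descends where a coordinate is invertible, so it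
becomes a function on V after multiplication by a power of either of two coordinates. Powers of two
coordinates form a regular sequence, so the denominator divides. -/
theorem IsBlowup.app_bijective_of_chart {X Y : Scheme.{0}} [IsIntegral X] [IsIntegral Y]
    {σ : X ⟶ Y} {Z : TopologicalSpace.Closeds Y}
    (hB : IsBlowup σ (Scheme.IdealSheafData.vanishingIdeal Z)) {V : Y.Opens} (hV : IsAffineOpen V)
    {p : Y} (hp : p ∈ V) (hVZ : ∀ x ∈ Z, x ∈ V → x = p) {n : ℕ} (hn : 2 ≤ n)
    (g : MvPolynomial (Fin n) ℂ →+* Γ(Y, V)) (hg : g.Flat)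
    (hgp : ∀ i, g (MvPolynomial.X i) ∈ pointIdeal p hp) : Function.Bijective (σ.app V) := by
  have : Nonempty V := ⟨⟨p, hp⟩⟩
  set t : Fin n → Γ(Y, V) := fun i => g (MvPolynomial.X i) with ht
  have ht0 : ∀ i, t i ≠ 0 := ne_zero_of_flat g hg
  have hDZ : ∀ i, ∀ x ∈ Z, x ∉ Y.basicOpen (t i) := by
    intro i x hx hxD
    obtain rfl := hVZ x hx (Y.basicOpen_le _ hxD)
    exact mem_pointIdeal_iff.mp (hgp i) hxD
  have hbij := fun i => hB.app_bijective _ (hDZ i)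
  have hne : ∀ i, ((Y.basicOpen (t i) : Y.Opens) : Set Y).Nonempty := by
    intro i
    by_contra h
    exact ht0 i (basicOpen_eq_bot_iff _ |>.mp (TopologicalSpace.Opens.not_nonempty_iff_eq_bot _ |>.mp h))
  have hinj : Function.Injective (σ.app V) :=
    IsBlowup.app_injective_of_le (Y.basicOpen_le (t ⟨0, by omega⟩)) (hne _) (hbij _).1
  have hne' : ∀ i, ((σ ⁻¹ᵁ Y.basicOpen (t i) : X.Opens) : Set X).Nonempty := by
    intro i
    by_contra h
    rw [TopologicalSpace.Opens.not_nonempty_iff_eq_bot] at h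
    have h1 : Subsingleton Γ(X, σ ⁻¹ᵁ Y.basicOpen (t i)) := by
      rw [h]; infer_instance
    have : Nonempty (Y.basicOpen (t i)) := (hne i).to_subtype
    exact zero_ne_one ((hbij i).1 (Subsingleton.elim (σ.app _ 0) (σ.app _ 1)))
  have hneV : Nonempty (σ ⁻¹ᵁ V : X.Opens) := by
    obtain ⟨x, hx⟩ := hne' ⟨0, by omega⟩
    exact ⟨⟨x, Y.basicOpen_le _ hx⟩⟩
  refine ⟨hinj, fun b => ?_⟩
  have key : ∀ i, ∃ (k : ℕ) (a : Γ(Y, V)), σ.app V (t i) ^ k * b = σ.app V a := by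
    intro i
    obtain ⟨c, hc⟩ := (hbij i).2 (fres (X := X) (U := σ ⁻¹ᵁ V)
      (fun _ hx => Y.basicOpen_le (t i) hx) b)
    have := hV.isLocalization_basicOpen (t i)
    obtain ⟨⟨a, ⟨_, k, rfl⟩⟩, ha⟩ := IsLocalization.surj (Submonoid.powers (t i)) c
    have ha : c * fres (Y.basicOpen_le (t i)) (t i ^ k) = fres (Y.basicOpen_le (t i)) a := ha
    refine ⟨k, a, fres_injective (X := X) (U := σ ⁻¹ᵁ V) (fun _ hx => Y.basicOpen_le (t i) hx)
      (hne' i) ?_⟩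
    rw [← fres_app, ← ha, map_mul, map_mul, hc, fres_app, map_pow, map_pow, map_pow, mul_comm]
  obtain ⟨k, a, ha⟩ := key ⟨0, by omega⟩
  obtain ⟨l, a', ha'⟩ := key ⟨1, by omega⟩
  -- Both sides pull back to the product of b with the two powers.
  have h1 : t ⟨0, by omega⟩ ^ k * a' = t ⟨1, by omega⟩ ^ l * a := by
    apply hinj
    rw [map_mul, map_mul, ← ha, ← ha', map_pow, map_pow]
    ring
  obtain ⟨q, rfl⟩ := pow_dvd_of_mul_pow_eq_mul_pow g hg
    (by simp [Fin.ext_iff]) k l a' a h1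
  refine ⟨q, ?_⟩
  rw [map_mul, map_pow] at ha
  refine (mul_left_cancel₀ (pow_ne_zero k ?_) ha).symm
  exact fun h => ht0 _ (hinj (h.trans (map_zero _).symm))

theorem exists_affine_chart {X : Scheme.{0}} (x : X) (O : X.Opens) (hx : x ∈ O) :
    ∃ V : X.Opens, IsAffineOpen V ∧ x ∈ V ∧ V ≤ O := by
  obtain ⟨V, hV, hxV, h⟩ := exists_isAffineOpen_mem_and_subset (x := x) (U := O) hx
  exact ⟨V, hV, hxV, h⟩

theorem exists_centered_chart_of_mem {X : Scheme.{0}} {n : ℕ} {f : X ⟶ SpecC}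
    (hf : SmoothOfRelativeDimension n f) (Z : TopologicalSpace.Closeds X)
    (hZ : (Z : Set X).Finite) (hcl : ∀ p ∈ Z, IsClosed {p}) (p : X) (hp : p ∈ Z) (O : X.Opens)
    (hpO : p ∈ O) :
    ∃ V : X.Opens, IsAffineOpen V ∧ V ≤ O ∧ (∀ x ∈ Z, x ∈ V → x = p) ∧ ∃ hpV : p ∈ V,
      ∃ g : MvPolynomial (Fin n) ℂ →+* Γ(X, V), (∀ c, g (MvPolynomial.C c) = scalars f V c) ∧
        g.Flat ∧ pointIdeal p hpV = Ideal.span (Set.range fun i => g (MvPolynomial.X i)) := by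
  have hc : IsClosed ((Z : Set X) \ {p}) := by
    have h : (Z : Set X) \ {p} = ⋃ x ∈ (Z : Set X) \ {p}, {x} :=
      (Set.biUnion_of_singleton _).symm
    rw [h]
    exact (hZ.subset Set.sdiff_subset).isClosed_biUnion fun x hx => hcl x hx.1
  obtain ⟨V, hV, hVO, hpV, g, h⟩ := exists_centered_chart hf p (hcl p hp)
    (O ⊓ ⟨((Z : Set X) \ {p})ᶜ, hc.isOpen_compl⟩) ⟨hpO, fun h => h.2 rfl⟩
  refine ⟨V, hV, fun x hx => (hVO hx).1, fun x hxZ hx => ?_, hpV, g, h⟩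
  by_contra hxp
  exact (hVO hx).2 ⟨hxZ, hxp⟩

/-- The direct image of the structure sheaf under the blowing up of a smooth variety of dimension
at least two at finitely many points is the structure sheaf. -/
theorem IsBlowup.exists_app_bijective {X Y : Scheme.{0}} [IsIntegral X] [IsIntegral Y]
    {σ : X ⟶ Y} {Z : TopologicalSpace.Closeds Y}
    (hB : IsBlowup σ (Scheme.IdealSheafData.vanishingIdeal Z)) {n : ℕ} (hn : 2 ≤ n)
    {f : Y ⟶ SpecC} (hf : SmoothOfRelativeDimension n f)
    (hZ : (Z : Set Y).Finite) (hcl : ∀ p ∈ Z, IsClosed {p}) (y : Y) (O : Y.Opens) (hy : y ∈ O) :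
    ∃ V : Y.Opens, y ∈ V ∧ V ≤ O ∧ Function.Bijective (σ.app V) := by
  by_cases hyZ : y ∈ Z
  · obtain ⟨V, hV, hVO, hVZ, hyV, g, -, hg, hgp⟩ :=
      exists_centered_chart_of_mem hf Z hZ hcl y hyZ O hy
    exact ⟨V, hyV, hVO, hB.app_bijective_of_chart hV hyV hVZ hn g hg fun i => by
      rw [hgp]
      exact Ideal.subset_span ⟨i, rfl⟩⟩
  · exact ⟨O ⊓ ⟨(Z : Set Y)ᶜ, Z.2.isOpen_compl⟩, ⟨hy, hyZ⟩, inf_le_left,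
      hB.app_bijective _ fun x hx h => h.2 hx⟩

/-! ### Descending sections along a blowing up -/

theorem section_eq_of_locally {X : Scheme.{0}} {M : X.Modules} {O : X.Opens} {s t : Γ(M, O)}
    (h : ∀ x ∈ O, ∃ (W : X.Opens) (hW : W ≤ O), x ∈ W ∧ res hW s = res hW t) : s = t := by
  choose W hW hx hst using h
  refine TopCat.Sheaf.eq_of_locally_eq' ⟨M.presheaf, M.isSheaf⟩
    (fun x : O => W x.1 x.2) O (fun x => homOfLE (hW x.1 x.2)) ?_ s t fun x => hst x.1 x.2
  intro x hx'
  exact TopologicalSpace.Opens.mem_iSup.mpr ⟨⟨x, hx'⟩, hx x hx'⟩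

theorem exists_section_of_locally {X : Scheme.{0}} {M : X.Modules} {ι : Type} (U : ι → X.Opens)
    (hU : ∀ x, ∃ i, x ∈ U i) (s : ∀ i, Γ(M, U i))
    (h : ∀ i j, res (M := M) (inf_le_left : U i ⊓ U j ≤ U i) (s i) = res inf_le_right (s j)) :
    ∃ t : Γ(M, ⊤), ∀ i, res le_top t = s i := by
  obtain ⟨t, ht, -⟩ := TopCat.Sheaf.existsUnique_gluing' ⟨M.presheaf, M.isSheaf⟩ U ⊤
    (fun i => homOfLE le_top) (fun x _ => TopologicalSpace.Opens.mem_iSup.mpr (hU x)) s h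
  exact ⟨t, ht⟩

/-- In terms of a frame and its pullback, which is again a frame, the map on sections is the map on
functions. -/
theorem pull_bijective_of_frame {X Y : Scheme.{0}} {σ : X ⟶ Y} {M : Y.Modules} {U W : Y.Opens}
    (hW : W ≤ U) {e : Γ(M, U)} (he : IsFrame e) (hσ : Function.Bijective (σ.app W)) :
    Function.Bijective (pull σ M W) := by
  have h1 := ((he.restrict hW).isFrame_pull σ) _ le_rfl
  rw [res_self] at h1
  have h2 := he W hW
  have h3 : (pull σ M W) ∘ (fun a : Γ(Y, W) ↦ a • res hW e) =
      (fun a : Γ(X, σ ⁻¹ᵁ W) ↦ a • pull σ M W (res hW e)) ∘ (σ.app W) := by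
    ext a
    exact pull_smul σ M a _
  have h4 := h1.comp hσ
  rw [← h3] at h4
  exact (h2.of_comp_iff _).mp h4

/-- The condition `σ_* 𝒪_X = 𝒪_Y`, locally. -/
def IsAppLocallyBijective {X Y : Scheme.{0}} (σ : X ⟶ Y) : Prop :=
  ∀ (y : Y) (O : Y.Opens), y ∈ O → ∃ V : Y.Opens, y ∈ V ∧ V ≤ O ∧ Function.Bijective (σ.app V)

theorem IsAppLocallyBijective.exists_pull_bijective {X Y : Scheme.{0}} {σ : X ⟶ Y}
    (hσ : IsAppLocallyBijective σ) {M : Y.Modules} (hM : IsLineBundle M) (y : Y) (O : Y.Opens)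
    (hy : y ∈ O) : ∃ V : Y.Opens, y ∈ V ∧ V ≤ O ∧ Function.Bijective (pull σ M V) := by
  obtain ⟨U, hyU, e, he⟩ := hM.exists_frame y
  obtain ⟨V, hyV, hV, hb⟩ := hσ y (O ⊓ U) ⟨hy, hyU⟩
  exact ⟨V, hyV, hV.trans inf_le_left, pull_bijective_of_frame (hV.trans inf_le_right) he hb⟩

theorem IsAppLocallyBijective.pull_injective {X Y : Scheme.{0}} {σ : X ⟶ Y}
    (hσ : IsAppLocallyBijective σ) {M : Y.Modules} (hM : IsLineBundle M) (O : Y.Opens) :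
    Function.Injective (pull σ M O) := by
  intro s t hst
  refine section_eq_of_locally fun y hy => ?_
  obtain ⟨V, hyV, hVO, hb⟩ := hσ.exists_pull_bijective hM y O hy
  refine ⟨V, hVO, hyV, hb.1 ?_⟩
  rw [pull_res, pull_res, hst]

theorem IsAppLocallyBijective.pull_surjective {X Y : Scheme.{0}} {σ : X ⟶ Y}
    (hσ : IsAppLocallyBijective σ) {M : Y.Modules} (hM : IsLineBundle M) :
    Function.Surjective (pull σ M ⊤) := by
  intro b
  choose V hV _ hb using fun y => hσ.exists_pull_bijective hM y ⊤ trivial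
  have hle := fun y => σ.preimage_mono (le_top : V y ≤ ⊤)
  choose s hs using fun y => (hb y).2 (res (hle y) b)
  obtain ⟨t, ht⟩ := exists_section_of_locally (M := M) V (fun y => ⟨y, hV y⟩) s (fun i j => by
    apply hσ.pull_injective hM
    rw [pull_res, pull_res, hs, hs, res_res, res_res])
  refine ⟨t, section_eq_of_locally fun x _ => ⟨σ ⁻¹ᵁ V (σ x), hle (σ x), hV (σ x), ?_⟩⟩
  rw [← hs, ← ht (σ x), pull_res]

theorem app_injective_of_affine {X : Scheme.{0}} {M N : X.Modules} (ι : M ⟶ N)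
    (h : ∀ U : X.affineOpens, Function.Injective (ι.app U.1)) (O : X.Opens) :
    Function.Injective (ι.app O) := by
  intro s t hst
  refine section_eq_of_locally fun x hx => ?_
  obtain ⟨V, hV, hxV, hVO⟩ := exists_affine_chart x O hx
  refine ⟨V, hVO, hxV, h ⟨V, hV⟩ ?_⟩
  change ι.app V _ = ι.app V _
  rw [app_res, app_res, hst]

theorem fres_self {X : Scheme.{0}} {U : X.Opens} (h : U ≤ U) (a : Γ(X, U)) : fres h a = a :=
  congr($(X.presheaf.map_id _) a)

theorem scalars_top {X : Scheme.{0}} (f : X ⟶ SpecC) (c : ℂ) :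
    scalars f ⊤ c = f.appTop ((Scheme.ΓSpecIso (CommRingCat.of ℂ)).inv c) :=
  fres_self _ _

theorem app_scalars {X X' : Scheme.{0}} {f : X ⟶ SpecC} {f' : X' ⟶ SpecC} {σ : X ⟶ X'}
    (h : σ ≫ f' = f) (V : X'.Opens) (c : ℂ) :
    σ.app V (scalars f' V c) = scalars f (σ ⁻¹ᵁ V) c := by
  subst h
  rw [← fres_scalars f' le_top c, fres_app, ← fres_scalars (σ ≫ f') (le_top : σ ⁻¹ᵁ V ≤ ⊤) c,
    scalars_top, scalars_top]
  rfl

theorem H0.toSection_smul {X : Scheme.{0}} {f : X ⟶ SpecC} {M : X.Modules} (c : ℂ) (s : H0 f M) :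
    (c • s).toSection = scalars f ⊤ c • s.toSection := rfl

/-- Pushing forward sections of `L = I σ^* L'`. -/
theorem exists_pushforward_sections {X X' : Scheme.{0}} {f : X ⟶ SpecC} {f' : X' ⟶ SpecC}
    {σ : X ⟶ X'} (h : σ ≫ f' = f) (hσ : IsAppLocallyBijective σ) {L : X.Modules} {L' : X'.Modules}
    (hL' : IsLineBundle L') (ι : L ⟶ (Scheme.Modules.pullback σ).obj L')
    (hι : Function.Injective (ι.app ⊤)) :
    ∃ φ : H0 f L →ₗ[ℂ] H0 f' L', Function.Injective φ ∧
      ∀ s : H0 f L, pull σ L' ⊤ (φ s).toSection = ι.app ⊤ s.toSection := by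
  have hinj := hσ.pull_injective hL' ⊤
  choose φ hφ using fun s : H0 f L => hσ.pull_surjective hL' (ι.app ⊤ s.toSection)
  let φ' : H0 f L →ₗ[ℂ] H0 f' L' :=
    { toFun := φ
      map_add' := fun s t => hinj (by
        rw [hφ]
        exact ((ι.app ⊤).hom.map_add _ _).trans
          ((congrArg₂ (· + ·) (hφ s) (hφ t)).symm.trans ((pull σ L' ⊤).hom.map_add _ _).symm))
      map_smul' := fun c s => hinj (by
        refine (hφ _).trans ?_
        refine (Scheme.Modules.Hom.app_smul ι (scalars f ⊤ c) s.toSection).trans ?_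
        refine Eq.trans ?_ (pull_smul σ L' (scalars f' ⊤ c) (φ s)).symm
        rw [hφ, app_scalars h]
        rfl) }
  refine ⟨φ', fun s t hst => hι ?_, hφ⟩
  have h1 : φ s = φ t := hst
  have := (hφ s).symm.trans ((congrArg _ h1).trans (hφ t))
  exact this

/-! ### Curves through the centre of a blowing up -/

-- B = C ⊗_P A, the pullback of a chart A, flat over P, along a subvariety C of affine space;
-- flatness of C → B is base change. The map ψ is the point of the fibre product lying over the
-- given points of A and C.
open TensorProduct in
theorem exists_flat_pushout {P C A K : Type} [CommRing P] [CommRing C] [CommRing A] [CommRing K]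
    (θ : P →+* C) (g : P →+* A) (hg : g.Flat) (e : C →+* K) (val : A →+* K)
    (h : e.comp θ = val.comp g) :
    ∃ (B : Type) (_ : CommRing B) (ρ : A →+* B) (l : C →+* B) (ψ : B →+* K), l.Flat ∧
      (∀ x, ρ (g x) = l (θ x)) ∧ (∀ a, ψ (ρ a) = val a) ∧ ∀ c, ψ (l c) = e c := by
  algebraize [g, θ, val.comp g]
  let val' : A →ₐ[P] K := { val with commutes' := fun _ => rfl }
  let e' : C →ₐ[P] K := { e with commutes' := fun x => congr($h x) }
  let ψ : C ⊗[P] A →ₐ[P] K := Algebra.TensorProduct.lift e' val' fun _ _ => mul_comm _ _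
  refine ⟨C ⊗[P] A, inferInstance, (Algebra.TensorProduct.includeRight : A →ₐ[P] _).toRingHom,
    algebraMap C _, ψ.toRingHom, ?_, fun x => ?_, fun a => ?_, fun c => ?_⟩
  · rw [RingHom.flat_algebraMap_iff]
    infer_instance
  · have h2 : g x = x • (1 : A) := by rw [Algebra.smul_def, mul_one]; rfl
    have h3 : θ x = x • (1 : C) := by rw [Algebra.smul_def, mul_one]; rfl
    change ((1 : C) ⊗ₜ[P] g x) = θ x ⊗ₜ[P] (1 : A)
    rw [h2, h3, TensorProduct.smul_tmul]
  · refine (Algebra.TensorProduct.lift_tmul e' val' _ 1 a).trans ?_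
    rw [map_one, one_mul]
    rfl
  · refine (Algebra.TensorProduct.lift_tmul e' val' _ c 1).trans ?_
    rw [map_one, mul_one]
    rfl

/-- A curve through the origin with tangent direction `v`. -/
theorem exists_curve {A : Type} [CommRing A] {n : ℕ}
    (g : MvPolynomial (Fin n) ℂ →+* A) (hg : g.Flat) (v : Fin n → ℂ) (val : A →+* ℂ)
    (hval : ∀ i, val (g (MvPolynomial.X i)) = 0) (hvalC : ∀ c, val (g (MvPolynomial.C c)) = c) :
    ∃ (B : Type) (_ : CommRing B) (ρ : A →+* B) (u : B) (j : ℂ →+* B) (ψ : B →+* ℂ),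
      u ∈ nonZeroDivisors B ∧ (∀ i, ρ (g (MvPolynomial.X i)) = j (v i) * u) ∧ ψ u = 0 ∧
      (∀ a, ψ (ρ a) = val a) ∧ (∀ c, ψ (j c) = c) := by
  -- The line through the origin in the direction v. The curve is its preimage in the chart, and its
  -- parameter stays a non-zero-divisor by flatness.
  let θ : MvPolynomial (Fin n) ℂ →+* Polynomial ℂ :=
    MvPolynomial.eval₂Hom Polynomial.C fun i => Polynomial.C (v i) * Polynomial.X
  have hev : (Polynomial.evalRingHom (0 : ℂ)).comp θ = val.comp g := by
    apply MvPolynomial.ringHom_ext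
    · intro c; simp [θ, hvalC]
    · intro i; simp [θ, hval]
  obtain ⟨B, _, ρ, l, ψ, hl, h1, h2, h3⟩ := exists_flat_pushout θ g hg _ val hev
  refine ⟨B, inferInstance, ρ, l Polynomial.X, l.comp Polynomial.C, ψ, ?_, fun i => ?_, ?_, h2,
    fun c => ?_⟩
  · algebraize [l]
    have h1 : IsSMulRegular (Polynomial ℂ) (Polynomial.X : Polynomial ℂ) :=
      isSMulRegular_iff_right_eq_zero_of_smul.mpr fun x hx => by
        simpa [Polynomial.X_ne_zero] using hx
    have h2 : IsSMulRegular B (Polynomial.X : Polynomial ℂ) := IsSMulRegular.of_flat (S := B) h1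
    rw [mem_nonZeroDivisors_iff_right]
    intro b hb
    refine isSMulRegular_iff_right_eq_zero_of_smul.mp h2 b ?_
    rw [Algebra.smul_def, mul_comm]
    exact hb
  · rw [h1, RingHom.comp_apply, ← map_mul]
    simp [θ]
  · rw [h3]; simp
  · rw [RingHom.comp_apply, h3]; simp

/-- Here G is the ring of functions on an open part of the blowing up, κ an equation of the
exceptional divisor, and H restriction to the lifted curve with parameter μ. The quotients z_i = t_i
/ κ are homogeneous coordinates of the point of the exceptional divisor. Since κ is a combination of
the t_i, it restricts to ημ; cancelling μ shows that the z_i are proportional to the tangent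
direction w, with factor η not vanishing at the point. -/
theorem exists_tangent_factors {A G R : Type} [CommRing A] [CommRing G] [CommRing R] {n : ℕ}
    (α : A →+* G) (H : G →+* R) (q : Ideal R) [q.IsPrime] (t : Fin n → A) (w : Fin n → R)
    (hw : ∃ i, w i ∉ q) (μ : R) (hμ : μ ∈ nonZeroDivisors R) (ht : ∀ i, H (α (t i)) = w i * μ)
    (κ : G) (hκ : Ideal.span {κ} = Ideal.span (Set.range fun i => α (t i))) :
    ∃ (η : R) (z : Fin n → G), η ∉ q ∧ (∀ i, α (t i) = z i * κ) ∧ ∀ i, η * H (z i) = w i := by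
  have h1 : ∀ i, ∃ z, z * κ = α (t i) := fun i =>
    Ideal.mem_span_singleton'.mp (hκ ▸ Ideal.subset_span ⟨i, rfl⟩)
  choose z hz using h1
  have h2 : κ ∈ Ideal.span (Set.range fun i => α (t i)) :=
    hκ ▸ Ideal.mem_span_singleton_self κ
  obtain ⟨r, hr⟩ := (Ideal.mem_span_range_iff_exists_fun).mp h2
  set η : R := ∑ i, H (r i) * w i with hη
  have h3 : H κ = η * μ := by
    rw [← hr, map_sum, hη, Finset.sum_mul]
    refine Finset.sum_congr rfl fun i _ => ?_
    rw [map_mul, ht, mul_assoc]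
  have h4 : ∀ i, η * H (z i) = w i := by
    intro i
    refine (mul_cancel_right_mem_nonZeroDivisors hμ).mp ?_
    rw [← ht, ← hz, map_mul, h3]
    ring
  refine ⟨η, z, fun h => ?_, fun i => (hz i).symm, h4⟩
  obtain ⟨i, hi⟩ := hw
  exact hi (h4 i ▸ Ideal.mul_mem_right _ _ h)

/-- Dividing Σ b_i t_i by κ leaves c = Σ b_i z_i, and ηc restricts to Σ b_i w_i on the curve. -/
theorem linear_transform_mem {A G R : Type} [CommRing A] [CommRing G] [CommRing R] {n : ℕ}
    {α : A →+* G} {H : G →+* R} {q : Ideal R} [hq : q.IsPrime] {t : Fin n → A} {w : Fin n → R}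
    {κ : G} (hκ : κ ∈ nonZeroDivisors G) {η : R} {z : Fin n → G} (hη : η ∉ q)
    (hz : ∀ i, α (t i) = z i * κ) (hw : ∀ i, η * H (z i) = w i) (b : Fin n → A) (c : G)
    (hc : α (∑ i, b i * t i) = c * κ) (hb : ∑ i, H (α (b i)) * w i ∈ q) : H c ∈ q := by
  have h1 : c = ∑ i, α (b i) * z i := by
    refine (mul_cancel_right_mem_nonZeroDivisors hκ).mp ?_
    rw [← hc, map_sum, Finset.sum_mul]
    exact Finset.sum_congr rfl fun i _ => by rw [map_mul, hz, mul_assoc]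
  refine (hq.mem_or_mem (x := η) ?_).resolve_left hη
  rw [h1, map_sum, Finset.mul_sum]
  convert! hb using 2 with i
  rw [← hw, map_mul]
  ring

/-- Here κ divides out twice: d = Σ b_ij z_i z_j, and η²d restricts to the quadratic form evaluated
at w. -/
theorem quadratic_transform_mem {A G R : Type} [CommRing A] [CommRing G] [CommRing R] {n : ℕ}
    {α : A →+* G} {H : G →+* R} {q : Ideal R} [hq : q.IsPrime] {t : Fin n → A} {w : Fin n → R}
    {κ : G} (hκ : κ ∈ nonZeroDivisors G) {η : R} {z : Fin n → G} (hη : η ∉ q)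
    (hz : ∀ i, α (t i) = z i * κ) (hw : ∀ i, η * H (z i) = w i) (b : Fin n → Fin n → A) (c : G)
    (hc : α (∑ i, ∑ j, b i j * (t i * t j)) = c * κ)
    (hb : ∑ i, ∑ j, H (α (b i j)) * (w i * w j) ∈ q) : ∃ d, c = κ * d ∧ H d ∈ q := by
  refine ⟨∑ i, ∑ j, α (b i j) * (z i * z j), ?_, ?_⟩
  · refine (mul_cancel_right_mem_nonZeroDivisors hκ).mp ?_
    rw [← hc]
    simp only [map_sum, Finset.mul_sum, Finset.sum_mul]
    refine Finset.sum_congr rfl fun i _ => Finset.sum_congr rfl fun j _ => ?_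
    rw [map_mul, map_mul, hz, hz]
    ring
  · refine (hq.mem_or_mem (x := η * η) ?_).resolve_left fun h => ?_
    · convert! hb using 1
      simp only [map_sum, Finset.mul_sum]
      refine Finset.sum_congr rfl fun i _ => Finset.sum_congr rfl fun j _ => ?_
      rw [← hw, ← hw, map_mul, map_mul]
      ring
    · exact hη ((hq.mem_or_mem h).elim id id)

theorem exists_ne_zero_quadratic {n : ℕ} (hn : 2 ≤ n) (b : Fin n → Fin n → ℂ) :
    ∃ v : Fin n → ℂ, (∃ i, v i ≠ 0) ∧ ∑ i, ∑ j, b i j * (v i * v j) = 0 := by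
  obtain ⟨m, rfl⟩ := Nat.exists_eq_add_of_le' hn
  by_cases h0 : b 0 0 = 0
  · refine ⟨Pi.single 0 1, ⟨0, by simp⟩, ?_⟩
    simp [Pi.single_apply, h0]
  · obtain ⟨r, hr⟩ := IsAlgClosed.exists_pow_nat_eq
      (discrim (b 0 0) (b 0 1 + b 1 0) (b 1 1)) (n := 2) (by norm_num)
    -- Only the first two variables are used: the binary form has a zero (x, 1).
    obtain ⟨x, hx⟩ := exists_quadratic_eq_zero h0 ⟨r, by rw [← hr, sq]⟩
    refine ⟨Fin.cons x (Fin.cons 1 0), ⟨1, by simp⟩, ?_⟩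
    simp only [Fin.sum_univ_succ, Fin.cons_zero, Fin.cons_succ, Pi.zero_apply, mul_zero,
      zero_mul, Finset.sum_const_zero, add_zero, Fin.succ_zero_eq_one]
    linear_combination hx

/-- A zero of the square of the linear form, which is quadratic. -/
theorem exists_ne_zero_linear {n : ℕ} (hn : 2 ≤ n) (b : Fin n → ℂ) :
    ∃ v : Fin n → ℂ, (∃ i, v i ≠ 0) ∧ ∑ i, b i * v i = 0 := by
  obtain ⟨v, hv, h⟩ := exists_ne_zero_quadratic hn fun i j => b i * b j
  refine ⟨v, hv, pow_eq_zero_iff two_ne_zero |>.mp (Eq.trans ?_ h)⟩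
  rw [sq, Finset.sum_mul_sum]
  exact Finset.sum_congr rfl fun i _ => Finset.sum_congr rfl fun j _ => by ring

/-! ### Lifting the curve to the blowing up. -/

theorem appLE_specMap_fromSpec {Y : Scheme.{0}} {V : Y.Opens} (hV : IsAffineOpen V)
    {B : CommRingCat.{0}} (ρ : Γ(Y, V) ⟶ B) (e : ⊤ ≤ (Spec.map ρ ≫ hV.fromSpec) ⁻¹ᵁ V) :
    (Spec.map ρ ≫ hV.fromSpec).appLE V ⊤ e = ρ ≫ (Scheme.ΓSpecIso B).inv := by
  have e' : ⊤ ≤ Spec.map ρ ⁻¹ᵁ (hV.fromSpec ⁻¹ᵁ V) := e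
  refine (Scheme.Hom.comp_appLE (Spec.map ρ) hV.fromSpec V ⊤ e).trans ?_
  change hV.fromSpec.app V ≫ (Spec.map ρ).appLE (hV.fromSpec ⁻¹ᵁ V) ⊤ e' = _
  rw [hV.fromSpec_app_self, Category.assoc, Scheme.Hom.map_appLE, Scheme.ΓSpecIso_inv_naturality]
  exact congrArg _ (Scheme.Hom.app_eq_appLE (f := Spec.map ρ) (U := ⊤)).symm

theorem preimage_specMap_fromSpec {Y : Scheme.{0}} {V : Y.Opens} (hV : IsAffineOpen V)
    {B : CommRingCat.{0}} (ρ : Γ(Y, V) ⟶ B) : (Spec.map ρ ≫ hV.fromSpec) ⁻¹ᵁ V = ⊤ := by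
  rw [Scheme.Hom.comp_preimage, hV.fromSpec_preimage_self]
  rfl

theorem isEffectiveCartier_comap_specMap {Y : Scheme.{0}} {V : Y.Opens} (hV : IsAffineOpen V)
    (I : Y.IdealSheafData) {B : CommRingCat.{0}} (ρ : Γ(Y, V) ⟶ B) (u : B)
    (hu : u ∈ nonZeroDivisors B) (hI : (I.ideal ⟨V, hV⟩).map ρ.hom = Ideal.span {u}) :
    IsEffectiveCartier (I.comap (Spec.map ρ ≫ hV.fromSpec)) := by
  intro t
  refine ⟨⟨⊤, isAffineOpen_top _⟩, trivial, (Scheme.ΓSpecIso B).inv u, ?_, ?_⟩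
  · exact (MulEquivClass.map_nonZeroDivisors
      (Scheme.ΓSpecIso B).symm.commRingCatIsoToRingEquiv).le ⟨u, hu, rfl⟩
  · rw [ideal_comap I _ ⟨V, hV⟩ ⟨⊤, isAffineOpen_top _⟩ (preimage_specMap_fromSpec hV ρ).ge,
      appLE_specMap_fromSpec, CommRingCat.hom_comp, ← Ideal.map_map, hI, Ideal.map_span,
      Set.image_singleton]

theorem germ_appLE {X Y T : Scheme.{0}} {σ : X ⟶ Y} {h : T ⟶ X} {q : T ⟶ Y} (hq : h ≫ σ = q)
    {V : Y.Opens} {U : X.Opens} (hU : U ≤ σ ⁻¹ᵁ V) (e : ⊤ ≤ q ⁻¹ᵁ V) (τ : T) (hτ : τ ∈ h ⁻¹ᵁ U)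
    (a : Γ(Y, V)) :
    T.presheaf.germ (h ⁻¹ᵁ U) τ hτ (h.app U (σ.appLE V U hU a)) =
      T.presheaf.germ ⊤ τ trivial (q.appLE V ⊤ e a) := by
  subst hq
  have h1 : h.app U (σ.appLE V U hU a) =
      fres (X := T) (U := ⊤) le_top ((h ≫ σ).appLE V ⊤ e a) := by
    rw [Scheme.Hom.app_eq_appLE]
    simp only [fres, ← CommRingCat.comp_apply, Scheme.Hom.appLE_comp_appLE, Scheme.Hom.appLE_map]
  rw [h1, germ_fres]

theorem germ_app_mem_maximalIdeal_iff {X T : Scheme.{0}} (h : T ⟶ X) {U : X.Opens} (τ : T)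
    (hτ : τ ∈ h ⁻¹ᵁ U) (c : Γ(X, U)) :
    T.presheaf.germ (h ⁻¹ᵁ U) τ hτ (h.app U c) ∈
      IsLocalRing.maximalIdeal (T.presheaf.stalk τ) ↔ c ∈ pointIdeal (h τ) hτ := by
  refine Iff.trans ?_ (mem_pointIdeal_iff (x := h τ) (hx := hτ) (a := c)).symm
  rw [IsLocalRing.mem_maximalIdeal, mem_nonunits_iff, ← T.mem_basicOpen,
    ← Scheme.preimage_basicOpen]
  rfl

theorem isClosed_of_section {X : Scheme.{0}} {f : X ⟶ SpecC} [IsSeparated f] (r : SpecC ⟶ X)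
    (h : r ≫ f = 𝟙 _) (y : SpecC) : IsClosed {r y} := by
  have : IsClosedImmersion r := isClosedImmersion_of_comp_eq_id f r h
  have : Subsingleton SpecC := inferInstanceAs (Subsingleton (PrimeSpectrum ℂ))
  have h1 : Set.range r = {r y} := by
    ext z
    constructor
    · rintro ⟨w, rfl⟩
      rw [Subsingleton.elim w y]; rfl
    · rintro rfl
      exact ⟨y, rfl⟩
  rw [← h1]
  exact r.isClosedEmbedding.isClosed_range

theorem specMap_fromSpec_comp_eq_id {Y : Scheme.{0}} {f : Y ⟶ SpecC} {V : Y.Opens}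
    (hV : IsAffineOpen V) (val : Γ(Y, V) ⟶ CommRingCat.of ℂ)
    (hval : ∀ c, val (scalars f V c) = c) : (Spec.map val ≫ hV.fromSpec) ≫ f = 𝟙 _ := by
  apply ext_of_isAffine
  rw [← cancel_epi (Scheme.ΓSpecIso (CommRingCat.of ℂ)).inv]
  ext c
  have h1 := appLE_specMap_fromSpec hV val (preimage_specMap_fromSpec hV val).ge
  have h2 := ConcreteCategory.congr_hom h1 (scalars f V c)
  rw [CommRingCat.comp_apply, hval] at h2
  have h3 : ∀ A : SpecC ⟶ Y, (A ≫ f).appTop = f.appTop ≫ A.appLE ⊤ ⊤ le_top := fun A => by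
    rw [Scheme.Hom.comp_appTop]
    exact congrArg (f.appTop ≫ ·) (Scheme.Hom.app_eq_appLE (f := A))
  have h4 : ((Spec.map val ≫ hV.fromSpec) ≫ f).appTop = f.appTop ≫
    Y.presheaf.map (homOfLE le_top).op ≫ (Spec.map val ≫ hV.fromSpec).appLE V ⊤
      (preimage_specMap_fromSpec hV val).ge := by
    rw [Scheme.Hom.map_appLE, h3]
  rw [h4]
  refine h2.trans ?_
  simp

theorem exists_stalk_hom {B : CommRingCat.{0}} (τ : Spec B) :
    ∃ a : B →+* (Spec B).presheaf.stalk τ,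
      (∀ b, (Spec B).presheaf.germ ⊤ τ trivial ((Scheme.ΓSpecIso B).inv b) = a b) ∧
      (∀ b, a b ∈ IsLocalRing.maximalIdeal ((Spec B).presheaf.stalk τ) ↔ b ∈ τ.asIdeal) ∧
      ∀ b ∈ nonZeroDivisors B, a b ∈ nonZeroDivisors ((Spec B).presheaf.stalk τ) := by
  refine ⟨((Scheme.ΓSpecIso B).inv ≫ (Spec B).presheaf.germ ⊤ τ trivial).hom, fun b => rfl,
    fun b => ?_, fun b hb => ?_⟩
  · change (Spec B).presheaf.germ ⊤ τ trivial ((Scheme.ΓSpecIso B).inv b) ∈ _ ↔ _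
    rw [IsLocalRing.mem_maximalIdeal, mem_nonunits_iff, ← Scheme.mem_basicOpen (Spec B) (U := ⊤) _ τ trivial]
    have h1 : τ ∈ PrimeSpectrum.basicOpen b ↔
        τ ∈ (Spec B).basicOpen ((Scheme.ΓSpecIso B).inv b) := by
      rw [← basicOpen_eq_of_affine]; rfl
    rw [← h1]
    exact not_not
  · let _ : Algebra B ((Spec B).presheaf.stalk τ) :=
      ((Scheme.ΓSpecIso B).inv ≫ (Spec B).presheaf.germ ⊤ τ trivial).hom.toAlgebra
    have : τ.asIdeal.IsPrime := PrimeSpectrum.isPrime τ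
    have h : IsLocalization.AtPrime ((Spec B).presheaf.stalk τ) τ.asIdeal :=
      StructureSheaf.IsLocalization.to_stalk B τ
    exact IsLocalization.map_nonZeroDivisors_le τ.asIdeal.primeCompl _ ⟨b, hb, rfl⟩

/-- The centre pulls back to the Cartier divisor u = 0 on the curve with tangent v, because some v_i
is invertible. The curve therefore lifts to X, and x is the image of its origin. In the conclusion R
is the local ring of the curve at the origin, q its maximal ideal, μ the germ of the parameter and j
the constants. -/
theorem IsBlowup.exists_point_over {X Y : Scheme.{0}} {σ : X ⟶ Y} {Z : TopologicalSpace.Closeds Y}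
    (hB : IsBlowup σ (Scheme.IdealSheafData.vanishingIdeal Z)) {f : X ⟶ SpecC} [IsSeparated f]
    {f' : Y ⟶ SpecC} (hσ : σ ≫ f' = f) {V : Y.Opens} (hV : IsAffineOpen V) {p : Y} (hpZ : p ∈ Z)
    (hp : p ∈ V) (hVZ : ∀ x ∈ Z, x ∈ V → x = p) {n : ℕ}
    (g : MvPolynomial (Fin n) ℂ →+* Γ(Y, V))
    (hgC : ∀ c, g (MvPolynomial.C c) = scalars f' V c) (hg : g.Flat)
    (hgp : pointIdeal p hp = Ideal.span (Set.range fun i => g (MvPolynomial.X i)))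
    (val : Γ(Y, V) →+* ℂ) (hvalC : ∀ c, val (scalars f' V c) = c)
    (hval : ∀ a, val a = 0 ↔ a ∈ pointIdeal p hp) (v : Fin n → ℂ) (hv : ∃ i, v i ≠ 0) :
    ∃ x : X, IsClosed {x} ∧ σ x = p ∧ ∀ (U : X.Opens) (hU : U ≤ σ ⁻¹ᵁ V) (hxU : x ∈ U),
      ∃ (R : Type) (_ : CommRing R) (H : Γ(X, U) →+* R) (q : Ideal R) (_ : q.IsPrime) (μ : R)
        (j : ℂ →+* R), μ ∈ nonZeroDivisors R ∧ (∀ c, H c ∈ q ↔ c ∈ pointIdeal x hxU) ∧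
        (∀ i, H (σ.appLE V U hU (g (MvPolynomial.X i))) = j (v i) * μ) ∧
        ∀ a, H (σ.appLE V U hU a) - j (val a) ∈ q := by
  obtain ⟨B, _, ρ, u, j, ψ, hu, hρ, hψu, hψρ, hψj⟩ := exists_curve g hg v val
    (fun i => (hval _).mpr (hgp ▸ Ideal.subset_span ⟨i, rfl⟩)) (fun c => by rw [hgC, hvalC])
  let ρ' : Γ(Y, V) ⟶ CommRingCat.of B := CommRingCat.ofHom ρ
  let q : Spec (CommRingCat.of B) ⟶ Y := Spec.map ρ' ≫ hV.fromSpec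
  have hcart : IsEffectiveCartier ((Scheme.IdealSheafData.vanishingIdeal Z).comap q) := by
    refine isEffectiveCartier_comap_specMap hV _ ρ' u hu ?_
    rw [vanishingIdeal_ideal_eq_pointIdeal Z ⟨V, hV⟩ p hpZ hp hVZ, hgp, Ideal.map_span]
    apply le_antisymm
    · rw [Ideal.span_le]
      rintro _ ⟨_, ⟨i, rfl⟩, rfl⟩
      exact Ideal.mem_span_singleton'.mpr ⟨j (v i), (hρ i).symm⟩
    · rw [Ideal.span_singleton_le_iff_mem]
      obtain ⟨i, hi⟩ := hv
      have h1 : u = j (v i)⁻¹ * ρ (g (MvPolynomial.X i)) := by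
        rw [hρ, ← mul_assoc, ← map_mul, inv_mul_cancel₀ hi, map_one, one_mul]
      rw [h1]
      exact Ideal.mul_mem_left _ _ (Ideal.subset_span ⟨_, ⟨i, rfl⟩, rfl⟩)
  obtain ⟨h, hh, -⟩ := hB.existsUnique_lift q hcart
  let o : SpecC := (⊥ : PrimeSpectrum ℂ)
  let τ : Spec (CommRingCat.of B) := Spec.map (CommRingCat.ofHom ψ) o
  have hτ : τ.asIdeal = RingHom.ker ψ := rfl
  have hval' : CommRingCat.ofHom val = ρ' ≫ CommRingCat.ofHom ψ := by
    ext a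
    exact (hψρ a).symm
  -- The point is the image of a section of the separated morphism f.
  have hcl : IsClosed {h τ} := by
    refine isClosed_of_section (f := f) (Spec.map (CommRingCat.ofHom ψ) ≫ h) ?_ o
    rw [← hσ, Category.assoc, reassoc_of% hh, ← Category.assoc, ← Category.assoc, ← Spec.map_comp,
      ← hval']
    exact specMap_fromSpec_comp_eq_id hV _ hvalC
  refine ⟨h τ, hcl, ?_, ?_⟩
  · rw [← Scheme.Hom.comp_apply, hh]
    refine Eq.trans ?_ (hV.fromSpec_primeIdealOf ⟨p, hp⟩)
    change hV.fromSpec (Spec.map ρ' τ) = _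
    congr 1
    apply PrimeSpectrum.ext
    rw [primeIdealOf_asIdeal]
    ext a
    rw [← hval, ← hψρ]
    rfl
  · intro U hU hxU
    obtain ⟨a, ha, ham, hau⟩ := exists_stalk_hom (B := CommRingCat.of B) τ
    have hH : ∀ b, (Spec (CommRingCat.of B)).presheaf.germ (h ⁻¹ᵁ U) τ hxU
        (h.app U (σ.appLE V U hU b)) = a (ρ b) := by
      intro b
      rw [germ_appLE hh hU (preimage_specMap_fromSpec hV ρ').ge τ hxU, appLE_specMap_fromSpec]
      exact ha (ρ b)
    refine ⟨(Spec (CommRingCat.of B)).presheaf.stalk τ, inferInstance, ((Spec (CommRingCat.of B)).presheaf.germ (h ⁻¹ᵁ U) τ hxU).hom.comp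
      (h.app U).hom, IsLocalRing.maximalIdeal _, inferInstance, a u, a.comp j, ?_,
      fun c => germ_app_mem_maximalIdeal_iff h τ hxU c, fun i => ?_, fun b => ?_⟩
    · exact hau u hu
    · refine (hH _).trans ?_
      rw [hρ, map_mul]; rfl
    · have h1 : a (ρ b - j (val b)) ∈ IsLocalRing.maximalIdeal _ := by
        rw [ham, hτ, RingHom.mem_ker, map_sub, hψρ, hψj, sub_self]
      rw [map_sub, ← hH] at h1
      exact h1

/-! ### Singularities of corresponding sections -/

theorem IsFrame.smul_mem_iff {X : Scheme.{0}} {M : X.Modules} {U : X.Opens} {e : Γ(M, U)}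
    (he : IsFrame e) (I : Ideal Γ(X, U)) (a : Γ(X, U)) :
    a • e ∈ I • (⊤ : Submodule Γ(X, U) Γ(M, U)) ↔ a ∈ I := by
  have h1 := he U le_rfl
  simp only [res_self] at h1
  refine ⟨fun h => ?_, fun h => Submodule.smul_mem_smul h trivial⟩
  let E : Γ(X, U) ≃ₗ[Γ(X, U)] Γ(M, U) :=
    LinearEquiv.ofBijective (LinearMap.toSpanSingleton Γ(X, U) Γ(M, U) e) h1
  have h2 := Submodule.mem_map_of_mem (f := E.symm.toLinearMap) h
  rw [Submodule.map_smul''] at h2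
  have h3 : E.symm.toLinearMap (a • e) = a := E.symm_apply_apply a
  rw [h3] at h2
  have h4 : I * (Submodule.map E.symm.toLinearMap ⊤ : Ideal Γ(X, U)) ≤ I := Ideal.mul_le_left
  exact h4 h2

/-- Local form of an isomorphism `L ≃ I σ^* L'`. -/
theorem exists_local_equation {X Y : Scheme.{0}} {σ : X ⟶ Y} {L : X.Modules} (hL : IsLineBundle L)
    {L' : Y.Modules} {J : X.IdealSheafData} (ι : L ⟶ (Scheme.Modules.pullback σ).obj L')
    (hι : ∀ U : X.affineOpens, Function.Injective (ι.app U.1) ∧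
      ∀ b : Γ((Scheme.Modules.pullback σ).obj L', U.1), (∃ a : Γ(L, U.1), ι.app U.1 a = b) ↔
      b ∈ J.ideal U • (⊤ : Submodule Γ(X, U.1) Γ((Scheme.Modules.pullback σ).obj L', U.1)))
    {V : Y.Opens} {l : Γ(L', V)} (hl : IsFrame l) (x : X) (O : X.Opens) (hxO : x ∈ O)
    (hx : x ∈ σ ⁻¹ᵁ V) :
    ∃ (U : X.Opens) (hUa : IsAffineOpen U) (hU : U ≤ σ ⁻¹ᵁ V), x ∈ U ∧ U ≤ O ∧
      ∃ (m : Γ(L, U)) (κ : Γ(X, U)), IsFrame m ∧ κ ∈ nonZeroDivisors Γ(X, U) ∧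
        J.ideal ⟨U, hUa⟩ = Ideal.span {κ} ∧
        ∀ (s : Γ(L, ⊤)) (s' : Γ(L', ⊤)), pull σ L' ⊤ s' = ι.app ⊤ s →
          ∀ a : Γ(Y, V), res le_top s' = a • l →
          ∃ c : Γ(X, U), res le_top s = c • m ∧ σ.appLE V U hU a = c * κ := by
  obtain ⟨U₁, hxU₁, m₁, hm₁⟩ := hL.exists_frame x
  obtain ⟨U, hUa, hxU, hle⟩ := exists_affine_chart x (U₁ ⊓ σ ⁻¹ᵁ V ⊓ O) ⟨⟨hxU₁, hx⟩, hxO⟩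
  have hU : U ≤ σ ⁻¹ᵁ V := fun y hy => (hle hy).1.2
  have hUU : U ≤ U₁ := fun y hy => (hle hy).1.1
  set m := res hUU m₁
  have hm : IsFrame m := hm₁.restrict hUU
  set e := res hU (pull σ L' V l) with he'
  have he : IsFrame e := (hl.isFrame_pull σ).restrict hU
  obtain ⟨hinj, hran⟩ := hι ⟨U, hUa⟩
  have hinj : Function.Injective (ι.app U) := hinj
  have he1 := he U le_rfl
  have hm1 := hm U le_rfl
  simp only [res_self] at he1 hm1
  -- The local equation of the exceptional divisor is the matrix of ι in the two frames: injectivity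
  -- of ι makes it a non-zero-divisor, and the description of the image makes it generate the ideal.
  obtain ⟨κ, hκ⟩ := he1.2 (ι.app U m)
  have hκ : κ • e = ι.app U m := hκ
  have hιsmul : ∀ a : Γ(X, U), ι.app U (a • m) = (a * κ) • e := fun a => by
    rw [Scheme.Modules.Hom.app_smul, ← hκ, mul_smul]
  refine ⟨U, hUa, hU, hxU, fun y hy => (hle hy).2, m, κ, hm, ?_, ?_, ?_⟩
  · rw [mem_nonZeroDivisors_iff_right]
    intro a ha
    have h1 := hιsmul a
    rw [ha, zero_smul] at h1
    refine hm1.1 ?_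
    change a • m = (0 : Γ(X, U)) • m
    rw [zero_smul]
    exact hinj (h1.trans ((ι.app U).hom.map_zero).symm)
  · ext a
    have h1 := hran (a • e)
    have h2 := he.smul_mem_iff (J.ideal ⟨U, hUa⟩) a
    rw [← h2, ← h1, Ideal.mem_span_singleton']
    constructor
    · rintro ⟨w, hw⟩
      obtain ⟨b, rfl⟩ := hm1.2 w
      exact ⟨b, he1.1 ((hιsmul b).symm.trans hw)⟩
    · rintro ⟨b, rfl⟩
      exact ⟨b • m, hιsmul b⟩
  · intro s s' hs a ha
    obtain ⟨c, hc⟩ := hm1.2 (res le_top s)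
    have hc : c • m = res le_top s := hc
    refine ⟨c, hc.symm, he1.1 ?_⟩
    change σ.appLE V U hU a • e = (c * κ) • e
    rw [← hιsmul, hc, app_res, ← hs]
    have h1 := congrArg (res hU) (congrArg (pull σ L' V) ha)
    rw [pull_res, res_res, pull_smul, res_smul] at h1
    refine Eq.trans ?_ h1.symm
    congr 1

theorem germ_appLE_mem_iff {X Y : Scheme.{0}} (σ : X ⟶ Y) {V : Y.Opens} {U : X.Opens}
    (hU : U ≤ σ ⁻¹ᵁ V) (x : X) (hx : x ∈ U) (a : Γ(Y, V)) :
    X.presheaf.germ U x hx (σ.appLE V U hU a) =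
      σ.stalkMap x (Y.presheaf.germ V (σ x) (hU hx) a) := by
  refine Eq.trans ?_ (Scheme.Hom.germ_stalkMap_apply σ V x (hU hx) a).symm
  have h1 : σ.appLE V U hU a = fres (X := X) (U := σ ⁻¹ᵁ V) hU (σ.app V a) := by
    simp only [fres, ← CommRingCat.comp_apply, Scheme.Hom.appLE]
  rw [h1, germ_fres]

section

variable {X Y : Scheme.{0}} {σ : X ⟶ Y} {Z : TopologicalSpace.Closeds Y} {L : X.Modules}
  {L' : Y.Modules} {ι : L ⟶ (Scheme.Modules.pullback σ).obj L'}

/-- `ι` identifies `L` with `I σ^* L'`. -/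
def IsTwistHom (Z : TopologicalSpace.Closeds Y) (ι : L ⟶ (Scheme.Modules.pullback σ).obj L') :
    Prop :=
  ∀ U : X.affineOpens, Function.Injective (ι.app U.1) ∧
      ∀ b : Γ((Scheme.Modules.pullback σ).obj L', U.1), (∃ a : Γ(L, U.1), ι.app U.1 a = b) ↔
      b ∈ ((Scheme.IdealSheafData.vanishingIdeal Z).comap σ).ideal U •
        (⊤ : Submodule Γ(X, U.1) Γ((Scheme.Modules.pullback σ).obj L', U.1))

/-- Away from the centre κ is a unit, so the equations of s and of the pullback of s' differ by a
unit; the stalk map is local, so it preserves vanishing and carries 𝔪² into 𝔪². -/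
theorem IsTwistHom.off_center (hι : IsTwistHom Z ι) (hL : IsLineBundle L) (hL' : IsLineBundle L')
    {s : Γ(L, ⊤)} {s' : Γ(L', ⊤)} (hs : pull σ L' ⊤ s' = ι.app ⊤ s) {x : X} (hx : σ x ∉ Z) :
    (VanishesAt s x ↔ VanishesAt s' (σ x)) ∧ (JetVanishesAt s' (σ x) → JetVanishesAt s x) := by
  obtain ⟨V, hV, l, hl⟩ := hL'.exists_frame (σ x)
  obtain ⟨U, hUa, hU, hxU, hUO, m, κ, hm, -, hκ, h⟩ := exists_local_equation hL ι hι hl x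
    (σ ⁻¹ᵁ ⟨(Z : Set Y)ᶜ, Z.2.isOpen_compl⟩) hx hV
  obtain ⟨a, ha⟩ := hl.exists_eq_smul le_rfl (res le_top s')
  rw [res_self] at ha
  obtain ⟨c, hc, hac⟩ := h s s' hs a ha
  have hug : IsUnit (X.presheaf.germ U x hxU κ) := by
    have h1 : x ∉ ((Scheme.IdealSheafData.vanishingIdeal Z).comap σ).support := by
      rw [Scheme.IdealSheafData.support_comap]
      change σ x ∉ (Scheme.IdealSheafData.vanishingIdeal Z).support
      rwa [← SetLike.mem_coe, Scheme.IdealSheafData.coe_support_vanishingIdeal]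
    rw [Scheme.IdealSheafData.mem_support_iff_of_mem (U := ⟨U, hUa⟩) hxU, hκ] at h1
    rw [← X.mem_basicOpen]
    by_contra h2
    refine h1 ((Scheme.mem_zeroLocus_iff _ _ _).mpr fun b hb => ?_)
    obtain ⟨r, rfl⟩ := Ideal.mem_span_singleton'.mp hb
    rw [Scheme.basicOpen_mul]
    exact fun h => h2 h.2
  have hg : X.presheaf.germ U x hxU c * X.presheaf.germ U x hxU κ =
      σ.stalkMap x (Y.presheaf.germ V (σ x) hV a) := by
    rw [← map_mul, ← hac, germ_appLE_mem_iff σ hU x hxU]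
  rw [hm.vanishesAt_iff hxU hc, hl.vanishesAt_iff hV ha, hm.jetVanishesAt_iff hxU hc,
    hl.jetVanishesAt_iff hV ha]
  constructor
  · rw [← Ideal.mul_unit_mem_iff_mem _ hug, hg, IsLocalRing.mem_maximalIdeal,
      IsLocalRing.mem_maximalIdeal, mem_nonunits_iff, mem_nonunits_iff, isUnit_map_iff]
  · intro h1
    rw [← Ideal.mul_unit_mem_iff_mem _ hug, hg]
    have h2 := Ideal.mem_map_of_mem (σ.stalkMap x).hom h1
    rw [Ideal.map_pow] at h2
    refine Ideal.pow_right_mono (Ideal.map_le_iff_le_comap.mpr fun r hr => ?_) 2 h2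
    rwa [Ideal.mem_comap, IsLocalRing.mem_maximalIdeal, mem_nonunits_iff, isUnit_map_iff]

theorem scalars_finiteType {X : Scheme.{0}} (f : X ⟶ SpecC) [LocallyOfFiniteType f] {V : X.Opens}
    (hV : IsAffineOpen V) : (scalars f V).FiniteType := by
  have h1 := LocallyOfFiniteType.finiteType_appLE f (isAffineOpen_top SpecC) hV le_top
  exact h1.comp (RingHom.FiniteType.of_surjective _
    (Scheme.ΓSpecIso (CommRingCat.of ℂ)).symm.commRingCatIsoToRingEquiv.surjective)

/-- The square of a maximal ideal is primary, hence contracted from the localization. -/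
theorem germ_mem_sq_iff {X : Scheme.{0}} {V : X.Opens} (hV : IsAffineOpen V) (x : X)
    (hx : x ∈ V) (hcl : IsClosed {x}) (a : Γ(X, V)) :
    X.presheaf.germ V x hx a ∈ IsLocalRing.maximalIdeal (X.presheaf.stalk x) ^ 2 ↔
      a ∈ pointIdeal x hx ^ 2 := by
  have hmax := isMaximal_pointIdeal hV x hx hcl
  let _ : Algebra Γ(X, V) (X.presheaf.stalk x) := (X.presheaf.germ V x hx).hom.toAlgebra
  have hloc : IsLocalization.AtPrime (X.presheaf.stalk x) (pointIdeal x hx) := by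
    have := hV.isLocalization_stalk ⟨x, hx⟩
    simp only [primeIdealOf_asIdeal] at this
    exact this
  have h1 : IsLocalRing.maximalIdeal (X.presheaf.stalk x) =
      (pointIdeal x hx).map (X.presheaf.germ V x hx).hom :=
    (IsLocalization.AtPrime.map_eq_maximalIdeal (pointIdeal x hx) (X.presheaf.stalk x)).symm
  rw [h1, ← Ideal.map_pow]
  refine ⟨fun h => ?_, fun h => Ideal.mem_map_of_mem _ h⟩
  obtain ⟨b, hb⟩ := (IsLocalization.mem_map_algebraMap_iff (pointIdeal x hx).primeCompl
    (X.presheaf.stalk x)).mp h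
  have hb := (map_mul (algebraMap Γ(X, V) (X.presheaf.stalk x)) a b.2).trans hb
  obtain ⟨c, hc⟩ := (IsLocalization.eq_iff_exists (pointIdeal x hx).primeCompl
    (X.presheaf.stalk x)).mp hb
  have h2 : (c : Γ(X, V)) * b.2 * a ∈ pointIdeal x hx ^ 2 := by
    rw [mul_assoc, mul_comm _ a, hc]
    exact Ideal.mul_mem_left _ _ b.1.2
  have h3 : (c : Γ(X, V)) * b.2 ∉ pointIdeal x hx := (c * b.2).2
  have hprim : (pointIdeal x hx ^ 2).IsPrimary :=
    Ideal.isPrimary_of_isMaximal_radical (by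
      rw [Ideal.radical_pow _ two_ne_zero, Ideal.IsPrime.radical inferInstance]
      exact hmax)
  refine ((Ideal.isPrimary_iff.mp hprim).2 (mul_comm _ a ▸ h2)).resolve_right ?_
  rwa [Ideal.radical_pow _ two_ne_zero, Ideal.IsPrime.radical inferInstance]

theorem exists_linear_combination {A : Type} [CommRing A] {n : ℕ} {t : Fin n → A} {a : A}
    (h : a ∈ Ideal.span (Set.range t)) : ∃ b : Fin n → A, a = ∑ i, b i * t i := by
  obtain ⟨b, hb⟩ := Ideal.mem_span_range_iff_exists_fun.mp h
  exact ⟨b, hb.symm⟩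

theorem exists_quadratic_combination {A : Type} [CommRing A] {n : ℕ} {t : Fin n → A} {a : A}
    (h : a ∈ Ideal.span (Set.range t) ^ 2) :
    ∃ b : Fin n → Fin n → A, a = ∑ i, ∑ j, b i j * (t i * t j) := by
  rw [sq] at h
  refine Submodule.mul_induction_on h (fun x hx y hy => ?_) (fun x y => ?_)
  · obtain ⟨b, rfl⟩ := exists_linear_combination hx
    obtain ⟨c, rfl⟩ := exists_linear_combination hy
    refine ⟨fun i j => b i * c j, ?_⟩
    rw [Finset.sum_mul_sum]
    exact Finset.sum_congr rfl fun i _ => Finset.sum_congr rfl fun j _ => by ring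
  · rintro ⟨b, rfl⟩ ⟨c, rfl⟩
    refine ⟨fun i j => b i j + c i j, ?_⟩
    simp only [add_mul, Finset.sum_add_distrib]

/-- The heart of the geometric argument: a zero v of the linear or quadratic part of the equation a
of s' at p is a direction, and s vanishes, respectively is singular, at the corresponding point of
the exceptional divisor. -/
theorem IsTwistHom.on_center (hι : IsTwistHom Z ι) (hL : IsLineBundle L) (hL' : IsLineBundle L')
    (hB : IsBlowup σ (Scheme.IdealSheafData.vanishingIdeal Z)) {f : X ⟶ SpecC} [IsSeparated f]
    {f' : Y ⟶ SpecC} (hσ : σ ≫ f' = f) {n : ℕ} (hn : 2 ≤ n) (hf' : SmoothOfRelativeDimension n f')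
    (hZ : (Z : Set Y).Finite) (hcl : ∀ p ∈ Z, IsClosed {p})
    {s : Γ(L, ⊤)} {s' : Γ(L', ⊤)} (hs : pull σ L' ⊤ s' = ι.app ⊤ s) {p : Y} (hp : p ∈ Z) :
    VanishesAt s' p ∧ (∃ x, σ x = p ∧ VanishesAt s x) ∧
      (JetVanishesAt s' p → ∃ x, IsClosed {x} ∧ JetVanishesAt s x) := by
  obtain ⟨O, hpO, l₀, hl₀⟩ := hL'.exists_frame p
  obtain ⟨V, hV, hVO, hVZ, hpV, g, hgC, hg, hgp⟩ :=
    exists_centered_chart_of_mem hf' Z hZ hcl p hp O hpO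
  set l := res hVO l₀
  have hl : IsFrame l := hl₀.restrict hVO
  have hmax := isMaximal_pointIdeal hV p hpV (hcl p hp)
  have : Smooth f' := SmoothOfRelativeDimension.smooth n f'
  obtain ⟨val, hvalC, hval⟩ := exists_value (scalars f' V) (scalars_finiteType f' hV)
    (pointIdeal p hpV)
  obtain ⟨a, ha⟩ := hl.exists_eq_smul le_rfl (res le_top s')
  rw [res_self] at ha
  have hI : ∀ (U : X.Opens) (hUa : IsAffineOpen U) (hU : U ≤ σ ⁻¹ᵁ V),
      ((Scheme.IdealSheafData.vanishingIdeal Z).comap σ).ideal ⟨U, hUa⟩ =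
        Ideal.span (Set.range fun i => σ.appLE V U hU (g (MvPolynomial.X i))) := by
    intro U hUa hU
    rw [ideal_comap _ σ ⟨V, hV⟩ ⟨U, hUa⟩ hU,
      vanishingIdeal_ideal_eq_pointIdeal Z ⟨V, hV⟩ p hp hpV hVZ, hgp, Ideal.map_span,
      ← Set.range_comp]
    rfl
  -- What happens at the point in the direction v, for any expansion of a in degree one or two; the
  -- coefficients enter only through their values at p.
  have key : ∀ v : Fin n → ℂ, (∃ i, v i ≠ 0) → ∃ (x : X) (U : X.Opens) (hxU : x ∈ U)
      (hU : U ≤ σ ⁻¹ᵁ V) (m : Γ(L, U)) (c κ : Γ(X, U)),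
      IsClosed {x} ∧ σ x = p ∧ IsFrame m ∧ res le_top s = c • m ∧
      σ.appLE V U hU a = c * κ ∧ κ ∈ pointIdeal x hxU ∧
      (∀ b : Fin n → Γ(Y, V), a = ∑ i, b i * g (MvPolynomial.X i) →
        ∑ i, val (b i) * v i = 0 → c ∈ pointIdeal x hxU) ∧
      (∀ b : Fin n → Fin n → Γ(Y, V),
        a = ∑ i, ∑ j, b i j * (g (MvPolynomial.X i) * g (MvPolynomial.X j)) →
        ∑ i, ∑ j, val (b i j) * (v i * v j) = 0 →
          ∃ d, c = κ * d ∧ d ∈ pointIdeal x hxU) := by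
    intro v hv
    obtain ⟨x, hxcl, hxp, hx⟩ := hB.exists_point_over hσ hV hp hpV hVZ g hgC hg hgp val hvalC hval
      v hv
    have hxV : x ∈ σ ⁻¹ᵁ V := by change σ x ∈ V; rwa [hxp]
    obtain ⟨U, hUa, hU, hxU, -, m, κ, hm, hκ0, hκ, h⟩ :=
      exists_local_equation hL ι hι hl x ⊤ trivial hxV
    obtain ⟨c, hc, hac⟩ := h s s' hs a ha
    obtain ⟨R, _, H, q, hq, μ, j, hμ, hH, hHt, hHv⟩ := hx U hU hxU
    have hjq : ∀ c : ℂ, c ≠ 0 → j c ∉ q := fun c hc h =>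
      hq.ne_top (q.eq_top_of_isUnit_mem h ((IsUnit.mk0 c hc).map j))
    obtain ⟨η, z, hη, hz, hw⟩ := exists_tangent_factors (σ.appLE V U hU).hom H q
      (fun i => g (MvPolynomial.X i)) (fun i => j (v i)) (hv.imp fun i hi => hjq _ hi) μ hμ hHt κ
      (by rw [← hκ, hI])
    refine ⟨x, U, hxU, hU, m, c, κ, hxcl, hxp, hm, hc, hac, ?_, ?_, ?_⟩
    · have h1 : κ ∈ Ideal.span (Set.range fun i => σ.appLE V U hU (g (MvPolynomial.X i))) := by
        rw [← hI U hUa, hκ]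
        exact Ideal.mem_span_singleton_self κ
      refine Ideal.span_le.mpr ?_ h1
      rintro _ ⟨i, rfl⟩
      rw [SetLike.mem_coe, mem_pointIdeal, germ_appLE_mem_iff σ hU x hxU,
        IsLocalRing.mem_maximalIdeal, mem_nonunits_iff, isUnit_map_iff]
      rw [← mem_nonunits_iff, ← IsLocalRing.mem_maximalIdeal]
      have h2 : ∀ (y : Y) (hy : y ∈ V), y = p → Y.presheaf.germ V y hy (g (MvPolynomial.X i)) ∈
          IsLocalRing.maximalIdeal (Y.presheaf.stalk y) := by
        rintro y hy rfl
        exact mem_pointIdeal.mp (hgp ▸ Ideal.subset_span ⟨i, rfl⟩)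
      exact h2 _ _ hxp
    · intro b hb hb0
      rw [← hH]
      refine linear_transform_mem (α := (σ.appLE V U hU).hom) hκ0 hη hz hw b c (hb ▸ hac) ?_
      rw [← (Ideal.Quotient.eq_zero_iff_mem)]
      have h3 : ∀ b, Ideal.Quotient.mk q (H (σ.appLE V U hU b)) =
          Ideal.Quotient.mk q (j (val b)) := fun b => Ideal.Quotient.eq.mpr (hHv b)
      have h4 : Ideal.Quotient.mk q (j (∑ i, val (b i) * v i)) = 0 := by
        rw [hb0, map_zero, map_zero]
      rw [← h4]
      simp only [map_sum, map_mul, h3]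
    · intro b hb hb0
      obtain ⟨d, hd, hdq⟩ := quadratic_transform_mem (α := (σ.appLE V U hU).hom) (H := H) (q := q)
        hκ0 hη hz hw b c (hb ▸ hac) (by
          rw [← (Ideal.Quotient.eq_zero_iff_mem)]
          have h3 : ∀ b, Ideal.Quotient.mk q (H (σ.appLE V U hU b)) =
              Ideal.Quotient.mk q (j (val b)) := fun b => Ideal.Quotient.eq.mpr (hHv b)
          have h4 : Ideal.Quotient.mk q (j (∑ i, ∑ k, val (b i k) * (v i * v k))) = 0 := by
            rw [hb0, map_zero, map_zero]
          rw [← h4]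
          simp only [map_sum, map_mul, h3])
      exact ⟨d, hd, (hH d).mp hdq⟩
  -- Any direction will do: a = cκ, and κ vanishes at the point above p.
  have hap : a ∈ pointIdeal p hpV := by
    obtain ⟨x, U, hxU, hU, m, c, κ, -, hxp, -, -, hac, hκ, -, -⟩ :=
      key (fun _ => 1) ⟨⟨0, by omega⟩, one_ne_zero⟩
    have h1 : σ.appLE V U hU a ∈ pointIdeal x hxU := hac ▸ Ideal.mul_mem_left _ _ hκ
    rw [mem_pointIdeal, germ_appLE_mem_iff σ hU x hxU,
      IsLocalRing.mem_maximalIdeal, mem_nonunits_iff, isUnit_map_iff, ← mem_nonunits_iff,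
      ← IsLocalRing.mem_maximalIdeal] at h1
    subst hxp
    exact h1
  refine ⟨(hl.vanishesAt_iff hpV ha).mpr hap, ?_, fun hj => ?_⟩
  · obtain ⟨b, hb⟩ := exists_linear_combination (hgp ▸ hap)
    obtain ⟨v, hv, hbv⟩ := exists_ne_zero_linear hn (fun i => val (b i))
    obtain ⟨x, U, hxU, hU, m, c, κ, -, hxp, hm, hc, -, -, h1, -⟩ := key v hv
    exact ⟨x, hxp, (hm.vanishesAt_iff hxU hc).mpr (h1 b hb hbv)⟩
  · rw [hl.jetVanishesAt_iff hpV ha, germ_mem_sq_iff hV p hpV (hcl p hp), hgp] at hj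
    obtain ⟨b, hb⟩ := exists_quadratic_combination hj
    obtain ⟨v, hv, hbv⟩ := exists_ne_zero_quadratic hn (fun i k => val (b i k))
    obtain ⟨x, U, hxU, hU, m, c, κ, hxcl, hxp, hm, hc, -, hκ, -, h1⟩ := key v hv
    -- The equation of s is a product of two functions vanishing at x.
    obtain ⟨d, rfl, hd⟩ := h1 b hb hbv
    refine ⟨x, hxcl, (hm.jetVanishesAt_iff hxU hc).mpr ?_⟩
    rw [map_mul, sq]
    exact Ideal.mul_mem_mul hκ hd

end

theorem IsBlowup.exists_preimage {X Y : Scheme.{0}} {σ : X ⟶ Y}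
    {Z : TopologicalSpace.Closeds Y}
    (hB : IsBlowup σ (Scheme.IdealSheafData.vanishingIdeal Z)) {y : Y} (hy : y ∉ Z) :
    ∃ x, σ x = y ∧ (IsClosed {y} → IsClosed {x}) := by
  let V : Y.Opens := ⟨(Z : Set Y)ᶜ, Z.2.isOpen_compl⟩
  have hiso := hB.isIso_morphismRestrict V fun x hx h => h hx
  have hbij : Function.Bijective (σ ∣_ V) := (Scheme.homeoOfIso (asIso (σ ∣_ V))).bijective
  obtain ⟨⟨x, hxV⟩, hx⟩ := hbij.2 ⟨y, hy⟩
  have hσ : ∀ z : (σ ⁻¹ᵁ V : X.Opens), ((σ ∣_ V) z).1 = σ z.1 := fun z => by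
    have h := congr($(morphismRestrict_ι σ V) z)
    exact h
  have hxy : σ x = y := by
    rw [← hσ ⟨x, hxV⟩, hx]
  refine ⟨x, hxy, fun hcl => ?_⟩
  have h1 : ({x} : Set X) = σ ⁻¹' {y} := by
    ext z
    simp only [Set.mem_singleton_iff, Set.mem_preimage]
    refine ⟨by rintro rfl; exact hxy, fun hz => ?_⟩
    have hzV : z ∈ σ ⁻¹ᵁ V := by change σ z ∈ V; rw [hz]; exact hy
    have h2 : (σ ∣_ V) ⟨z, hzV⟩ = (σ ∣_ V) ⟨x, hxV⟩ := Subtype.ext (by rw [hσ, hσ, hxy]; exact hz)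
    exact congrArg Subtype.val (hbij.1 h2)
  rw [h1]
  exact hcl.preimage σ.continuous

section

variable {X Y : Scheme.{0}} {σ : X ⟶ Y} {Z : TopologicalSpace.Closeds Y} {L : X.Modules}
  {L' : Y.Modules} {ι : L ⟶ (Scheme.Modules.pullback σ).obj L'}

theorem IsTwistHom.isSingular (hι : IsTwistHom Z ι) (hL : IsLineBundle L) (hL' : IsLineBundle L')
    (hB : IsBlowup σ (Scheme.IdealSheafData.vanishingIdeal Z)) {f : X ⟶ SpecC} [IsSeparated f]
    {f' : Y ⟶ SpecC} (hσ : σ ≫ f' = f) {n : ℕ} (hn : 2 ≤ n) (hf' : SmoothOfRelativeDimension n f')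
    (hZ : (Z : Set Y).Finite) (hcl : ∀ p ∈ Z, IsClosed {p})
    {s : H0 f L} {s' : H0 f' L'} (hs : pull σ L' ⊤ s'.toSection = ι.app ⊤ s.toSection)
    (h : IsSingular s') : IsSingular s := by
  obtain ⟨y, hy, hj⟩ := h
  by_cases hyZ : y ∈ Z
  · exact (hι.on_center hL hL' hB hσ hn hf' hZ hcl hs hyZ).2.2 hj
  · obtain ⟨x, rfl, hx⟩ := hB.exists_preimage hyZ
    exact ⟨x, hx hy, (hι.off_center hL hL' hs hyZ).2 hj⟩

theorem IsTwistHom.zeroLocus_eq (hι : IsTwistHom Z ι) (hL : IsLineBundle L) (hL' : IsLineBundle L')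
    (hB : IsBlowup σ (Scheme.IdealSheafData.vanishingIdeal Z)) {f : X ⟶ SpecC} [IsSeparated f]
    {f' : Y ⟶ SpecC} (hσ : σ ≫ f' = f) {n : ℕ} (hn : 2 ≤ n) (hf' : SmoothOfRelativeDimension n f')
    (hZ : (Z : Set Y).Finite) (hcl : ∀ p ∈ Z, IsClosed {p})
    {s : H0 f L} {s' : H0 f' L'} (hs : pull σ L' ⊤ s'.toSection = ι.app ⊤ s.toSection) :
    zeroLocus s' = σ '' zeroLocus s := by
  ext y
  constructor
  · intro hy
    by_cases hyZ : y ∈ Z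
    · obtain ⟨x, hx, hxs⟩ := (hι.on_center hL hL' hB hσ hn hf' hZ hcl hs hyZ).2.1
      exact ⟨x, hxs, hx⟩
    · obtain ⟨x, rfl, -⟩ := hB.exists_preimage hyZ
      exact ⟨x, (hι.off_center hL hL' hs hyZ).1.mpr hy, rfl⟩
  · rintro ⟨x, hx, rfl⟩
    by_cases hyZ : σ x ∈ Z
    · exact (hι.on_center hL hL' hB hσ hn hf' hZ hcl hs hyZ).1
    · exact (hι.off_center hL hL' hs hyZ).1.mp hx

end

-- Properness, and the map on sections.

attribute [local instance] MvPolynomial.gradedAlgebra in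
theorem projectiveSpaceToSpecC_isProper (N : ℕ) : IsProper (projectiveSpaceToSpecC N) := by
  have : IsScalarTower ℂ (MvPolynomial.homogeneousSubmodule (Fin (N + 1)) ℂ 0)
      (MvPolynomial (Fin (N + 1)) ℂ) :=
    ⟨fun c x m => by
      change (c • (x : MvPolynomial (Fin (N + 1)) ℂ)) * m = c • (x * m)
      exact smul_mul_assoc _ _ _⟩
  have hft : Algebra.FiniteType (MvPolynomial.homogeneousSubmodule (Fin (N + 1)) ℂ 0)
      (MvPolynomial (Fin (N + 1)) ℂ) :=
    Algebra.FiniteType.of_restrictScalars_finiteType ℂ _ _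
  have hbij : Function.Bijective
      (algebraMap ℂ (MvPolynomial.homogeneousSubmodule (Fin (N + 1)) ℂ 0)) := by
    refine ⟨fun a b hab => MvPolynomial.C_injective (Fin (N + 1)) ℂ (congrArg Subtype.val hab),
      fun x => ?_⟩
    obtain ⟨x, hx⟩ := x
    have h1 := MvPolynomial.totalDegree_eq_zero_iff_eq_C.mp
      (Nat.le_zero.mp (MvPolynomial.IsHomogeneous.totalDegree_le hx))
    exact ⟨_, Subtype.ext h1.symm⟩
  have : IsIso (CommRingCat.ofHom
      (algebraMap ℂ (MvPolynomial.homogeneousSubmodule (Fin (N + 1)) ℂ 0))) :=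
    (ConcreteCategory.isIso_iff_bijective _).mpr hbij
  have h1 : IsProper (Proj.toSpecZero (MvPolynomial.homogeneousSubmodule (Fin (N + 1)) ℂ)) :=
    inferInstance
  have h2 : IsProper (Spec.map (CommRingCat.ofHom
      (algebraMap ℂ (MvPolynomial.homogeneousSubmodule (Fin (N + 1)) ℂ 0)))) := inferInstance
  exact MorphismProperty.comp_mem @IsProper _ _ h1 h2

theorem IsSmoothProjectiveVariety.isProper {X : Scheme.{0}} {f : X ⟶ SpecC} {n : ℕ}
    (h : IsSmoothProjectiveVariety f n) : IsProper f := by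
  obtain ⟨N, i, hi, rfl⟩ := h.projective
  have := projectiveSpaceToSpecC_isProper N
  infer_instance

theorem IsReduction.exists_linearMap {X X' : Scheme.{0}} {n : ℕ} (hn : 2 ≤ n) {f : X ⟶ SpecC}
    (hX : IsSmoothProjectiveVariety f n) {L : X.Modules} (hL : IsLineBundle L) {f' : X' ⟶ SpecC}
    {L' : X'.Modules} {σ : X ⟶ X'} (hred : IsReduction f L f' L' n σ) :
    ∃ φ : H0 f L →ₗ[ℂ] H0 f' L', Function.Injective φ ∧
      (∀ s, IsSingular (φ s) → IsSingular s) ∧ ∀ s, zeroLocus (φ s) = σ '' zeroLocus s := by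
  obtain ⟨Z, hZ, hcl, hB, ⟨ι, hι⟩, -⟩ := hred.exists_center
  have hι : IsTwistHom Z ι := hι
  have hX' := hred.isSmoothProjectiveVariety
  have := hX.isIntegral
  have := hX'.isIntegral
  have := hX.isProper
  have hσ : IsAppLocallyBijective σ := fun y O hy =>
    hB.exists_app_bijective hn hX'.smooth hZ hcl y O hy
  obtain ⟨φ, hφ, hs⟩ := exists_pushforward_sections hred.comp_eq hσ hred.isLineBundle ι
    (app_injective_of_affine ι (fun U => (hι U).1) ⊤)
  exact ⟨φ, hφ, fun s => hι.isSingular hL hred.isLineBundle hB hred.comp_eq hn hX'.smooth hZ hcl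
    (hs s), fun s => hι.zeroLocus_eq hL hred.isLineBundle hB hred.comp_eq hn hX'.smooth hZ hcl
    (hs s)⟩

/-! ### The Zariski topology on projective space -/

section ProjectiveTopology

variable {V : Type} [AddCommGroup V] [Module ℂ V]

attribute [local instance] zariskiTopology

theorem eval_smul_of_isHomogeneous {τ : Type} {d : ℕ} {p : MvPolynomial τ ℂ}
    (hp : p.IsHomogeneous d) (t : ℂ) (x : τ → ℂ) :
    MvPolynomial.eval (t • x) p = t ^ d * MvPolynomial.eval x p := by
  rw [MvPolynomial.eval_eq, MvPolynomial.eval_eq, Finset.mul_sum]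
  refine Finset.sum_congr rfl fun m hm => ?_
  have h := hp (MvPolynomial.mem_support_iff.mp hm)
  have h : ∑ i ∈ m.support, m i = d := by
    rw [← h, ← Finsupp.degree_apply, Finsupp.degree_eq_weight_one]
    rfl
  simp only [Pi.smul_apply, smul_eq_mul, mul_pow, Finset.prod_mul_distrib,
    Finset.prod_pow_eq_pow_sum]
  rw [h]
  ring

theorem eval_rep_mk {d : ℕ} {p : MvPolynomial (Module.Dual ℂ V) ℂ} (hp : p.IsHomogeneous d)
    (v : V) (hv : v ≠ 0) :
    MvPolynomial.eval (fun l : Module.Dual ℂ V => l (Projectivization.mk ℂ v hv).rep) p = 0 ↔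
      MvPolynomial.eval (fun l : Module.Dual ℂ V => l v) p = 0 := by
  obtain ⟨a, ha⟩ := Projectivization.exists_smul_eq_mk_rep ℂ v hv
  have h : (fun l : Module.Dual ℂ V => l (Projectivization.mk ℂ v hv).rep) =
      (a : ℂ) • fun l : Module.Dual ℂ V => l v := by
    ext l
    rw [← ha, Units.smul_def, map_smul]
    rfl
  rw [h, eval_smul_of_isHomogeneous hp]
  simp

theorem isClosed_setOf_eval {d : ℕ} {p : MvPolynomial (Module.Dual ℂ V) ℂ}
    (hp : p.IsHomogeneous d) :
    IsClosed {q : Projectivization ℂ V |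
      MvPolynomial.eval (fun l : Module.Dual ℂ V => l q.rep) p = 0} := by
  rw [← isOpen_compl_iff]
  exact TopologicalSpace.isOpen_generateFrom_of_mem ⟨d, p, hp, rfl⟩

/-- The generating open sets form a basis, since products of homogeneous polynomials are
homogeneous. -/
theorem exists_homogeneous_of_isOpen {O : Set (Projectivization ℂ V)} (hO : IsOpen O)
    {q : Projectivization ℂ V} (hq : q ∈ O) :
    ∃ (d : ℕ) (p : MvPolynomial (Module.Dual ℂ V) ℂ), p.IsHomogeneous d ∧
      MvPolynomial.eval (fun l : Module.Dual ℂ V => l q.rep) p ≠ 0 ∧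
      ∀ q' ∉ O, MvPolynomial.eval (fun l : Module.Dual ℂ V => l q'.rep) p = 0 := by
  induction hO with
  | basic s hs =>
    obtain ⟨d, p, hp, rfl⟩ := hs
    exact ⟨d, p, hp, hq, fun q' hq' => not_not.mp hq'⟩
  | univ => exact ⟨0, 1, MvPolynomial.isHomogeneous_one _ _, by simp, fun q' hq' => (hq' trivial).elim⟩
  | inter s t _ _ hs ht =>
    obtain ⟨d, p, hp, h1, h2⟩ := hs hq.1
    obtain ⟨d', p', hp', h1', h2'⟩ := ht hq.2
    refine ⟨d + d', p * p', hp.mul hp', by simpa using ⟨h1, h1'⟩, fun q' hq' => ?_⟩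
    rw [map_mul]
    by_cases h : q' ∈ s
    · rw [h2' q' fun h' => hq' ⟨h, h'⟩, mul_zero]
    · rw [h2 q' h, zero_mul]
  | sUnion S _ hS =>
    obtain ⟨s, hs, hqs⟩ := hq
    obtain ⟨d, p, hp, h1, h2⟩ := hS s hs hqs
    exact ⟨d, p, hp, h1, fun q' hq' => h2 q' fun h => hq' ⟨s, hs, h⟩⟩

variable {r : ℕ} (b : Module.Basis (Fin r) ℂ V)

/-- The affine cone over a set of points of projective space, without the origin. -/
def cone (A : Set (Projectivization ℂ V)) : Set (Fin r → ℂ) :=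
  {x | ∃ (v : V) (hv : v ≠ 0), Projectivization.mk ℂ v hv ∈ A ∧ b.equivFun v = x}

/-- The ideal of the polynomials vanishing on the affine cone over a set. -/
noncomputable def coneIdeal (A : Set (Projectivization ℂ V)) : Ideal (MvPolynomial (Fin r) ℂ) :=
  MvPolynomial.vanishingIdeal ℂ (cone b A)

theorem mem_coneIdeal {A : Set (Projectivization ℂ V)} {f : MvPolynomial (Fin r) ℂ} :
    f ∈ coneIdeal b A ↔ ∀ (v : V) (hv : v ≠ 0), Projectivization.mk ℂ v hv ∈ A →
      MvPolynomial.eval (b.equivFun v) f = 0 := by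
  rw [coneIdeal, MvPolynomial.mem_vanishingIdeal_iff]
  constructor
  · intro h v hv hvA
    have := h _ ⟨v, hv, hvA, rfl⟩
    rwa [MvPolynomial.aeval_eq_eval] at this
  · rintro h _ ⟨v, hv, hvA, rfl⟩
    rw [MvPolynomial.aeval_eq_eval]
    exact h v hv hvA

theorem coneIdeal_anti {A B : Set (Projectivization ℂ V)} (h : A ⊆ B) :
    coneIdeal b B ≤ coneIdeal b A := fun f hf => by
  rw [mem_coneIdeal] at hf ⊢
  exact fun v hv hvA => hf v hv (h hvA)

/-- A polynomial in linear forms, in coordinates. -/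
noncomputable def toCoordinates : MvPolynomial (Module.Dual ℂ V) ℂ →ₐ[ℂ] MvPolynomial (Fin r) ℂ :=
  MvPolynomial.aeval fun l => ∑ i, MvPolynomial.C (l (b i)) * MvPolynomial.X i

theorem eval_toCoordinates (v : V) (p : MvPolynomial (Module.Dual ℂ V) ℂ) :
    MvPolynomial.eval (b.equivFun v) (toCoordinates b p) =
      MvPolynomial.eval (fun l : Module.Dual ℂ V => l v) p := by
  have h : (MvPolynomial.aeval (R := ℂ) (b.equivFun v)).comp (toCoordinates b) =
      MvPolynomial.aeval (fun l : Module.Dual ℂ V => l v) := by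
    ext l
    have h1 : l v = ∑ i, l (b i) * b.repr v i := by
      conv_lhs => rw [← b.sum_repr v, map_sum]
      exact Finset.sum_congr rfl fun i _ => by rw [map_smul, smul_eq_mul, mul_comm]
    simp [toCoordinates, h1]
  have h2 := congr($h p)
  simpa [MvPolynomial.aeval_eq_eval] using h2

theorem mem_closure_of_coneIdeal {A : Set (Projectivization ℂ V)} {v : V} (hv : v ≠ 0)
    (h : ∀ f ∈ coneIdeal b A, MvPolynomial.eval (b.equivFun v) f = 0) :
    Projectivization.mk ℂ v hv ∈ closure A := by
  by_contra hc
  obtain ⟨d, p, hp, h1, h2⟩ := exists_homogeneous_of_isOpen isClosed_closure.isOpen_compl hc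
  refine h1 ((eval_rep_mk hp v hv).mpr ?_)
  rw [← eval_toCoordinates b]
  refine h _ ((mem_coneIdeal b).mpr fun w hw hwA => ?_)
  rw [eval_toCoordinates b, ← eval_rep_mk hp w hw]
  exact h2 _ fun hn => hn (subset_closure hwA)

theorem coneIdeal_closure_subset {A B : Set (Projectivization ℂ V)}
    (h : coneIdeal b B ≤ coneIdeal b A) : A ⊆ closure B := by
  intro q hq
  rw [← q.mk_rep] at hq ⊢
  exact mem_closure_of_coneIdeal b q.rep_nonzero fun f hf =>
    (mem_coneIdeal b).mp (h hf) _ q.rep_nonzero hq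

/-- The restriction of a polynomial to a line through the origin. -/
noncomputable def restrictLine (x : Fin r → ℂ) (f : MvPolynomial (Fin r) ℂ) : Polynomial ℂ :=
  ∑ k ∈ Finset.range (f.totalDegree + 1),
    Polynomial.monomial k (MvPolynomial.eval x (MvPolynomial.homogeneousComponent k f))

theorem eval_restrictLine (x : Fin r → ℂ) (f : MvPolynomial (Fin r) ℂ) (t : ℂ) :
    (restrictLine x f).eval t = MvPolynomial.eval (t • x) f := by
  conv_rhs => rw [← MvPolynomial.sum_homogeneousComponent f]
  rw [map_sum, restrictLine, Polynomial.eval_finsetSum]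
  refine Finset.sum_congr rfl fun k _ => ?_
  rw [eval_smul_of_isHomogeneous (MvPolynomial.homogeneousComponent_isHomogeneous k f),
    Polynomial.eval_monomial, mul_comm]

theorem eq_zero_of_forall_eval {P : Polynomial ℂ} (h : ∀ t, t ≠ 0 → P.eval t = 0) : P = 0 :=
  Polynomial.eq_zero_of_infinite_isRoot P
    ((Set.finite_singleton (0 : ℂ)).infinite_compl.mono fun t ht => h t ht)

theorem restrictLine_eq_zero_iff (x : Fin r → ℂ) (f : MvPolynomial (Fin r) ℂ) :
    restrictLine x f = 0 ↔
      ∀ k, MvPolynomial.eval x (MvPolynomial.homogeneousComponent k f) = 0 := by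
  constructor
  · intro h k
    by_cases hk : k < f.totalDegree + 1
    · have h1 := congrArg (fun P => Polynomial.coeff P k) h
      simpa [restrictLine, Polynomial.finsetSum_coeff, Polynomial.coeff_monomial, hk] using h1
    · rw [MvPolynomial.homogeneousComponent_eq_zero k f (by omega), map_zero]
  · intro h
    simp [restrictLine, h]

theorem restrictLine_mul_eq_zero {x : Fin r → ℂ} {f g : MvPolynomial (Fin r) ℂ}
    (h : ∀ t : ℂ, t ≠ 0 → MvPolynomial.eval (t • x) (f * g) = 0) :
    restrictLine x f = 0 ∨ restrictLine x g = 0 := by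
  refine mul_eq_zero.mp (eq_zero_of_forall_eval fun t ht => ?_)
  rw [Polynomial.eval_mul, eval_restrictLine, eval_restrictLine, ← map_mul, h t ht]

theorem isClosed_setOf_eval_basis {d : ℕ} {f : MvPolynomial (Fin r) ℂ} (hf : f.IsHomogeneous d) :
    IsClosed {q : Projectivization ℂ V | MvPolynomial.eval (b.equivFun q.rep) f = 0} := by
  convert! isClosed_setOf_eval (V := V) (hf.rename_isHomogeneous (f := fun i => b.coord i)) using 3
  rw [MvPolynomial.eval_rename]
  rfl

theorem isClosed_setOf_restrictLine (f : MvPolynomial (Fin r) ℂ) :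
    IsClosed {q : Projectivization ℂ V | restrictLine (b.equivFun q.rep) f = 0} := by
  simp only [restrictLine_eq_zero_iff, Set.ofPred_forall]
  exact isClosed_iInter fun k => isClosed_setOf_eval_basis b
    (MvPolynomial.homogeneousComponent_isHomogeneous k f)

theorem mem_coneIdeal_of_restrictLine {A : Set (Projectivization ℂ V)}
    {f : MvPolynomial (Fin r) ℂ} (h : ∀ q ∈ A, restrictLine (b.equivFun q.rep) f = 0) :
    f ∈ coneIdeal b A := by
  rw [mem_coneIdeal]
  intro v hv hvA
  obtain ⟨a, ha⟩ := Projectivization.exists_smul_eq_mk_rep ℂ v hv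
  have h1 := congrArg (Polynomial.eval (a⁻¹ : ℂˣ).val) (h _ hvA)
  rw [eval_restrictLine, ← map_smul, ← ha, ← Units.smul_def, inv_smul_smul] at h1
  simpa using h1

/-- If fg vanishes on the cone, then on each line of the cone f or g vanishes identically, as
polynomials in one variable form a domain. The lines of either kind form a closed set, so
irreducibility selects one factor. Working with whole lines avoids a reduction to homogeneous f and
g. -/
theorem isPrime_coneIdeal {A : Set (Projectivization ℂ V)} (hA : IsIrreducible A) :
    (coneIdeal b A).IsPrime := by
  refine ⟨fun h => ?_, fun {f g} hfg => ?_⟩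
  · obtain ⟨q, hq⟩ := hA.nonempty
    rw [← q.mk_rep] at hq
    have h1 := (mem_coneIdeal b).mp (h ▸ Submodule.mem_top : (1 : MvPolynomial (Fin r) ℂ) ∈ _) _
      q.rep_nonzero hq
    simp at h1
  · have h1 := isPreirreducible_iff_isClosed_union_isClosed.mp hA.2 _ _
      (isClosed_setOf_restrictLine b f) (isClosed_setOf_restrictLine b g) (fun q hq => by
        refine restrictLine_mul_eq_zero fun t ht => ?_
        rw [← map_smul]
        refine (mem_coneIdeal b).mp hfg (t • q.rep) (smul_ne_zero ht q.rep_nonzero) ?_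
        have h2 : Projectivization.mk ℂ (t • q.rep) (smul_ne_zero ht q.rep_nonzero) =
            Projectivization.mk ℂ q.rep q.rep_nonzero :=
          (Projectivization.mk_eq_mk_iff' ℂ _ _ _ _).mpr ⟨t, rfl⟩
        rwa [h2, q.mk_rep])
    exact h1.imp (mem_coneIdeal_of_restrictLine b) (mem_coneIdeal_of_restrictLine b)

theorem coneIdeal_strictAnti {A B : Set (Projectivization ℂ V)} (hA : IsClosed A) (h : A ⊂ B) :
    coneIdeal b B < coneIdeal b A := by
  refine lt_of_le_of_ne (coneIdeal_anti b h.subset) fun he => h.not_subset ?_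
  have := coneIdeal_closure_subset b he.ge
  rwa [hA.closure_eq] at this

/-- Closed sets embed, strictly order-reversing, in the ideals of a Noetherian ring. -/
theorem noetherianSpace_projectivization [FiniteDimensional ℂ V] :
    TopologicalSpace.NoetherianSpace (Projectivization ℂ V) := by
  refine ((TopologicalSpace.noetherianSpace_TFAE (Projectivization ℂ V)).out 0 1).mpr ?_
  let b := Module.finBasis ℂ V
  let F : TopologicalSpace.Closeds (Projectivization ℂ V) →
    (Ideal (MvPolynomial (Fin (Module.finrank ℂ V)) ℂ))ᵒᵈ :=
    fun A => OrderDual.toDual (coneIdeal b A)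
  have hF : StrictMono F := fun A B h => coneIdeal_strictAnti b A.2 h
  exact hF.wellFoundedLT

end ProjectiveTopology

/-! ### Dimensions of subsets of projective space -/

section ProjectiveDimension

open TopologicalSpace

variable {V : Type} [AddCommGroup V] [Module ℂ V]

attribute [local instance] zariskiTopology

/-- The ideal of the origin. -/
noncomputable abbrev originIdeal (r : ℕ) : Ideal (MvPolynomial (Fin r) ℂ) :=
  MvPolynomial.vanishingIdeal ℂ {(0 : Fin r → ℂ)}

theorem mem_originIdeal {r : ℕ} {f : MvPolynomial (Fin r) ℂ} :
    f ∈ originIdeal r ↔ MvPolynomial.eval 0 f = 0 := by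
  rw [MvPolynomial.mem_vanishingIdeal_singleton_iff, MvPolynomial.aeval_eq_eval]

/-- A polynomial vanishing on a punctured line vanishes at the origin too; the inclusion is strict
because some coordinate is non-zero on the line. The origin thus adds one step to every chain of
cones. -/
theorem coneIdeal_lt_originIdeal {r : ℕ} (b : Module.Basis (Fin r) ℂ V)
    {A : Set (Projectivization ℂ V)} (hA : A.Nonempty) : coneIdeal b A < originIdeal r := by
  obtain ⟨q, hq⟩ := hA
  refine lt_of_le_of_ne (fun f hf => ?_) fun he => ?_
  · have h1 : restrictLine (b.equivFun q.rep) f = 0 := eq_zero_of_forall_eval fun t ht => by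
      rw [eval_restrictLine, ← map_smul]
      refine (mem_coneIdeal b).mp hf _ (smul_ne_zero ht q.rep_nonzero) ?_
      have h2 : Projectivization.mk ℂ (t • q.rep) (smul_ne_zero ht q.rep_nonzero) =
          Projectivization.mk ℂ q.rep q.rep_nonzero :=
        (Projectivization.mk_eq_mk_iff' ℂ _ _ _ _).mpr ⟨t, rfl⟩
      rwa [h2, q.mk_rep]
    have h2 := eval_restrictLine (b.equivFun q.rep) f 0
    rw [h1, zero_smul, Polynomial.eval_zero] at h2
    exact mem_originIdeal.mpr h2.symm
  · refine q.rep_nonzero (b.equivFun.map_eq_zero_iff.mp (funext fun i => ?_))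
    have h1 : (MvPolynomial.X i : MvPolynomial (Fin r) ℂ) ∈ coneIdeal b A := by
      rw [he, mem_originIdeal]; simp
    rw [← q.mk_rep] at hq
    simpa using (mem_coneIdeal b).mp h1 _ q.rep_nonzero hq

theorem eval_toCoordinates_X {r : ℕ} (b : Module.Basis (Fin r) ℂ V) (l : Module.Dual ℂ V) (v : V) :
    MvPolynomial.eval (b.equivFun v) (toCoordinates b (MvPolynomial.X l)) = l v := by
  rw [eval_toCoordinates, MvPolynomial.eval_X]

/-- By the Nullstellensatz: a non-zero point of the zero set of P would give a point of Y at which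
all the forms vanish. -/
theorem originIdeal_le_of_isPrime {r : ℕ} (b : Module.Basis (Fin r) ℂ V)
    {Y : Set (Projectivization ℂ V)} (hY : IsClosed Y) {d : ℕ} (l : Fin d → Module.Dual ℂ V)
    (hl : ∀ q ∈ Y, ∃ i, l i q.rep ≠ 0) (P : Ideal (MvPolynomial (Fin r) ℂ)) (hP : P.IsPrime)
    (hYP : coneIdeal b Y ≤ P) (hlP : ∀ i, toCoordinates b (MvPolynomial.X (l i)) ∈ P) :
    originIdeal r ≤ P := by
  have h1 : MvPolynomial.vanishingIdeal ℂ (MvPolynomial.zeroLocus ℂ P) = P := by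
    rw [MvPolynomial.vanishingIdeal_zeroLocus_eq_radical, hP.radical]
  rw [← h1]
  refine MvPolynomial.vanishingIdeal_anti_mono fun x hx => ?_
  by_contra hx0
  set v := b.equivFun.symm x with hv
  have hxv : b.equivFun v = x := b.equivFun.apply_symm_apply x
  have hv0 : v ≠ 0 := fun h => hx0 (by rw [← hxv, h, map_zero]; rfl)
  have hmem : Projectivization.mk ℂ v hv0 ∈ Y := by
    rw [← hY.closure_eq]
    refine mem_closure_of_coneIdeal b hv0 fun f hf => ?_
    have := hx f (hYP hf)
    rwa [MvPolynomial.aeval_eq_eval, ← hxv] at this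
  obtain ⟨i, hi⟩ := hl _ hmem
  have h2 := eval_rep_mk (MvPolynomial.isHomogeneous_X ℂ (l i)) v hv0
  rw [MvPolynomial.eval_X, MvPolynomial.eval_X] at h2
  refine hi (h2.mpr ?_)
  have := hx _ (hlP i)
  rwa [MvPolynomial.aeval_eq_eval, ← hxv, eval_toCoordinates_X] at this

/-- A closed set on which `d` linear forms have no common zero has dimension less than `d`. -/
theorem length_lt_of_forms [FiniteDimensional ℂ V] {Y : Set (Projectivization ℂ V)}
    (hY : IsClosed Y) {d : ℕ} (l : Fin d → Module.Dual ℂ V) (hl : ∀ q ∈ Y, ∃ i, l i q.rep ≠ 0)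
    (p : LTSeries (IrreducibleCloseds Y)) : p.length < d := by
  let b := Module.finBasis ℂ V
  let J := coneIdeal b Y
  have hirr : ∀ A : IrreducibleCloseds Y, IsIrreducible (Subtype.val '' (A : Set Y)) := fun A =>
    A.isIrreducible.image _ continuous_subtype_val.continuousOn
  have hle : ∀ A : IrreducibleCloseds Y, J ≤ coneIdeal b (Subtype.val '' (A : Set Y)) := fun A =>
    coneIdeal_anti b (Subtype.coe_image_subset Y _)
  let F : IrreducibleCloseds Y → (PrimeSpectrum.zeroLocus (J : Set (MvPolynomial (Fin (Module.finrank ℂ V)) ℂ)))ᵒᵈ :=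
    fun A => OrderDual.toDual ⟨⟨_, isPrime_coneIdeal b (hirr A)⟩, hle A⟩
  have hF : StrictMono F := fun A B h =>
    coneIdeal_strictAnti b (hY.isClosedEmbedding_subtypeVal.isClosedMap _ A.isClosed)
      (Subtype.val_injective.image_strictMono h)
  have hlt : ∀ A : IrreducibleCloseds Y,
      coneIdeal b (Subtype.val '' (A : Set Y)) < originIdeal _ := fun A =>
    coneIdeal_lt_originIdeal b (hirr A).nonempty
  let M : PrimeSpectrum.zeroLocus (J : Set (MvPolynomial (Fin (Module.finrank ℂ V)) ℂ)) :=
    ⟨⟨originIdeal _, inferInstance⟩, (hle p.head).trans (hlt p.head).le⟩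
  -- The chain of cone ideals, extended by the ideal of the origin; the extra member turns the bound
  -- d into a strict inequality for `p.length`.
  let q := (p.map F hF).cons (OrderDual.toDual M) (hlt p.head)
  have h1 : (q.length : ℕ∞) ≤ Order.height M := Order.length_le_coheight_head (p := q)
  let e := J.primeSpectrumQuotientOrderIsoZeroLocus
  rw [← Order.height_orderIso e.symm M, ← PrimeSpectrum.height_eq_orderHeight] at h1
  set s : Set (MvPolynomial _ ℂ ⧸ J) :=
    Set.range fun i => Ideal.Quotient.mk J (toCoordinates b (MvPolynomial.X (l i))) with hs
  have hM : (e.symm M).asIdeal.comap (Ideal.Quotient.mk J) = originIdeal _ := by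
    have := congrArg (fun P => P.1.asIdeal) (e.apply_symm_apply M)
    exact this
  -- On the cone over Y the d forms cut out only the origin, so Krull's height theorem bounds the
  -- height of its ideal by d.
  have hmin : (e.symm M).asIdeal ∈ (Ideal.span s).minimalPrimes := by
    refine ⟨⟨inferInstance, ?_⟩, ?_⟩
    · rw [Ideal.span_le]
      rintro _ ⟨i, rfl⟩
      change toCoordinates b (MvPolynomial.X (l i)) ∈ (e.symm M).asIdeal.comap _
      rw [hM, mem_originIdeal, ← map_zero b.equivFun, eval_toCoordinates_X, map_zero]
    · rintro P ⟨hP, hsP⟩ -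
      have h2 := originIdeal_le_of_isPrime b hY l hl (P.comap (Ideal.Quotient.mk J)) inferInstance
        (fun f hf => by
          rw [Ideal.mem_comap, Ideal.Quotient.eq_zero_iff_mem.mpr hf]
          exact zero_mem _) (fun i => hsP (Ideal.subset_span ⟨i, rfl⟩))
      rw [← hM] at h2
      exact (Ideal.comap_le_comap_iff_of_surjective _ Ideal.Quotient.mk_surjective _ _).mp h2
  have h3 := Ideal.height_le_card_of_mem_minimalPrimes_span (Set.finite_range _) hmin
  have h4 : s.ncard ≤ d := by
    rw [hs, ← Set.image_univ]
    refine (Set.ncard_image_le Set.finite_univ).trans ?_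
    simp
  have h5 : (q.length : ℕ∞) ≤ d := h1.trans (h3.trans (by exact_mod_cast h4))
  have h6 : q.length = p.length + 1 :=
    (RelSeries.cons_length (p.map F hF) _ _).trans rfl
  have h7 : q.length ≤ d := by exact_mod_cast h5
  omega

theorem exists_form_ne_zero [FiniteDimensional ℂ V] {S : Set (Projectivization ℂ V)}
    (hS : S.Finite) : ∃ l : Module.Dual ℂ V, ∀ q ∈ S, l q.rep ≠ 0 := by
  have := hS.to_subtype
  obtain ⟨f, hf⟩ := Module.exists_dual_forall_apply_ne_zero (K := ℂ)
    (fun q : S => q.1.rep) (fun q => q.1.rep_nonzero)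
  exact ⟨f, fun q hq => hf ⟨q, hq⟩⟩

theorem isClosed_setOf_form (l : Module.Dual ℂ V) :
    IsClosed {q : Projectivization ℂ V | l q.rep = 0} := by
  simpa using isClosed_setOf_eval (MvPolynomial.isHomogeneous_X ℂ l)

/-- On a set of dimension less than `d` there are `d` linear forms without common zero. -/
theorem exists_forms [FiniteDimensional ℂ V] (d : ℕ) (D : Set (Projectivization ℂ V))
    (h : ∀ p : LTSeries (IrreducibleCloseds D), p.length < d) :
    ∃ l : Fin d → Module.Dual ℂ V, ∀ q ∈ D, ∃ i, l i q.rep ≠ 0 := by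
  have hnoeth : NoetherianSpace (Projectivization ℂ V) := noetherianSpace_projectivization
  induction d generalizing D with
  | zero =>
    refine ⟨Fin.elim0, fun q hq => ?_⟩
    exact absurd (h (RelSeries.singleton _
      ⟨closure {(⟨q, hq⟩ : D)}, isIrreducible_singleton.closure, isClosed_closure⟩)) (by simp)
  | succ d ih =>
    have hD : NoetherianSpace D := Topology.IsInducing.subtypeVal.noetherianSpace
    have hne : ∀ C ∈ irreducibleComponents D, C.Nonempty := fun C hC => hC.1.nonempty
    choose c hc using fun C : irreducibleComponents D => hne C C.2
    have hfin := (NoetherianSpace.finite_irreducibleComponents (α := D)).to_subtype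
    -- A form that does not vanish at one chosen point of each irreducible component; its hyperplane
    -- section contains no component, so its dimension is smaller.
    obtain ⟨l₀, hl₀⟩ := exists_form_ne_zero (Set.finite_range fun C => (c C).1)
    let D' : Set (Projectivization ℂ V) := D ∩ {q | l₀ q.rep = 0}
    have hin : Topology.IsInducing (Set.inclusion (Set.inter_subset_left : D' ⊆ D)) :=
      (Topology.IsEmbedding.inclusion _).isInducing
    obtain ⟨l, hl⟩ := ih D' fun p => by
      let p' := p.map _ (IrreducibleCloseds.map_strictMono_of_isInducing hin)
      obtain ⟨C, hC, hsub⟩ := exists_mem_irreducibleComponents_subset_of_isIrreducible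
        (p'.last : Set D) p'.last.isIrreducible
      -- Every chain in the hyperplane section can be lengthened by a component of D.
      have hlt : p'.last < ⟨C, hC.1, isClosed_of_mem_irreducibleComponents C hC⟩ := by
        refine lt_of_le_of_ne hsub fun he => ?_
        have h1 : c ⟨C, hC⟩ ∈ (p'.last : Set D) := by
          rw [he]; exact hc ⟨C, hC⟩
        have h2 : (p'.last : Set D) ⊆ {q | l₀ q.1.rep = 0} := by
          refine closure_minimal ?_ ((isClosed_setOf_form l₀).preimage continuous_subtype_val)
          rintro _ ⟨q, -, rfl⟩
          exact q.2.2
        exact hl₀ _ ⟨⟨C, hC⟩, rfl⟩ (h2 h1)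
      have h3 := h (p'.snoc _ hlt)
      simpa [p'] using h3
    refine ⟨Fin.cons l₀ l, fun q hq => ?_⟩
    by_cases h0 : l₀ q.rep = 0
    · obtain ⟨i, hi⟩ := hl q ⟨hq, h0⟩
      exact ⟨i.succ, by simpa using hi⟩
    · exact ⟨0, by simpa using h0⟩

theorem projDim_lt_of_length_lt {D : Set (Projectivization ℂ V)} {d : ℕ}
    (h : ∀ p : LTSeries (IrreducibleCloseds D), p.length < d) : projDim D < d := by
  unfold projDim
  split_ifs with hD
  · omega
  · obtain ⟨q, hq⟩ := Set.nonempty_iff_ne_empty.mpr hD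
    -- The chain of length zero shows d > 0, so the truncated subtraction d - 1 below is exact.
    have h0 := h (RelSeries.singleton _
      ⟨closure {(⟨q, hq⟩ : D)}, isIrreducible_singleton.closure, isClosed_closure⟩)
    have h1 : topologicalKrullDim D ≤ ((d - 1 : ℕ) : ℕ∞) :=
      iSup_le fun p => by
        have := h p
        have h2 : p.length ≤ d - 1 := by omega
        exact_mod_cast h2
    have h2 : (topologicalKrullDim D).unbotD 0 ≤ ((d - 1 : ℕ) : ℕ∞) := by
      rw [WithBot.unbotD_le_iff]
      · exact h1
      · simp
    have h3 := ENat.toNat_le_of_le_natCast h2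
    omega

/-- In `projDim` an infinite Krull dimension would be read as 0, so chains must be bounded
beforehand; the coordinate forms, which have no common zero, do this. -/
theorem length_lt_of_projDim [FiniteDimensional ℂ V] {D : Set (Projectivization ℂ V)} {d : ℕ}
    (h : projDim D < d) (p : LTSeries (IrreducibleCloseds D)) : p.length < d := by
  have hfin : ∀ p : LTSeries (IrreducibleCloseds D), p.length < Module.finrank ℂ V := fun p => by
    have hin : Topology.IsInducing (Set.inclusion (Set.subset_univ D)) :=
      (Topology.IsEmbedding.inclusion _).isInducing
    refine length_lt_of_forms isClosed_univ (fun i => (Module.finBasis ℂ V).coord i)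
      (fun q _ => ?_) (p.map _ (IrreducibleCloseds.map_strictMono_of_isInducing hin))
    by_contra! h0
    exact q.rep_nonzero ((Module.finBasis ℂ V).ext_elem fun i => by simpa using h0 i)
  have hne : D ≠ ∅ := by
    obtain ⟨q, -⟩ := p.head.isIrreducible.nonempty
    exact Set.nonempty_iff_ne_empty.mp ⟨q.1, q.2⟩
  have hle : topologicalKrullDim D ≤ ((Module.finrank ℂ V : ℕ) : ℕ∞) :=
    iSup_le fun p => by exact_mod_cast (hfin p).le
  have hp : (p.length : WithBot ℕ∞) ≤ topologicalKrullDim D := le_iSup_of_le p le_rfl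
  unfold projDim at h
  rw [if_neg hne] at h
  generalize topologicalKrullDim D = k at *
  induction k with
  | bot => simp at hp
  | coe k =>
    have hk : k ≤ (Module.finrank ℂ V : ℕ) := by exact_mod_cast hle
    lift k to ℕ using ne_top_of_le_ne_top (ENat.natCast_ne_top _) hk
    have h1 : p.length ≤ k := by exact_mod_cast hp
    have h2 : (k : ℤ) < d := h
    omega

end ProjectiveDimension

/-! ### Comparison of discriminants under a linear embedding. -/

section ProjectiveComparison

attribute [local instance] zariskiTopology

theorem form_rep_mk_ne_zero_iff {V : Type} [AddCommGroup V] [Module ℂ V] (l : Module.Dual ℂ V)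
    (v : V) (hv : v ≠ 0) : l (Projectivization.mk ℂ v hv).rep ≠ 0 ↔ l v ≠ 0 := by
  simpa using (eval_rep_mk (MvPolynomial.isHomogeneous_X ℂ l) v hv).not

/-- Linear subspaces missing D are carried by φ to linear subspaces missing D', and the largest
dimension of such a subspace determines the dimension of a closed set. Closedness is needed only for
D': the construction of forms on D works for any subset. -/
theorem projDim_sub_finrank_le {V W : Type} [AddCommGroup V] [Module ℂ V] [AddCommGroup W]
    [Module ℂ W] [FiniteDimensional ℂ V] [FiniteDimensional ℂ W] (φ : V →ₗ[ℂ] W)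
    (hφ : Function.Injective φ) {D : Set (Projectivization ℂ V)} {D' : Set (Projectivization ℂ W)}
    (hD' : IsClosed D') (h : ∀ (v : V) (hv : v ≠ 0) (hw : φ v ≠ 0),
      Projectivization.mk ℂ (φ v) hw ∈ D' → Projectivization.mk ℂ v hv ∈ D) :
    projDim D' - Module.finrank ℂ W ≤ projDim D - Module.finrank ℂ V := by
  have h0 : -1 ≤ projDim D := by
    unfold projDim
    split_ifs <;> omega
  -- One form more than the dimension; none when D is empty, as its dimension is -1.
  obtain ⟨l, hl⟩ := exists_forms (projDim D + 1).toNat D fun p =>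
    length_lt_of_projDim (by omega) p
  let Λ : Submodule ℂ V := LinearMap.ker (LinearMap.pi l)
  let Λ' : Submodule ℂ W := Λ.map φ
  have hΛ : Module.finrank ℂ V ≤ (projDim D + 1).toNat + Module.finrank ℂ Λ := by
    have h1 := (LinearMap.pi l).finrank_range_add_finrank_ker
    have h2 := (LinearMap.range (LinearMap.pi l)).finrank_le
    rw [Module.finrank_fin_fun] at h2
    change _ ≤ _ + Module.finrank ℂ (LinearMap.ker (LinearMap.pi l))
    omega
  have hΛ' : Module.finrank ℂ Λ' = Module.finrank ℂ Λ :=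
    (Submodule.equivMapOfInjective φ hφ Λ).symm.finrank_eq
  have hquot := Submodule.finrank_quotient_add_finrank Λ'
  let b := Module.finBasis ℂ (W ⧸ Λ')
  have h1 : projDim D' < Module.finrank ℂ (W ⧸ Λ') := by
    refine projDim_lt_of_length_lt fun p =>
      length_lt_of_forms hD' (fun i => (b.coord i).comp Λ'.mkQ) (fun q hq => ?_) p
    by_contra! hq0
    have h2 : q.rep ∈ Λ' := by
      rw [← Submodule.Quotient.mk_eq_zero]
      exact b.ext_elem fun i => by simpa using hq0 i
    obtain ⟨v, hv, hvq⟩ := h2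
    have hv0 : v ≠ 0 := by
      rintro rfl
      exact q.rep_nonzero (by rw [← hvq, map_zero])
    have h3 : Projectivization.mk ℂ v hv0 ∈ D := by
      refine h v hv0 (hvq ▸ q.rep_nonzero) ?_
      convert! hq
      conv_rhs => rw [← q.mk_rep]
      congr 1
    obtain ⟨i, hi⟩ := hl _ h3
    exact (form_rep_mk_ne_zero_iff _ v hv0).mp hi (congrFun (LinearMap.mem_ker.mp hv) i)
  omega

theorem mem_discriminantLocus_mk {X : Scheme.{0}} {f : X ⟶ SpecC} {L : X.Modules}
    {V : Submodule ℂ (H0 f L)} {s : V} (hs : s ≠ 0) (h : IsSingular (s : H0 f L)) :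
    Projectivization.mk ℂ s hs ∈ discriminantLocus V :=
  ⟨s, by simp, hs, h⟩

theorem isSingular_smul {X : Scheme.{0}} {f : X ⟶ SpecC} {L : X.Modules} {s : H0 f L}
    (h : IsSingular s) (c : ℂ) : IsSingular (c • s) := by
  obtain ⟨x, hx, hj⟩ := h
  refine ⟨x, hx, ?_⟩
  rw [JetVanishesAt, H0.toSection_smul]
  have h1 := germ_smul' L x ⊤ trivial (scalars f ⊤ c) s.toSection
  have h2 := Submodule.smul_mem _ (X.presheaf.germ ⊤ x trivial (scalars f ⊤ c)) hj
  rwa [← h1] at h2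

theorem isSingular_of_mk_mem {X : Scheme.{0}} {f : X ⟶ SpecC} {L : X.Modules}
    {V : Submodule ℂ (H0 f L)} {s : V} (hs : s ≠ 0)
    (h : Projectivization.mk ℂ s hs ∈ discriminantLocus V) : IsSingular (s : H0 f L) := by
  obtain ⟨t, ht, ht0, htS⟩ := h
  rw [Projectivization.submodule_mk, Submodule.mem_span_singleton] at ht
  obtain ⟨a, rfl⟩ := ht
  have ha : a ≠ 0 := by
    rintro rfl
    simp at ht0
  have h1 := isSingular_smul htS a⁻¹
  rwa [Submodule.coe_smul, inv_smul_smul₀ ha] at h1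

theorem defect_le_of_linearMap {X X' : Scheme.{0}} {f : X ⟶ SpecC} {L : X.Modules}
    {f' : X' ⟶ SpecC} {L' : X'.Modules} (φ : H0 f L →ₗ[ℂ] H0 f' L') (hφ : Function.Injective φ)
    (h : ∀ s, IsSingular (φ s) → IsSingular s) (V : Submodule ℂ (H0 f L))
    [FiniteDimensional ℂ (H0 f' L')]
    (hcl : IsClosed (discriminantLocus (⊤ : Submodule ℂ (H0 f' L')))) :
    defect V ≤ defect (⊤ : Submodule ℂ (H0 f' L')) := by
  have : FiniteDimensional ℂ (H0 f L) := Module.Finite.of_injective φ hφ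
  let ψ : V →ₗ[ℂ] (⊤ : Submodule ℂ (H0 f' L')) :=
    (φ.comp V.subtype).codRestrict ⊤ fun _ => trivial
  have hψ : Function.Injective ψ := fun s t hst =>
    Subtype.ext (hφ (congrArg Subtype.val hst))
  have h1 := projDim_sub_finrank_le ψ hψ (D := discriminantLocus V) hcl fun v hv hw hm =>
    mem_discriminantLocus_mk hv (h _ (isSingular_of_mk_mem hw hm))
  unfold defect
  omega

end ProjectiveComparison

/-! ### Finiteness of spaces of functions with bounded poles -/

/-- Noether normalization makes S finite over a polynomial ring A. Then F is finite over the
fraction field of A, and separable in characteristic zero, so the integral closure of A in F is a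
Noetherian A-module; it contains that of S. -/
theorem isNoetherian_integralClosure {k F : Type} [Field k] [CharZero k] [Field F] [Algebra k F]
    [Algebra.EssFiniteType k F] (S : Subalgebra k F) [Algebra.FiniteType k S]
    (h : IntermediateField.adjoin k (S : Set F) = ⊤) : IsNoetherian S (integralClosure S F) := by
  obtain ⟨n, g, hg, hfin⟩ := exists_finite_inj_algHom_of_fg k S
  let A := MvPolynomial (Fin n) k
  algebraize [g.toRingHom, (S.val.comp g).toRingHom]
  have : IsScalarTower A S F := .of_algebraMap_eq' rfl
  have : IsScalarTower k A S := .of_algebraMap_eq' g.comp_algebraMap.symm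
  have : IsScalarTower k A F := .of_algebraMap_eq' (S.val.comp g).comp_algebraMap.symm
  have : FaithfulSMul A F := (faithfulSMul_iff_algebraMap_injective A F).mpr
    (Subtype.val_injective.comp hg)
  let K := FractionRing A
  let := FractionRing.liftAlgebra A F
  have : IsScalarTower A K F := FractionRing.isScalarTower_liftAlgebra A F
  have : IsScalarTower k K F := .of_algebraMap_eq fun c => by
    rw [IsScalarTower.algebraMap_apply k A F, IsScalarTower.algebraMap_apply A K F,
      ← IsScalarTower.algebraMap_apply k A K]
  have : Module.Finite A S := hfin
  have hint : Algebra.IsIntegral A S := inferInstance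
  have : Algebra.IsAlgebraic K F := by
    have h1 : (algebraicClosure K F).restrictScalars k = ⊤ := by
      rw [eq_top_iff, ← h, IntermediateField.adjoin_le_iff]
      intro x hx
      have h2 : IsIntegral A (algebraMap S F ⟨x, hx⟩) := (hint.isIntegral ⟨x, hx⟩).algebraMap
      exact mem_algebraicClosure_iff.mpr (h2.tower_top (A := K)).isAlgebraic
    refine ⟨fun x => ?_⟩
    have h2 : x ∈ (algebraicClosure K F).restrictScalars k := h1 ▸ trivial
    exact mem_algebraicClosure_iff.mp h2
  have : Algebra.EssFiniteType K F := .of_comp k K F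
  have : Module.Finite K F := Algebra.finite_of_essFiniteType_of_isAlgebraic
  have : CharZero K := charZero_of_injective_algebraMap (algebraMap k K).injective
  have hN : IsNoetherian A (integralClosure A F) :=
    IsIntegralClosure.isNoetherian A K F (integralClosure A F)
  let ι : integralClosure S F →ₗ[A] integralClosure A F :=
    { toFun := fun x => ⟨x.1, isIntegral_trans x.1 x.2⟩
      map_add' := fun _ _ => rfl
      map_smul' := fun _ _ => rfl }
  have hN' : IsNoetherian A (integralClosure S F) :=
    isNoetherian_of_injective ι fun x y hxy => by
      have h1 : (ι x).1 = (ι y).1 := by rw [hxy]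
      exact Subtype.ext h1
  exact isNoetherian_of_tower A hN'

open Polynomial in
-- Here H is a space of functions with poles bounded by the l_i. A variable X is adjoined to grade
-- the problem: S is generated by X, the l_i X and multiples of X by field generators, and for κ in
-- H the element κX is integral over S. These elements therefore span a finite S-module, and
-- comparison of coefficients of X gives finitely many generators of H over k.
theorem finiteDimensional_of_valuationSubring {k K ι : Type} [Field k] [CharZero k] [Field K]
    [Algebra k K] [Algebra.EssFiniteType k K] [Finite ι] (l : ι → K) (H : Submodule k K)
    (h : ∀ κ ∈ H, ∀ O : ValuationSubring K, (∀ c, algebraMap k K c ∈ O) →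
      ∃ i, ∃ a ∈ O, κ = a * l i) : FiniteDimensional k H := by
  let F := FractionRing K[X]
  obtain ⟨s, hs⟩ := IntermediateField.fg_top k K
  let θ : K[X] →ₐ[k] F := IsScalarTower.toAlgHom k K[X] F
  have hθ : Function.Injective θ := IsFractionRing.injective K[X] F
  let G : Set K[X] := insert X ((fun a => C a * X) '' (Set.range l ∪ s))
  have hG : G.Finite := ((Set.finite_range l).union s.finite_toSet).image _ |>.insert _
  let S : Subalgebra k F := Algebra.adjoin k (θ '' G)
  have : Algebra.FiniteType k S := by
    rw [← Subalgebra.fg_iff_finiteType]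
    exact Subalgebra.fg_def.mpr ⟨_, hG.image _, rfl⟩
  -- All generators of S are multiples of X, so constant terms lie in k.
  have hS : ∀ z ∈ S, ∃ p : K[X], θ p = z ∧ ∃ c : k, p.coeff 0 = algebraMap k K c := by
    intro z hz
    induction hz using Algebra.adjoin_induction with
    | mem x hx =>
      obtain ⟨p, hp, rfl⟩ := hx
      refine ⟨p, rfl, 0, ?_⟩
      obtain rfl | ⟨a, -, rfl⟩ := hp <;> simp
    | algebraMap c =>
      refine ⟨algebraMap k K[X] c, θ.commutes c, c, ?_⟩
      simp [Polynomial.algebraMap_apply]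
    | add x y _ _ hx hy =>
      obtain ⟨p, rfl, c, hc⟩ := hx
      obtain ⟨q, rfl, d, hd⟩ := hy
      exact ⟨p + q, map_add _ _ _, c + d, by simp [hc, hd]⟩
    | mul x y _ _ hx hy =>
      obtain ⟨p, rfl, c, hc⟩ := hx
      obtain ⟨q, rfl, d, hd⟩ := hy
      exact ⟨p * q, map_mul _ _ _, c * d, by simp [hc, hd, mul_coeff_zero]⟩
  have hgen : IntermediateField.adjoin k (S : Set F) = ⊤ := by
    set E := IntermediateField.adjoin k (S : Set F)
    have hSE : ∀ p ∈ G, θ p ∈ E := fun p hp =>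
      IntermediateField.subset_adjoin k _ (Algebra.subset_adjoin ⟨p, hp, rfl⟩)
    have hX : θ X ∈ E := hSE _ (Set.mem_insert _ _)
    have hX0 : θ X ≠ 0 := (map_ne_zero_iff θ hθ).mpr X_ne_zero
    let j : K →ₐ[k] F := IsScalarTower.toAlgHom k K F
    have hj : ∀ a, j a = θ (C a) := fun a => IsScalarTower.algebraMap_apply K K[X] F a
    have hK : ∀ a : K, j a ∈ E := by
      have h1 : E.comap j = ⊤ := by
        rw [eq_top_iff, ← hs, IntermediateField.adjoin_le_iff]
        intro a ha
        have h2 := hSE (C a * X) (Set.mem_insert_of_mem _ ⟨a, Or.inr ha, rfl⟩)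
        rw [map_mul] at h2
        have h3 := E.mul_mem h2 (E.inv_mem hX)
        rw [mul_inv_cancel_right₀ hX0, ← hj] at h3
        exact h3
      intro a
      have : a ∈ E.comap j := h1 ▸ trivial
      exact this
    have hP : ∀ p : K[X], θ p ∈ E := by
      intro p
      induction p using Polynomial.induction_on' with
      | add p q hp hq => rw [map_add]; exact E.add_mem hp hq
      | monomial n a =>
        rw [← C_mul_X_pow_eq_monomial, map_mul, map_pow, ← hj]
        exact E.mul_mem (hK a) (pow_mem hX n)
    rw [eq_top_iff]
    rintro z -
    obtain ⟨p, q, hq, rfl⟩ := IsFractionRing.div_surjective (A := K[X]) z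
    exact E.div_mem (hP p) (hP q)
  have : Algebra.EssFiniteType k K[X] := .comp k K K[X]
  have : Algebra.EssFiniteType k F := .comp k K[X] F
  have hN := isNoetherian_integralClosure S hgen
  have hint : ∀ κ ∈ H, IsIntegral S (θ (C κ * X)) := by
    intro κ hκ
    by_contra hni
    have hx : θ (C κ * X) ∉ (integralClosure S F).toSubring := hni
    have : IsIntegrallyClosedIn (integralClosure S F).toSubring F :=
      inferInstanceAs (IsIntegrallyClosedIn (integralClosure S F) F)
    obtain ⟨V, hV, hxV⟩ := Subring.exists_le_valuationSubring_of_isIntegrallyClosedIn hx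
    have hSV : ∀ z ∈ S, z ∈ V := fun z hz => hV (isIntegral_algebraMap (x := (⟨z, hz⟩ : S)))
    -- A valuation ring V containing S but not κX restricts to K, and the pole bound there writes κX
    -- as a · (l_i X), which does lie in V.
    obtain ⟨i, a, ha, rfl⟩ := h κ hκ (V.comap (algebraMap K F)) fun c => by
      rw [ValuationSubring.mem_comap, ← IsScalarTower.algebraMap_apply]
      exact hSV _ (S.algebraMap_mem c)
    rw [ValuationSubring.mem_comap] at ha
    apply hxV
    rw [C_mul, mul_assoc, map_mul]
    exact V.mul_mem _ _ ha (hSV _ (Algebra.subset_adjoin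
      ⟨_, Set.mem_insert_of_mem _ ⟨l i, Or.inl ⟨i, rfl⟩, rfl⟩, rfl⟩))
  let N : Submodule S F := Submodule.span S ((fun κ => θ (C κ * X)) '' H)
  have hNle : N ≤ Subalgebra.toSubmodule (integralClosure S F) := by
    rw [Submodule.span_le]
    rintro _ ⟨κ, hκ, rfl⟩
    exact hint κ hκ
  have hNfg : N.FG := by
    have : IsNoetherian S (Subalgebra.toSubmodule (integralClosure S F)) := hN
    have := isNoetherian_of_le hNle
    exact (Submodule.fg_top N).mp (IsNoetherian.noetherian ⊤)
  obtain ⟨t, htH, ht⟩ := (Submodule.fg_span_iff_fg_span_finset_subset _).mp hNfg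
  obtain ⟨u, huH, hut⟩ := Set.subset_image_iff.mp htH
  have hufin : u.Finite := by
    refine Set.Finite.of_finite_image (f := fun κ => θ (C κ * X)) (hut ▸ t.finite_toSet) ?_
    intro a _ b _ hab
    simpa using hθ hab
  have hH : H ≤ Submodule.span k u := by
    intro κ hκ
    have h1 : θ (C κ * X) ∈ N := Submodule.subset_span ⟨κ, hκ, rfl⟩
    rw [show N = _ from ht, ← hut] at h1
    -- The generators κX have no constant term, so in degree one only the constant terms of the
    -- coefficients from S, which lie in k, contribute.
    have h2 : ∀ z ∈ Submodule.span S ((fun κ => θ (C κ * X)) '' u),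
        ∃ p : K[X], θ p = z ∧ p.coeff 0 = 0 ∧ p.coeff 1 ∈ Submodule.span k u := by
      intro z hz
      induction hz using Submodule.span_induction with
      | mem x hx =>
        obtain ⟨a, ha, rfl⟩ := hx
        exact ⟨_, rfl, by simp, by simpa using Submodule.subset_span ha⟩
      | zero => exact ⟨0, map_zero _, by simp, by simp⟩
      | add x y _ _ hx hy =>
        obtain ⟨p, rfl, hp0, hp⟩ := hx
        obtain ⟨q, rfl, hq0, hq⟩ := hy
        exact ⟨p + q, map_add _ _ _, by simp [hp0, hq0], by simpa using add_mem hp hq⟩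
      | smul a x _ hx =>
        obtain ⟨p, rfl, hp0, hp⟩ := hx
        obtain ⟨q, hq, c, hc⟩ := hS a.1 a.2
        refine ⟨q * p, by rw [map_mul, hq]; rfl, by simp [mul_coeff_zero, hp0], ?_⟩
        rw [mul_coeff_one, hp0, hc, mul_zero, add_zero, ← Algebra.smul_def]
        exact Submodule.smul_mem _ c hp
    obtain ⟨p, hp, -, hp1⟩ := h2 _ h1
    rw [hθ hp] at hp1
    simpa using hp1
  have := FiniteDimensional.span_of_finite k hufin
  exact Submodule.finiteDimensional_of_le hH

/-! ### Centres of valuations, and sections of line bundles. -/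

theorem eq_toSpecΓ_comp {X : Scheme.{0}} {R : CommRingCat.{0}} (f : X ⟶ Spec R) :
    f = X.toSpecΓ ≫ Spec.map ((Scheme.ΓSpecIso R).inv ≫ f.appTop) := by
  rw [Spec.map_comp, ← Category.assoc, ← Scheme.toSpecΓ_naturality, Category.assoc,
    toSpecΓ_SpecMap_ΓSpecIso_inv, Category.comp_id]

/-- A valuation ring of the function field of a proper variety has a centre. -/
theorem exists_center {X : Scheme.{0}} [IsIntegral X] (f : X ⟶ SpecC) [UniversallyClosed f]
    (O : ValuationSubring X.functionField)
    (hO : ∀ c, X.presheaf.germ ⊤ (genericPoint X) trivial (scalars f ⊤ c) ∈ O) :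
    ∃ x : X, ∀ (U : X.Opens) (_ : x ∈ U) (hU : genericPoint X ∈ U) (a : Γ(X, U)),
      X.presheaf.germ U (genericPoint X) hU a ∈ O := by
  let g : ℂ →+* X.functionField :=
    (X.presheaf.germ ⊤ (genericPoint X) trivial).hom.comp (scalars f ⊤)
  let j : ℂ →+* O := g.codRestrict O hO
  have hf : X.fromSpecStalk (genericPoint X) ≫ f =
      Spec.map (CommRingCat.ofHom (algebraMap O X.functionField)) ≫
        Spec.map (CommRingCat.ofHom j) := by
    conv_lhs => rw [eq_toSpecΓ_comp f]
    rw [← Category.assoc, Scheme.fromSpecStalk_toSpecΓ, ← Spec.map_comp, ← Spec.map_comp]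
    congr 1
    ext c
    exact congrArg (X.presheaf.germ ⊤ (genericPoint X) trivial) (scalars_top f c).symm
  have h1 := (UniversallyClosed.eq_valuativeCriterion ▸ ‹UniversallyClosed f› :
    (ValuativeCriterion.Existence ⊓ @QuasiCompact) f).1
    { R := O, K := X.functionField, i₁ := X.fromSpecStalk (genericPoint X)
      i₂ := Spec.map (CommRingCat.ofHom j), commSq := ⟨hf⟩ }
  obtain ⟨⟨l, hl, -⟩⟩ := h1.exists_lift
  -- The valuative criterion extends the generic point to the spectrum of O; the centre is the image
  -- of the closed point.
  let x := l (IsLocalRing.closedPoint O)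
  have hx : genericPoint X ⤳ x := (genericPoint_spec X).specializes trivial
  have h2 : Scheme.stalkClosedPointTo l ≫ CommRingCat.ofHom (algebraMap O X.functionField) =
      X.presheaf.stalkSpecializes hx := by
    apply Spec.map_injective
    rw [← cancel_mono (X.fromSpecStalk x), Scheme.SpecMap_stalkSpecializes_fromSpecStalk,
      Spec.map_comp, Category.assoc, Scheme.Spec_stalkClosedPointTo_fromSpecStalk]
    exact hl
  refine ⟨x, fun U hxU hU a => ?_⟩
  have h3 : X.presheaf.germ U (genericPoint X) hU a =
      X.presheaf.stalkSpecializes hx (X.presheaf.germ U x hxU a) := by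
    rw [← CommRingCat.comp_apply, X.presheaf.germ_stalkSpecializes]
  rw [h3, ← h2]
  exact Subtype.prop _

/-- The coefficient of a section with respect to a frame. -/
noncomputable def IsFrame.coeff {X : Scheme.{0}} {M : X.Modules} {U : X.Opens} {e : Γ(M, U)}
    (he : IsFrame e) (s : Γ(M, ⊤)) : Γ(X, U) :=
  (he.exists_eq_smul le_rfl (res le_top s)).choose

theorem IsFrame.smul_injective {X : Scheme.{0}} {M : X.Modules} {U : X.Opens} {e : Γ(M, U)}
    (he : IsFrame e) {a b : Γ(X, U)} (h : a • e = b • e) : a = b := by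
  apply (he U le_rfl).1
  simpa only [res_self] using h

theorem IsFrame.res_eq_coeff_smul {X : Scheme.{0}} {M : X.Modules} {U : X.Opens} {e : Γ(M, U)}
    (he : IsFrame e) (s : Γ(M, ⊤)) : res le_top s = he.coeff s • e :=
  (he.exists_eq_smul le_rfl (res le_top s)).choose_spec.trans
    (congrArg (he.coeff s • ·) (res_self le_rfl e))

theorem IsFrame.coeff_add {X : Scheme.{0}} {M : X.Modules} {U : X.Opens} {e : Γ(M, U)}
    (he : IsFrame e) (s t : Γ(M, ⊤)) : he.coeff (s + t) = he.coeff s + he.coeff t := by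
  apply he.smul_injective
  rw [← he.res_eq_coeff_smul, add_smul, ← he.res_eq_coeff_smul, ← he.res_eq_coeff_smul]
  exact map_add _ _ _

theorem IsFrame.coeff_smul {X : Scheme.{0}} {M : X.Modules} {U : X.Opens} {e : Γ(M, U)}
    (he : IsFrame e) (a : Γ(X, ⊤)) (s : Γ(M, ⊤)) :
    he.coeff (a • s) = fres le_top a * he.coeff s := by
  apply he.smul_injective
  rw [← he.res_eq_coeff_smul, mul_smul, ← he.res_eq_coeff_smul, res_smul]

theorem genericPoint_mem {X : Scheme.{0}} [IsIntegral X] {U : X.Opens} {x : X} (hx : x ∈ U) :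
    genericPoint X ∈ U :=
  ((genericPoint_spec X).mem_open_set_iff U.isOpen).mpr ⟨x, trivial, hx⟩

/-- The coefficient of a section at the generic point, with respect to a frame, is a linear
function of the section. -/
noncomputable def IsFrame.genericCoeff {X : Scheme.{0}} [IsIntegral X] (f : X ⟶ SpecC)
    [Algebra ℂ X.functionField]
    (h : ∀ c, algebraMap ℂ X.functionField c =
      X.presheaf.germ ⊤ (genericPoint X) trivial (scalars f ⊤ c))
    {M : X.Modules} {U : X.Opens} (hU : genericPoint X ∈ U) {e : Γ(M, U)} (he : IsFrame e) :
    H0 f M →ₗ[ℂ] X.functionField where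
  toFun s := X.presheaf.germ U (genericPoint X) hU (he.coeff s.toSection)
  map_add' s t := (congrArg _ (he.coeff_add s.toSection t.toSection)).trans (map_add _ _ _)
  map_smul' c s := by
    rw [H0.toSection_smul, he.coeff_smul, map_mul, Algebra.smul_def, RingHom.id_apply, h,
      germ_fres]

/-- A line bundle on a proper variety has a finite-dimensional space of sections. -/
theorem IsLineBundle.finiteDimensional_H0 {X : Scheme.{0}} [IsIntegral X] (f : X ⟶ SpecC)
    [UniversallyClosed f] [LocallyOfFiniteType f] {L : X.Modules} (hL : IsLineBundle L) :
    FiniteDimensional ℂ (H0 f L) := by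
  have : CompactSpace X := QuasiCompact.compactSpace_of_compactSpace f
  set η := genericPoint X
  choose U hU e he using hL.exists_frame
  have hη : ∀ x, η ∈ U x := fun x => genericPoint_mem (hU x)
  obtain ⟨V, hV, hηV, -⟩ := exists_affine_chart η ⊤ trivial
  let : Algebra ℂ X.functionField :=
    ((X.presheaf.germ ⊤ η trivial).hom.comp (scalars f ⊤)).toAlgebra
  have halg : ∀ c, algebraMap ℂ X.functionField c =
    X.presheaf.germ ⊤ η trivial (scalars f ⊤ c) := fun c => rfl
  have hess : Algebra.EssFiniteType ℂ X.functionField := by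
    have : Nonempty V := ⟨η, hηV⟩
    let := (scalars f V).toAlgebra
    have : Algebra.FiniteType ℂ Γ(X, V) := scalars_finiteType f hV
    have : IsScalarTower ℂ Γ(X, V) X.functionField := .of_algebraMap_eq fun c => by
      rw [halg, ← germ_fres le_top η hηV, fres_scalars]
      rfl
    have := functionField_isFractionRing_of_isAffineOpen X V hV
    have := Algebra.EssFiniteType.of_isLocalization X.functionField (nonZeroDivisors Γ(X, V))
    exact .comp ℂ Γ(X, V) X.functionField
  obtain ⟨t, ht⟩ := isCompact_univ.elim_finite_subcover (fun x => (U x : Set X))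
    (fun x => (U x).isOpen) fun x _ => Set.mem_iUnion.mpr ⟨x, hU x⟩
  have hW : ∀ x, η ∈ U x ⊓ U η := fun x => ⟨hη x, hη η⟩
  -- Transition functions from the local frames to the frame at the generic point. A section has
  -- coefficient (regular function on U x) · (u x), so finitely many u x bound its poles.
  choose u hu using fun x => ((he η).restrict (V := U x ⊓ U η) inf_le_right).exists_eq_smul le_rfl
    (res inf_le_left (e x))
  let κ := (he η).genericCoeff f halg (hη η)
  have hκ : ∀ (s : H0 f L) x, κ s = X.presheaf.germ (U x) η (hη x) ((he x).coeff s.toSection) *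
      X.presheaf.germ (U x ⊓ U η) η (hW x) (u x) := by
    intro s x
    have h1 : fres inf_le_right ((he η).coeff s.toSection) =
        fres inf_le_left ((he x).coeff s.toSection) * u x := by
      apply ((he η).restrict (V := U x ⊓ U η) inf_le_right).smul_injective
      have h2 := hu x
      rw [res_self] at h2
      rw [mul_smul, ← h2, ← res_smul, ← res_smul, ← (he η).res_eq_coeff_smul,
        ← (he x).res_eq_coeff_smul, res_res, res_res]
    have h3 := congrArg (X.presheaf.germ (U x ⊓ U η) η (hW x)) h1
    rw [map_mul, germ_fres, germ_fres] at h3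
    exact h3
  have hinj : Function.Injective κ := by
    rw [injective_iff_map_eq_zero]
    intro s hs
    have h0 : (he η).coeff s.toSection = 0 :=
      germ_injective_of_isIntegral X η (hη η) (hs.trans (map_zero _).symm)
    refine section_eq_of_locally (M := L) (O := ⊤) fun x _ => ⟨U x, le_top, hU x, ?_⟩
    have h1 : (he x).coeff s.toSection = 0 := by
      refine fres_injective (inf_le_left : U x ⊓ U η ≤ U x) ⟨η, hW x⟩ ?_
      apply ((he x).restrict (V := U x ⊓ U η) inf_le_left).smul_injective
      rw [← res_smul, ← (he x).res_eq_coeff_smul, map_zero, zero_smul, res_res,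
        ← res_res le_top inf_le_right, (he η).res_eq_coeff_smul, h0, zero_smul]
      exact map_zero _
    have h2 := (he x).res_eq_coeff_smul s.toSection
    rw [h1, zero_smul] at h2
    exact h2.trans (map_zero _).symm
  have hfin : FiniteDimensional ℂ (LinearMap.range κ) := by
    refine finiteDimensional_of_valuationSubring
      (fun x : t => X.presheaf.germ (U x ⊓ U η) η (hW x) (u x)) _ ?_
    rintro _ ⟨s, rfl⟩ O hO
    -- The frame to use is that of a member of the finite cover containing the centre of O, where
    -- regular functions have germs in O.
    obtain ⟨x, hx⟩ := exists_center f O hO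
    obtain ⟨y, hy, hxy⟩ := Set.mem_iUnion₂.mp (ht (Set.mem_univ x))
    exact ⟨⟨y, hy⟩, _, hx (U y) hxy (hη y) _, hκ s y⟩
  exact Module.Finite.equiv (LinearEquiv.ofInjective κ hinj).symm

/-! ### Elimination -/

theorem exists_isClosed_singleton_mem {X : Scheme.{0}} [CompactSpace X] {T : Set X}
    (hT : IsClosed T) (hne : T.Nonempty) : ∃ x ∈ T, IsClosed {x} :=
  hT.exists_closed_singleton hne

theorem appLE_apply_of_eq_id {X : Scheme.{0}} {g : X ⟶ X} (h : g = 𝟙 X) {U : X.Opens}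
    (e : U ≤ g ⁻¹ᵁ U) (a : Γ(X, U)) : g.appLE U U e a = a := by
  subst h
  rw [Scheme.Hom.appLE, Scheme.Hom.id_app]
  exact fres_self _ a

/-- The conditions on the parameters `λ` for the existence of a common zero of functions depending
linearly on `λ`, on a proper variety, are polynomial. -/
theorem exists_resultants {X : Scheme.{0}} (f : X ⟶ SpecC) [UniversallyClosed f] {C : Type} {r : ℕ}
    (U : C → X.Opens) (a : ∀ c, Fin r → Γ(X, U c)) :
    ∃ J : Set (MvPolynomial (Fin r) ℂ), ∀ l : Fin r → ℂ,
      (∃ x : X, IsClosed {x} ∧ ∀ c, x ∉ X.basicOpen (∑ i, scalars f (U c) (l i) * a c i)) ↔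
        ∀ p ∈ J, MvPolynomial.eval l p = 0 := by
  have : CompactSpace X := QuasiCompact.compactSpace_of_compactSpace f
  let R := CommRingCat.of (MvPolynomial (Fin r) ℂ)
  let g : Spec R ⟶ SpecC := Spec.map (CommRingCat.ofHom MvPolynomial.C)
  let π₁ := Limits.pullback.fst f g
  let π₂ := Limits.pullback.snd f g
  let ξ : Fin r → Γ(Limits.pullback f g, ⊤) := fun i =>
    π₂.appTop ((Scheme.ΓSpecIso R).inv (MvPolynomial.X i))
  let F : ∀ c, Γ(Limits.pullback f g, π₁ ⁻¹ᵁ U c) := fun c =>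
    ∑ i, fres le_top (ξ i) * π₁.app (U c) (a c i)
  -- The incidence variety in X × 𝔸^r. Its projection to 𝔸^r is closed as f is universally closed,
  -- and J defines the image.
  let T : Set (Limits.pullback f g : Scheme.{0}) :=
    (⋃ c, ((Limits.pullback f g).basicOpen (F c) : Set _))ᶜ
  have hT : IsClosed T :=
    (isOpen_iUnion fun c => ((Limits.pullback f g).basicOpen (F c)).isOpen).isClosed_compl
  have hclosed : IsClosed (π₂ '' T) := π₂.isClosedMap _ hT
  obtain ⟨J, hJ⟩ := (PrimeSpectrum.isClosed_iff_zeroLocus _).mp hclosed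
  refine ⟨J, fun l => ?_⟩
  let ψ : R ⟶ CommRingCat.of ℂ := CommRingCat.ofHom (MvPolynomial.eval l)
  let ε : SpecC ⟶ Spec R := Spec.map ψ
  have hεg : ε ≫ g = 𝟙 _ := by
    rw [← Spec.map_comp, ← Spec.map_id]
    congr 1
    ext c
    exact MvPolynomial.eval_C c
  -- The slice of X × 𝔸^r over the parameter l.
  let τ : X ⟶ Limits.pullback f g := Limits.pullback.lift (𝟙 X) (f ≫ ε) (by
    rw [Category.assoc, hεg, Category.comp_id, Category.id_comp])
  have hτ₁ : τ ≫ π₁ = 𝟙 X := Limits.pullback.lift_fst _ _ _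
  have hτ₂ : τ ≫ π₂ = f ≫ ε := Limits.pullback.lift_snd _ _ _
  have hle : ∀ c, U c ≤ τ ⁻¹ᵁ π₁ ⁻¹ᵁ U c := fun c => by
    rw [← Scheme.Hom.comp_preimage, hτ₁]
    exact le_rfl
  have h1 : ∀ c b, fres (hle c) (τ.app _ (π₁.app (U c) b)) = b := by
    intro c b
    have h : (τ ≫ π₁).appLE (U c) (U c) (hle c) b = b := appLE_apply_of_eq_id hτ₁ _ b
    exact congr($((Scheme.Hom.comp_appLE τ π₁ (U c) (U c) (hle c)).symm) b).trans h
  have h2 : ∀ c i, fres (hle c) (τ.app _ (fres le_top (ξ i))) = scalars f (U c) (l i) := by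
    intro c i
    have h : τ.appTop (ξ i) = scalars f ⊤ (l i) := by
      have h3 : (τ ≫ π₂).appTop ((Scheme.ΓSpecIso R).inv (MvPolynomial.X i)) =
          (f ≫ ε).appTop ((Scheme.ΓSpecIso R).inv (MvPolynomial.X i)) := by rw [hτ₂]
      have h4 : ε.appTop ((Scheme.ΓSpecIso R).inv (MvPolynomial.X i)) =
          (Scheme.ΓSpecIso (CommRingCat.of ℂ)).inv (l i) := by
        have h5 := congr($(Scheme.ΓSpecIso_inv_naturality ψ) (MvPolynomial.X i))
        exact h5.symm.trans
          (congrArg (Scheme.ΓSpecIso (CommRingCat.of ℂ)).inv (MvPolynomial.eval_X i))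
      rw [scalars_top, ← h4]
      exact h3
    rw [← fres_scalars f le_top (l i), ← h, fres_app]
    exact fres_fres _ _ _
  have hF : ∀ c, fres (hle c) (τ.app _ (F c)) = ∑ i, scalars f (U c) (l i) * a c i := by
    intro c
    simp only [F, map_sum, map_mul, h1, h2]
  have hb : ∀ c, τ ⁻¹ᵁ (Limits.pullback f g).basicOpen (F c) =
      X.basicOpen (∑ i, scalars f (U c) (l i) * a c i) := by
    intro c
    rw [← hF, Scheme.preimage_basicOpen]
    refine Eq.trans ?_ (X.basicOpen_res _ (homOfLE (hle c)).op).symm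
    refine (inf_eq_right.mpr ?_).symm
    refine (X.basicOpen_le _).trans ?_
    rw [← Scheme.Hom.comp_preimage, hτ₁]
    exact le_rfl
  have hτT : ∀ x, τ x ∈ T ↔ ∀ c, x ∉ X.basicOpen (∑ i, scalars f (U c) (l i) * a c i) := by
    intro x
    simp only [T, Set.mem_compl_iff, Set.mem_iUnion, not_exists, ← hb]
    exact Iff.rfl
  have hpt : ∀ z : SpecC, ε z ∈ π₂ '' T ↔ ∀ p ∈ J, MvPolynomial.eval l p = 0 := by
    intro z
    have hz : z.asIdeal = ⊥ := (Ideal.eq_bot_or_top z.asIdeal).resolve_right z.isPrime.ne_top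
    rw [hJ]
    refine (PrimeSpectrum.mem_zeroLocus _ _).trans (forall₂_congr fun p _ => ?_)
    change ψ p ∈ z.asIdeal ↔ _
    rw [hz]
    exact Submodule.mem_bot _
  simp only [← hτT]
  constructor
  · rintro ⟨x, -, hx⟩
    rw [← hpt (f x)]
    refine ⟨τ x, hx, ?_⟩
    rw [← Scheme.Hom.comp_apply, ← Scheme.Hom.comp_apply, hτ₂]
  · intro h
    have z : SpecC := IsLocalRing.closedPoint ℂ
    obtain ⟨y, hy, hyz⟩ := (hpt z).mpr h
    obtain ⟨w, rfl, -⟩ := Scheme.Pullback.exists_preimage_pullback (f := π₂) (g := ε) y z hyz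
    -- The fibre of X × 𝔸^r over l is the slice, so a point of T above l comes from X. It is then
    -- specialized to a closed point, by compactness.
    have h3 : Limits.pullback.fst π₂ ε = (Limits.pullback.fst π₂ ε ≫ π₁) ≫ τ := by
      apply Limits.pullback.hom_ext
      · change _ ≫ π₁ = _ ≫ π₁
        rw [Category.assoc, hτ₁, Category.comp_id]
      · change _ ≫ π₂ = _ ≫ π₂
        have h4 : π₁ ≫ f = π₂ ≫ g := Limits.pullback.condition
        rw [Category.assoc, hτ₂, Category.assoc, reassoc_of% h4,
          ← Category.assoc (Limits.pullback.fst π₂ ε), Limits.pullback.condition, Category.assoc,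
          reassoc_of% hεg]
    rw [h3, Scheme.Hom.comp_apply] at hy
    obtain ⟨x, hx, hxc⟩ := exists_isClosed_singleton_mem
      (hT.preimage τ.continuous) ⟨_, hy⟩
    exact ⟨x, hxc, hx⟩

/-! ### The discriminant locus is closed -/

theorem notMem_basicOpen_iff {X : Scheme.{0}} {U : X.Opens} (a : Γ(X, U)) (x : X) :
    x ∉ X.basicOpen a ↔
      ∀ hx : x ∈ U, X.presheaf.germ U x hx a ∈ IsLocalRing.maximalIdeal (X.presheaf.stalk x) := by
  constructor
  · intro h hx
    rw [IsLocalRing.mem_maximalIdeal, mem_nonunits_iff]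
    exact fun hu => h ((X.mem_basicOpen a x hx).mpr hu)
  · intro h hx
    have hxU := X.basicOpen_le a hx
    exact (IsLocalRing.mem_maximalIdeal _).mp (h hxU) ((X.mem_basicOpen a x hxU).mp hx)

/-- At closed points the first jet is given by the coefficient of the section and its derivatives,
all ℂ-linear in the section. Singularity becomes the existence of a common zero of functions
depending linearly on parameters. -/
theorem exists_jet_chart {X : Scheme.{0}} {f : X ⟶ SpecC} {n : ℕ}
    (hf : SmoothOfRelativeDimension n f) {L : X.Modules} (hL : IsLineBundle L) (x : X) :
    ∃ (V : X.Opens) (e : Γ(L, V)) (ι : Type) (D : ι → Γ(X, V) →+ Γ(X, V)), x ∈ V ∧ IsFrame e ∧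
      (∀ j c a, D j (scalars f V c * a) = scalars f V c * D j a) ∧
      ∀ (y : X) (hy : y ∈ V), IsClosed {y} → ∀ a : Γ(X, V),
        X.presheaf.germ V y hy a ∈ IsLocalRing.maximalIdeal (X.presheaf.stalk y) ^ 2 ↔
          X.presheaf.germ V y hy a ∈ IsLocalRing.maximalIdeal (X.presheaf.stalk y) ∧
          ∀ j, X.presheaf.germ V y hy (D j a) ∈
            IsLocalRing.maximalIdeal (X.presheaf.stalk y) := by
  obtain ⟨U, hxU, e, he⟩ := hL.exists_frame x
  obtain ⟨V, hV, hxV, hVU, hsm⟩ := exists_smooth_chart hf x U hxU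
  let := (scalars f V).toAlgebra
  obtain ⟨ι, D, hD⟩ := exists_derivations (scalars f V) hsm.isStandardSmooth
  refine ⟨V, res hVU e, ι, fun j => (D j : Γ(X, V) →+ Γ(X, V)), hxV, he.restrict hVU,
    fun j c a => (D j).map_smul c a, fun y hy hcl a => ?_⟩
  rw [germ_mem_sq_iff hV y hy hcl]
  constructor
  · intro h
    have h1 := Ideal.pow_le_self two_ne_zero h
    exact ⟨mem_pointIdeal.mp h1, fun j => mem_pointIdeal.mp
      ((hD _ (isMaximal_pointIdeal hV y hy hcl) a h1).mp h j)⟩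
  · rintro ⟨h1, h2⟩
    exact (hD _ (isMaximal_pointIdeal hV y hy hcl) a (mem_pointIdeal.mpr h1)).mpr
      fun j => mem_pointIdeal.mpr (h2 j)

/-- The singular members of a finite-dimensional linear system are defined by polynomial
equations. -/
theorem exists_equations_isSingular {X : Scheme.{0}} {f : X ⟶ SpecC} [UniversallyClosed f] {n : ℕ}
    (hf : SmoothOfRelativeDimension n f) {L : X.Modules} (hL : IsLineBundle L) {r : ℕ}
    (s : Fin r → H0 f L) :
    ∃ J : Set (MvPolynomial (Fin r) ℂ), ∀ l : Fin r → ℂ,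
      IsSingular (∑ i, l i • s i) ↔ ∀ p ∈ J, MvPolynomial.eval l p = 0 := by
  choose V e ι D hx he hDc hD using exists_jet_chart hf hL
  let a : ∀ x, Fin r → Γ(X, V x) := fun x i => (he x).coeff (s i).toSection
  -- The index `none` stands for the coefficient itself, `some j` for its derivative along D j.
  let F : ∀ c : Σ x, Option (ι x), Fin r → Γ(X, V c.1) := fun c i =>
    c.2.elim (a c.1 i) fun j => D c.1 j (a c.1 i)
  obtain ⟨J, hJ⟩ := exists_resultants f (fun c : Σ x, Option (ι x) => V c.1) F
  refine ⟨J, fun l => ?_⟩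
  rw [← hJ]
  refine exists_congr fun y => and_congr_right fun hy => ?_
  let S : ∀ x, Γ(X, V x) := fun x => ∑ i, scalars f (V x) (l i) * a x i
  have hS : ∀ x, res le_top (∑ i, l i • s i : H0 f L).toSection = S x • e x := by
    intro x
    rw [(he x).res_eq_coeff_smul]
    congr 1
    let κ : H0 f L →+ Γ(X, V x) :=
      AddMonoidHom.mk' (fun t => (he x).coeff t.toSection) fun s t => (he x).coeff_add _ _
    refine (map_sum κ _ _).trans (Finset.sum_congr rfl fun i _ => ?_)
    change (he x).coeff (l i • s i).toSection = _
    rw [H0.toSection_smul, (he x).coeff_smul, fres_scalars]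
  have hDS : ∀ x j, D x j (S x) = ∑ i, scalars f (V x) (l i) * D x j (a x i) := fun x j => by
    simp only [S, map_sum, hDc]
  have hjet : ∀ x (hyx : y ∈ V x), JetVanishesAt (∑ i, l i • s i : H0 f L).toSection y ↔
      X.presheaf.germ (V x) y hyx (S x) ∈ IsLocalRing.maximalIdeal (X.presheaf.stalk y) ∧
      ∀ j, X.presheaf.germ (V x) y hyx (D x j (S x)) ∈
        IsLocalRing.maximalIdeal (X.presheaf.stalk y) := fun x hyx => by
    rw [(he x).jetVanishesAt_iff hyx (hS x), hD x y hyx hy]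
  constructor
  · rintro h ⟨x, _ | j⟩
    · exact (notMem_basicOpen_iff _ _).mpr fun hyx => ((hjet x hyx).mp h).1
    · refine (notMem_basicOpen_iff _ _).mpr fun hyx => ?_
      have h1 := ((hjet x hyx).mp h).2 j
      rwa [hDS] at h1
  · intro h
    refine (hjet y (hx y)).mpr ⟨?_, fun j => ?_⟩
    · exact (notMem_basicOpen_iff _ _).mp (h ⟨y, none⟩) (hx y)
    · rw [hDS]
      exact (notMem_basicOpen_iff _ _).mp (h ⟨y, some j⟩) (hx y)

-- The equations of the singular sections need not be homogeneous, but singularity is invariant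
-- under scaling, so they hold along entire lines; for each equation this is a closed condition on
-- the line.
attribute [local instance] zariskiTopology in
theorem isClosed_discriminantLocus {X : Scheme.{0}} {f : X ⟶ SpecC} [UniversallyClosed f] {n : ℕ}
    (hf : SmoothOfRelativeDimension n f) {L : X.Modules} (hL : IsLineBundle L)
    (V : Submodule ℂ (H0 f L)) [FiniteDimensional ℂ V] : IsClosed (discriminantLocus V) := by
  let b := Module.finBasis ℂ V
  obtain ⟨J, hJ⟩ := exists_equations_isSingular hf hL fun i => (b i : H0 f L)
  have hsum : ∀ v : V, ∑ i, b.equivFun v i • (b i : H0 f L) = v := by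
    intro v
    conv_rhs => rw [← b.sum_equivFun v]
    exact (map_sum V.subtype (fun i => b.equivFun v i • b i) Finset.univ).symm
  have h1 : discriminantLocus V = ⋂ p ∈ J, {q | restrictLine (b.equivFun q.rep) p = 0} := by
    ext q
    simp only [Set.mem_iInter, Set.mem_ofPred_eq]
    have h2 : q ∈ discriminantLocus V ↔ IsSingular (q.rep : H0 f L) := by
      constructor
      · intro h
        exact isSingular_of_mk_mem q.rep_nonzero (by rwa [q.mk_rep])
      · intro h
        rw [← q.mk_rep]
        exact mem_discriminantLocus_mk q.rep_nonzero h
    rw [h2]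
    constructor
    · intro h p hp
      refine eq_zero_of_forall_eval fun t _ => ?_
      rw [eval_restrictLine, ← map_smul]
      refine (hJ _).mp ?_ p hp
      rw [hsum]
      exact isSingular_smul h t
    · intro h
      rw [← hsum q.rep, hJ]
      intro p hp
      have h3 := congrArg (Polynomial.eval 1) (h p hp)
      rwa [eval_restrictLine, one_smul, Polynomial.eval_zero] at h3
  rw [h1]
  exact isClosed_biInter fun p _ => isClosed_setOf_restrictLine b p

end DiscriminantDefect

theorem lemma3p2p0 {X X' : Scheme.{0}} (n : ℕ) (hn : 3 ≤ n)
    (f : X ⟶ DiscriminantDefect.SpecC)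
    (hX : DiscriminantDefect.IsSmoothProjectiveVariety f n)
    (L : X.Modules) (hL : DiscriminantDefect.IsLineBundle L)
    (hample : DiscriminantDefect.IsAmple L)
    (V : Submodule ℂ (DiscriminantDefect.H0 f L)) (hV : DiscriminantDefect.Spans V)
    (f' : X' ⟶ DiscriminantDefect.SpecC) (L' : X'.Modules) (σ : X ⟶ X')
    (hred : DiscriminantDefect.IsReduction f L f' L' n σ) :
    DiscriminantDefect.defect V ≤
        DiscriminantDefect.defect (⊤ : Submodule ℂ (DiscriminantDefect.H0 f' L')) ∧
      ∀ s : DiscriminantDefect.H0 f L, s ≠ 0 → ¬ DiscriminantDefect.IsSingular s →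
        ∃ s' : DiscriminantDefect.H0 f' L', s' ≠ 0 ∧ ¬ DiscriminantDefect.IsSingular s' ∧
          DiscriminantDefect.zeroLocus s' = σ '' DiscriminantDefect.zeroLocus s := by
  obtain ⟨φ, hφ, hsing, hzero⟩ := hred.exists_linearMap (by omega) hX hL
  have hX' := hred.isSmoothProjectiveVariety
  have := hX'.isIntegral
  have := hX'.isProper
  have := hred.isLineBundle.finiteDimensional_H0 f'
  exact ⟨DiscriminantDefect.defect_le_of_linearMap φ hφ hsing V
      (DiscriminantDefect.isClosed_discriminantLocus hX'.smooth hred.isLineBundle ⊤),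
    fun s hs hns => ⟨φ s, (map_ne_zero_iff φ hφ).mpr hs, fun h => hns (hsing s h), hzero s⟩⟩
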